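/- Let $n\ge1$ and $m\in\mathbf R$, and let $\hat u(\xi)=\int_{\mathbf R^n}u(x)e^{-ix\cdot\xi}\,dx$ be the Fourier transform $\mathcal F$, extended to tempered distributions; $\mathbf N=\{0,1,2,\dots\}$, $D=-i\partial$. Let $S^m$ be the space of classical (polyhomogeneous) symbols of order $m$ on $\mathbf R^n$: those $a\in C^\infty(\mathbf R^n)$ for which there are $a_{m-j}\in C^\infty(\mathbf R^n)$, $j\in\mathbf N$, positively homogeneous of degree $m-j$ for $|\xi|\ge1$, such that for every $k\in\mathbf N$ and every multiindex $\beta$, $\partial^\beta\big(a-\sum_{j<k}a_{m-j}\big)(\xi)=O((1+|\xi|)^{m-k-|\beta|})$ on $\mathbf R^n$. Let $\mathcal P_m$ be the space of polynomials on $\mathbf R^n$ of degree $\le m$ if $m\in\mathbf N$, and $\mathcal P_m=\{0\}$ if $m\notin\mathbf N$. Let $\theta=1-\chi$, where $\chi\in C^\infty_c(\mathbf R^n)$, $0\le\chi\le1$ and $\chi=1$ near the origin. For $s\in\mathbf R$, let $\mathcal C_s$ be the space of all distributions on $\mathbf R^n$ of the form $$(r^sF(r,\zeta))^{\textstyle\cdot}+G(r\zeta)\log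 r+P(D)\delta_0+H,$$ where $x=r\zeta$ ($r\ge0$, $\zeta\in S^{n-1}$) are polar coordinates; $F\in C^\infty([0,\infty)\times S^{n-1})$ and $G\in C^\infty(\mathbf R^n)$ vanish for $r\ge1$; if $s\in\mathbf Z$, all derivatives of $G$ of order $<s$ vanish at the origin (no condition if $s\le0$), while $G=0$ if $s\notin\mathbf Z$; $P$ is a polynomial of degree $\le-s-n$ if $-s-n\in\mathbf N$, and $P=0$ otherwise; $H$ is a Schwartz function; and $(r^sF)^{\textstyle\cdot}$ is the prolongation of $r^sF$ from $\mathbf R^n\setminus\{0\}$ to $\mathbf R^n$ given by the Hadamard finite part of $\int r^sF\,\varphi\,dx$ at the origin. (i) $\mathcal F$ maps $S^m$ into $\mathcal C_{-n-m}$. (ii) In fact, $\mathcal F$ is a bijection of $$S^m+\theta\mathcal P_m\log:=\{a+\theta p\log|\cdot|:\ a\in S^m,\ p\in\mathcal P_m\}$$ onto $\mathcal C_{-n-m}$. -/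

import Mathlib

open Real Set Filter Topology MeasureTheory
open scoped ContDiff SchwartzMap FourierTransform LineDeriv InnerProductSpace

noncomputable section

/-- The space `ℝⁿ` with the Euclidean norm. -/
abbrev Rn (n : ℕ) : Type := EuclideanSpace ℝ (Fin n)

/-! ### The Fourier transform `û(ξ) = ∫ e^{-i x·ξ} u(x) dx` -/

/-- Dilation by `(2π)⁻¹` on `ℝⁿ`. -/
def dilationEquiv (n : ℕ) : Rn n ≃L[ℝ] Rn n :=
  ContinuousLinearEquiv.smulLeft (Units.mk0 ((2 * π)⁻¹ : ℝ) (inv_ne_zero two_pi_pos.ne'))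

/-- The Fourier transform `φ ↦ (ξ ↦ ∫ e^{-i x·ξ} φ(x) dx)` on Schwartz functions. It is Mathlib's
transform (with kernel `e^{-2πi x·ξ}`) evaluated at `(2π)⁻¹ ξ`. -/
def schwartzFourier (n : ℕ) : 𝓢(Rn n, ℂ) →L[ℂ] 𝓢(Rn n, ℂ) :=
  (SchwartzMap.compCLMOfContinuousLinearEquiv ℂ (dilationEquiv n)).comp
    (FourierTransform.fourierCLM ℂ 𝓢(Rn n, ℂ))

theorem schwartzFourier_apply {n : ℕ} (φ : 𝓢(Rn n, ℂ)) (ξ : Rn n) :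
    schwartzFourier n φ ξ = ∫ x, Complex.exp (-(Complex.I * (⟪x, ξ⟫_ℝ : ℝ))) * φ x := by
  have h : schwartzFourier n φ ξ = 𝓕 (φ : Rn n → ℂ) ((2 * π)⁻¹ • ξ) := by
    rw [← SchwartzMap.fourier_coe]; rfl
  rw [h, Real.fourier_eq']
  refine integral_congr_ae (Eventually.of_forall fun x => ?_)
  have h2 : (2 * (π : ℂ)) ≠ 0 := by exact_mod_cast two_pi_pos.ne'
  simp only [inner_smul_right, smul_eq_mul]
  congr 2
  push_cast
  field_simp

/-- The Fourier transform of tempered distributions, `⟨T̂, φ⟩ = ⟨T, φ̂⟩`. -/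
def distFourier (n : ℕ) (T : 𝓢'(Rn n, ℂ)) : 𝓢'(Rn n, ℂ) :=
  PointwiseConvergenceCLM.precomp ℂ (schwartzFourier n) T

/-- The tempered distribution `T` is given by integration against the function `f`. -/
def IsGivenBy {n : ℕ} (T : 𝓢'(Rn n, ℂ)) (f : Rn n → ℂ) : Prop :=
  ∀ φ : 𝓢(Rn n, ℂ), Integrable (fun x => f x * φ x) ∧ T φ = ∫ x, f x * φ x

/-! ### Symbols -/

/-- Symbol estimates of order `m`: `a ∈ C^∞(ℝⁿ)` and `∂^β a(ξ) = O((1 + |ξ|)^{m - |β|})` for all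
multiindices `β`. -/
def IsSymbol {n : ℕ} (m : ℝ) (a : Rn n → ℂ) : Prop :=
  ContDiff ℝ ∞ a ∧
    ∀ k : ℕ, ∃ C : ℝ, ∀ ξ : Rn n, ‖iteratedFDeriv ℝ k a ξ‖ ≤ C * (1 + ‖ξ‖) ^ (m - k)

/-- Classical (polyhomogeneous) symbols of order `m`: `a ∼ ∑ⱼ a_{m-j}`, where `a_{m-j}` is smooth
on `ℝⁿ` and positively homogeneous of degree `m - j` for `|ξ| ≥ 1`, and `∼` means that
`a - ∑_{j<k} a_{m-j}` is a symbol of order `m - k` for each `k`. -/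
def IsClassicalSymbol {n : ℕ} (m : ℝ) (a : Rn n → ℂ) : Prop :=
  ContDiff ℝ ∞ a ∧ ∃ b : ℕ → Rn n → ℂ,
    (∀ j, ContDiff ℝ ∞ (b j)) ∧
    (∀ j, ∀ t : ℝ, 1 ≤ t → ∀ ξ : Rn n, 1 ≤ ‖ξ‖ → b j (t • ξ) = ((t ^ (m - j) : ℝ) : ℂ) * b j ξ) ∧
    ∀ k : ℕ, IsSymbol (m - k) (fun ξ => a ξ - ∑ j ∈ Finset.range k, b j ξ)

/-- Cutoff functions: `χ ∈ 𝒟(ℝⁿ)`, `0 ≤ χ ≤ 1`, `χ = 1` near the origin. -/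
def IsCutoff {n : ℕ} (χ : Rn n → ℝ) : Prop :=
  ContDiff ℝ ∞ χ ∧ HasCompactSupport χ ∧ (∀ x, 0 ≤ χ x ∧ χ x ≤ 1) ∧ ∀ᶠ x in 𝓝 0, χ x = 1

/-- Patch functions: `θ = 1 - χ` with `χ` a cutoff function. -/
def IsPatch {n : ℕ} (θ : Rn n → ℝ) : Prop :=
  ∃ χ : Rn n → ℝ, IsCutoff χ ∧ ∀ x, θ x = 1 - χ x

/-- The polynomials on `ℝⁿ` with complex coefficients of degree at most `d` if `d` is a nonnegative
integer, and the zero polynomial alone for every other real `d`. -/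
def polysOfDegree (n : ℕ) (d : ℝ) : Set (MvPolynomial (Fin n) ℂ) :=
  {p | p = 0 ∨ ∃ k : ℕ, (k : ℝ) = d ∧ p.totalDegree ≤ k}

/-- The value of a polynomial at a point of `ℝⁿ`. -/
def polyEval {n : ℕ} (p : MvPolynomial (Fin n) ℂ) (x : Rn n) : ℂ :=
  MvPolynomial.eval (fun i => (x i : ℂ)) p

/-- The space `S^m` of classical symbols of order `m` on `ℝⁿ`, as tempered distributions. -/
def symbolSpace (n : ℕ) (m : ℝ) : Set 𝓢'(Rn n, ℂ) :=
  {T | ∃ a : Rn n → ℂ, IsClassicalSymbol m a ∧ IsGivenBy T a}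

/-- The space `S^m + θ 𝒫_m log = {a + θ p log|·| : a ∈ S^m, p ∈ 𝒫_m}`, as tempered
distributions. -/
def logSymbolSpace (n : ℕ) (m : ℝ) (θ : Rn n → ℝ) : Set 𝓢'(Rn n, ℂ) :=
  {T | ∃ (a : Rn n → ℂ) (p : MvPolynomial (Fin n) ℂ),
    IsClassicalSymbol m a ∧ p ∈ polysOfDegree n m ∧
    IsGivenBy T (fun ξ => a ξ + (θ ξ : ℂ) * polyEval p ξ * (Real.log ‖ξ‖ : ℂ))}

/-! ### The spaces `𝒞_s` -/

/-- `L` is the Hadamard finite part of `I ε` as `ε ↘ 0`: the limit that is left after removing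
divergent terms `c ε^a` (`a < 0`) and `b log ε`, finitely many in number. -/
def IsFinitePart (I : ℝ → ℂ) (L : ℂ) : Prop :=
  ∃ (A : Finset ℝ) (c : ℝ → ℂ) (b : ℂ), (∀ a ∈ A, a < 0) ∧
    Tendsto (fun ε : ℝ => I ε - ∑ a ∈ A, c a * ((ε ^ a : ℝ) : ℂ) - b * (Real.log ε : ℂ))
      (𝓝[>] 0) (𝓝 L)

/-- `T` is the (finite part) prolongation to `ℝⁿ` of the function `u` on `ℝⁿ ∖ {0}`. -/
def IsProlongation {n : ℕ} (T : 𝓢'(Rn n, ℂ)) (u : Rn n → ℂ) : Prop :=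
  ∀ φ : 𝓢(Rn n, ℂ), IsFinitePart (fun ε => ∫ x in {x : Rn n | ε ≤ ‖x‖}, u x * φ x) (T φ)

/-- `F ∈ C^∞([0,∞) × S^{n-1})`, for a function `F` of which only the values at `(r, ζ)` with
`0 ≤ r` and `|ζ| = 1` matter: the extension of `F` that is homogeneous of degree `0` in the second
variable is smooth on `[0,∞) × (ℝⁿ ∖ {0})`, up to the boundary `r = 0`. -/
def IsSmoothPolar {n : ℕ} (F : ℝ → Rn n → ℂ) : Prop :=
  ContDiffOn ℝ ∞ (fun q : ℝ × Rn n => F q.1 (‖q.2‖⁻¹ • q.2)) (Ici 0 ×ˢ {0}ᶜ)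

/-- `D^α T = (-i)^{|α|} ∂^α T` for a tempered distribution `T` and a multiindex `α`. -/
def multiD {n : ℕ} (α : Fin n →₀ ℕ) (T : 𝓢'(Rn n, ℂ)) : 𝓢'(Rn n, ℂ) :=
  (List.finRange n).foldr
    (fun j S => (fun V : 𝓢'(Rn n, ℂ) =>
      (-Complex.I) • ∂_{(EuclideanSpace.single j 1 : Rn n)} V)^[α j] S) T

/-- `P(D) T` for a polynomial `P` and a tempered distribution `T`. -/
def polyD {n : ℕ} (P : MvPolynomial (Fin n) ℂ) (T : 𝓢'(Rn n, ℂ)) : 𝓢'(Rn n, ℂ) :=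
  ∑ α ∈ P.support, P.coeff α • multiD α T

/-- The space `𝒞_s` of all distributions `(r^s F(r,ζ))˙ + G(rζ) log r + P(D)δ₀ + H` on `ℝⁿ`, where
`F ∈ C^∞([0,∞) × S^{n-1})` and `G ∈ C^∞(ℝⁿ)` vanish for `r ≥ 1`, `G` vanishes to order `s` at the
origin (no condition for `s ≤ 0`) if `s` is an integer and `G = 0` if not, `P` is a polynomial of
degree at most `-s-n` (so `P = 0` unless `-s-n` is a nonnegative integer), and `H` is a Schwartz
function. -/
def spaceC (n : ℕ) (s : ℝ) : Set 𝓢'(Rn n, ℂ) :=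
  {T | ∃ (F : ℝ → Rn n → ℂ) (G : Rn n → ℂ) (P : MvPolynomial (Fin n) ℂ) (H : 𝓢(Rn n, ℂ))
      (T₁ T₂ : 𝓢'(Rn n, ℂ)),
    IsSmoothPolar F ∧ (∀ r ζ, 1 ≤ r → ‖ζ‖ = 1 → F r ζ = 0) ∧
    ContDiff ℝ ∞ G ∧ (∀ x, 1 ≤ ‖x‖ → G x = 0) ∧
    (∀ j : ℕ, (j : ℝ) < s → iteratedFDeriv ℝ j G 0 = 0) ∧
    ((¬ ∃ k : ℤ, (k : ℝ) = s) → ∀ x, G x = 0) ∧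
    P ∈ polysOfDegree n (-s - n) ∧
    IsProlongation T₁ (fun x => ((‖x‖ ^ s : ℝ) : ℂ) * F ‖x‖ (‖x‖⁻¹ • x)) ∧
    IsGivenBy T₂ (fun x => G x * (Real.log ‖x‖ : ℂ)) ∧
    T = T₁ + T₂ + polyD P (TemperedDistribution.delta 0)
      + SchwartzMap.toTemperedDistributionCLM (Rn n) ℂ volume H}

end

/-! The Fourier transform exchanges homogeneous behaviour of degree `μ` at infinity with homogeneous
singularities of degree `-n - μ` at the origin. The correspondence is built term by term from tails
`tail σ φ x = ∫_1^∞ t^(-σ-1) φ(t x) dt` of Schwartz functions. A tail decays rapidly at infinity,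
and off the origin it is `f - p log|x| - E` with `f` homogeneous of degree `σ`, `p` a homogeneous
polynomial of degree `σ` and `E` smooth (`exists_decomp`). As the tail is negligible at infinity,
`E` behaves there like `f - p log|x|`. So one decomposition describes both a singularity at the
origin (the tail) and a symbol (`E`).

Dilation by `t` becomes dilation by `1/t` under the transform, with a factor `t^(-n)`. Parseval
therefore pairs `∫_ε^1 t^(-μ-1) φ(t ξ) dt` with `∫_1^(1/ε) t^(-s-1) φ̂(t x) dt` when `s = -n - μ`.
Finite parts as `ε → 0` show that the prolongation of `tail s φ̂` is the transform of `E + q`, where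
`q` is a homogeneous polynomial of degree `μ` (`exists_prolongation_tail`). Tails realize every
homogeneous function and every term `p log|x|`. Hence each singular term has a matching symbol term,
and each symbol term has a matching singular term up to a polynomial (`exists_corr_of_singular`,
`exists_corr_of_symbol`). Polynomials transform into `P(D)δ`.

Truncating an expansion at the origin leaves a function that is `O(|x|^σ)` with derivatives, `σ`
large. Its transform is a symbol of very negative order (`isSymbol_invFourier`). For surjectivity,
the singularity is expanded and transformed termwise; its preimage already exists as a distribution,
so no asymptotic summation is needed on the symbol side (`exists_symbol_of_expansion`). For the
converse inclusion, the singular terms that match a symbol are Borel summed (`exists_polar_sum`,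
`exists_smooth_with_taylor`), and the symbol of this sum differs from the given one by a polynomial
and a Schwartz function. Injectivity is that of the transform on tempered distributions. -/

noncomputable section

/-! ### Weighted bounds for derivatives -/

section PBound

variable {n : ℕ} {F F₁ F₂ : Type*} [NormedAddCommGroup F] [NormedSpace ℝ F]
  [NormedAddCommGroup F₁] [NormedSpace ℝ F₁] [NormedAddCommGroup F₂] [NormedSpace ℝ F₂]

/-- `u` is smooth away from the origin and `∂^β u = O(|x|^{σ - |β|})` on `A`. -/
def PBound (σ : ℝ) (A : Set (Rn n)) (u : Rn n → F) : Prop :=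
  ContDiffOn ℝ ∞ u {0}ᶜ ∧
    ∀ k : ℕ, ∃ C : ℝ, ∀ x ∈ A, x ≠ 0 → ‖iteratedFDeriv ℝ k u x‖ ≤ C * ‖x‖ ^ (σ - k)

/-- The bounds `∂^β u = O(|x|^{σ - |β|})` near the origin. -/
abbrev NearBound (σ : ℝ) (u : Rn n → F) : Prop := PBound σ {x : Rn n | ‖x‖ ≤ 1} u

/-- The bounds `∂^β u = O(|x|^{σ - |β|})` near infinity. -/
abbrev FarBound (σ : ℝ) (u : Rn n → F) : Prop := PBound σ {x : Rn n | 1 ≤ ‖x‖} u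

theorem isOpen_compl_zero : IsOpen ({0}ᶜ : Set (Rn n)) := isOpen_compl_singleton

theorem contDiffAt_of_off {u : Rn n → F} (h : ContDiffOn ℝ ∞ u {0}ᶜ) {x : Rn n} (hx : x ≠ 0)
    (k : ℕ) : ContDiffAt ℝ k u x :=
  ((h.contDiffAt (isOpen_compl_zero.mem_nhds hx)).of_le (by exact_mod_cast le_top))

variable {σ τ : ℝ} {A : Set (Rn n)}

theorem PBound.bound {u : Rn n → F} (h : PBound σ A u) (k : ℕ) : ∃ C : ℝ, 0 ≤ C ∧
    ∀ x ∈ A, x ≠ 0 → ‖iteratedFDeriv ℝ k u x‖ ≤ C * ‖x‖ ^ (σ - k) := by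
  obtain ⟨C, hC⟩ := h.2 k
  refine ⟨|C|, abs_nonneg _, fun x hx h0 => (hC x hx h0).trans ?_⟩
  gcongr
  exact le_abs_self C

theorem PBound.norm_le {u : Rn n → F} (h : PBound σ A u) : ∃ C : ℝ, 0 ≤ C ∧
    ∀ x ∈ A, x ≠ 0 → ‖u x‖ ≤ C * ‖x‖ ^ σ := by
  simpa using h.bound 0

theorem iteratedFDeriv_congr_off {u v : Rn n → F} (h : ∀ x, x ≠ 0 → u x = v x) {x : Rn n}
    (hx : x ≠ 0) (k : ℕ) : iteratedFDeriv ℝ k u x = iteratedFDeriv ℝ k v x :=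
  (Filter.EventuallyEq.iteratedFDeriv ℝ
    (Filter.eventuallyEq_of_mem (isOpen_compl_zero.mem_nhds hx) fun y hy => h y hy) k).eq_of_nhds

theorem PBound.congr {u v : Rn n → F} (hu : PBound σ A u) (h : ∀ x, x ≠ 0 → u x = v x) :
    PBound σ A v := by
  refine ⟨hu.1.congr fun x hx => (h x hx).symm, fun k => ?_⟩
  obtain ⟨C, hC⟩ := hu.2 k
  exact ⟨C, fun x hx h0 => by rw [← iteratedFDeriv_congr_off h h0]; exact hC x hx h0⟩

theorem PBound.add {u v : Rn n → F} (hu : PBound σ A u) (hv : PBound σ A v) :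
    PBound σ A (fun x => u x + v x) := by
  refine ⟨hu.1.add hv.1, fun k => ?_⟩
  obtain ⟨C, hC⟩ := hu.2 k
  obtain ⟨C', hC'⟩ := hv.2 k
  refine ⟨C + C', fun x hx h0 => ?_⟩
  have := iteratedFDeriv_add_apply (𝕜 := ℝ) (i := k) (contDiffAt_of_off hu.1 h0 k)
    (contDiffAt_of_off hv.1 h0 k)
  have e : (fun x => u x + v x) = u + v := rfl
  rw [e, this, add_mul]
  exact (norm_add_le _ _).trans (add_le_add (hC x hx h0) (hC' x hx h0))

theorem PBound.zero : PBound σ A (fun _ : Rn n => (0 : F)) := by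
  refine ⟨contDiffOn_const, fun k => ⟨0, fun x _ _ => ?_⟩⟩
  have : iteratedFDeriv ℝ k (fun _ : Rn n => (0 : F)) = 0 := iteratedFDeriv_fun_zero
  simp [this]

/-- Leibniz' rule: the weights `|x|^(σ-i)` and `|x|^(τ-(k-i))` always multiply to `|x|^(σ+τ-k)`. -/
theorem PBound.bilin (B : F₁ →L[ℝ] F₂ →L[ℝ] F) {u : Rn n → F₁} {v : Rn n → F₂}
    (hu : PBound σ A u) (hv : PBound τ A v) : PBound (σ + τ) A (fun x => B (u x) (v x)) := by
  refine ⟨B.isBoundedBilinearMap.contDiff.comp_contDiffOn (hu.1.prodMk hv.1), fun k => ?_⟩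
  choose C hC0 hC using hu.bound
  choose C' hC0' hC' using hv.bound
  refine ⟨‖B‖ * ∑ i ∈ Finset.range (k + 1), (k.choose i : ℝ) * C i * C' (k - i),
    fun x hx h0 => ?_⟩
  have hx0 : 0 < ‖x‖ := norm_pos_iff.2 h0
  have key := B.norm_iteratedFDerivWithin_le_of_bilinear hu.1 hv.1
    isOpen_compl_zero.uniqueDiffOn (x := x) h0 (n := k) (by exact_mod_cast le_top)
  have e1 := fun i => iteratedFDerivWithin_of_isOpen (𝕜 := ℝ) (f := u) i isOpen_compl_zero h0
  have e2 := fun i => iteratedFDerivWithin_of_isOpen (𝕜 := ℝ) (f := v) i isOpen_compl_zero h0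
  have e3 := fun i => iteratedFDerivWithin_of_isOpen (𝕜 := ℝ) (f := fun x => B (u x) (v x)) i
    isOpen_compl_zero h0
  simp only [e1, e2, e3] at key
  refine key.trans ?_
  rw [mul_assoc, Finset.sum_mul]
  refine mul_le_mul_of_nonneg_left (Finset.sum_le_sum fun i hi => ?_) B.opNorm_nonneg
  have hik : i ≤ k := Nat.lt_succ_iff.1 (Finset.mem_range.1 hi)
  have hpow : ‖x‖ ^ (σ + τ - k) = ‖x‖ ^ (σ - i) * ‖x‖ ^ (τ - (k - i : ℕ)) := by
    rw [← rpow_add hx0]; congr 1; push_cast [hik]; ring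
  rw [hpow]
  calc _ ≤ (k.choose i : ℝ) * (C i * ‖x‖ ^ (σ - i)) * (C' (k - i) * ‖x‖ ^ (τ - (k - i : ℕ))) := by
        exact mul_le_mul (mul_le_mul_of_nonneg_left (hC i x hx h0) (Nat.cast_nonneg _))
          (hC' (k - i) x hx h0) (norm_nonneg _) (mul_nonneg (Nat.cast_nonneg _)
            (mul_nonneg (hC0 i) (rpow_nonneg (norm_nonneg _) _)))
    _ = _ := by ring

theorem PBound.mul {u v : Rn n → ℂ} (hu : PBound σ A u) (hv : PBound τ A v) :
    PBound (σ + τ) A (fun x => u x * v x) :=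
  PBound.bilin (ContinuousLinearMap.mul ℝ ℂ) hu hv

theorem PBound.clm (L : F₁ →L[ℝ] F) {u : Rn n → F₁} (hu : PBound σ A u) :
    PBound σ A (fun x => L (u x)) := by
  refine ⟨L.contDiff.comp_contDiffOn hu.1, fun k => ?_⟩
  obtain ⟨C, hC⟩ := hu.2 k
  refine ⟨‖L‖ * C, fun x hx h0 => ?_⟩
  have := L.norm_iteratedFDeriv_comp_left (contDiffAt_of_off hu.1 h0 k) le_rfl
  refine this.trans ?_
  rw [mul_assoc]
  exact mul_le_mul_of_nonneg_left (hC x hx h0) (norm_nonneg _)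

theorem PBound.const_mul {u : Rn n → ℂ} (c : ℂ) (hu : PBound σ A u) :
    PBound σ A (fun x => c * u x) :=
  PBound.clm (ContinuousLinearMap.mul ℝ ℂ c) hu

theorem PBound.neg {u : Rn n → ℂ} (hu : PBound σ A u) : PBound σ A (fun x => - u x) :=
  (hu.const_mul (-1)).congr fun x _ => by ring

theorem PBound.sub {u v : Rn n → ℂ} (hu : PBound σ A u) (hv : PBound σ A v) :
    PBound σ A (fun x => u x - v x) :=
  (hu.add hv.neg).congr fun x _ => by ring

theorem PBound.sum {ι : Type*} {s : Finset ι} {u : ι → Rn n → ℂ}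
    (h : ∀ i ∈ s, PBound σ A (u i)) : PBound σ A (fun x => ∑ i ∈ s, u i x) := by
  classical
  induction s using Finset.induction_on with
  | empty => simpa using PBound.zero
  | insert a s ha ih =>
    simp only [Finset.sum_insert ha]
    exact (h a (Finset.mem_insert_self _ _)).add
      (ih fun i hi => h i (Finset.mem_insert_of_mem hi))

theorem NearBound.mono {u : Rn n → F} (hu : NearBound σ u) (h : τ ≤ σ) : NearBound τ u := by
  refine ⟨hu.1, fun k => ?_⟩
  obtain ⟨C, hC0, hC⟩ := hu.bound k
  refine ⟨C, fun x hx h0 => (hC x hx h0).trans ?_⟩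
  exact mul_le_mul_of_nonneg_left
    (rpow_le_rpow_of_exponent_ge (norm_pos_iff.2 h0) hx (by linarith)) hC0

theorem FarBound.mono {u : Rn n → F} (hu : FarBound σ u) (h : σ ≤ τ) : FarBound τ u := by
  refine ⟨hu.1, fun k => ?_⟩
  obtain ⟨C, hC0, hC⟩ := hu.bound k
  refine ⟨C, fun x hx h0 => (hC x hx h0).trans ?_⟩
  exact mul_le_mul_of_nonneg_left (rpow_le_rpow_of_exponent_le hx (by linarith)) hC0

/-- Dilations by `ρ ≠ 0`. -/
def dil (n : ℕ) (ρ : ℝ) (h : ρ ≠ 0) : Rn n ≃L[ℝ] Rn n :=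
  ContinuousLinearEquiv.smulLeft (Units.mk0 ρ h)

theorem dil_apply (ρ : ℝ) (h : ρ ≠ 0) (x : Rn n) : dil n ρ h x = ρ • x := rfl

theorem norm_iteratedFDeriv_comp_dil {ρ : ℝ} (h : 0 < ρ) (u : Rn n → F) (k : ℕ) (y : Rn n) :
    ‖iteratedFDeriv ℝ k (fun y => u (ρ • y)) y‖ = ρ ^ k * ‖iteratedFDeriv ℝ k u (ρ • y)‖ := by
  have key := (dil n ρ h.ne').iteratedFDerivWithin_comp_right u (s := univ) (x := y)
    uniqueDiffOn_univ (mem_univ _) k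
  rw [preimage_univ, iteratedFDerivWithin_univ, iteratedFDerivWithin_univ] at key
  have e : (fun y => u (ρ • y)) = u ∘ (dil n ρ h.ne') := rfl
  have e2 : (iteratedFDeriv ℝ k u (ρ • y)).compContinuousLinearMap
      (fun _ => ((dil n ρ h.ne' : Rn n ≃L[ℝ] Rn n) : Rn n →L[ℝ] Rn n))
      = ρ ^ k • iteratedFDeriv ℝ k u (ρ • y) := by
    ext m
    simp only [ContinuousMultilinearMap.compContinuousLinearMap_apply,
      ContinuousLinearEquiv.coe_coe, dil_apply, _root_.smul_apply]
    have := (iteratedFDeriv ℝ k u (ρ • y)).map_smul_univ (fun _ => ρ) m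
    simpa using this
  rw [e, key, dil_apply, e2, norm_smul, norm_pow, Real.norm_of_nonneg h.le]

/-- Bounds for the derivatives of `y ↦ u(ρ y)` on the unit sphere give weighted bounds for `u`. -/
theorem pbound_of_scaling {u : Rn n → F} (hu : ContDiffOn ℝ ∞ u {0}ᶜ)
    (h : ∀ k : ℕ, ∃ C : ℝ, ∀ ρ : ℝ, 0 < ρ → ∀ y : Rn n, ‖y‖ = 1 → ρ • y ∈ A →
      ‖iteratedFDeriv ℝ k (fun y => u (ρ • y)) y‖ ≤ C * ρ ^ σ) : PBound σ A u := by
  refine ⟨hu, fun k => ?_⟩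
  obtain ⟨C, hC⟩ := h k
  refine ⟨C, fun x hx h0 => ?_⟩
  have hx0 : 0 < ‖x‖ := norm_pos_iff.2 h0
  have e : ‖x‖ • (‖x‖⁻¹ • x) = x := smul_inv_smul₀ hx0.ne' x
  have h1 : ‖‖x‖⁻¹ • x‖ = 1 := by
    rw [norm_smul, norm_inv, norm_norm, inv_mul_cancel₀ hx0.ne']
  -- With `ρ = |x|` and `y = x/|x|`, the chain rule factor `ρ ^ k` turns the bound `ρ ^ σ` into
  -- `|x|^(σ-k)`.
  have := hC ‖x‖ hx0 (‖x‖⁻¹ • x) h1 (by rwa [e])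
  rw [norm_iteratedFDeriv_comp_dil hx0, e] at this
  rw [rpow_sub hx0, rpow_natCast, ← mul_div_assoc, le_div_iff₀ (by positivity)]
  linarith

theorem exists_bound_sphere {u : Rn n → F} (hu : ContDiffOn ℝ ∞ u {0}ᶜ) (k : ℕ) :
    ∃ C : ℝ, 0 ≤ C ∧ ∀ y : Rn n, ‖y‖ = 1 → ‖iteratedFDeriv ℝ k u y‖ ≤ C := by
  have hc : ContinuousOn (iteratedFDeriv ℝ k u) (Metric.sphere (0 : Rn n) 1) := by
    intro y hy
    have hy0 : y ≠ 0 := by rintro rfl; simp at hy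
    exact ((contDiffAt_of_off hu hy0 k).continuousAt_iteratedFDeriv le_rfl).continuousWithinAt
  obtain ⟨C, hC⟩ := (isCompact_sphere (0 : Rn n) 1).exists_bound_of_continuousOn hc
  exact ⟨|C|, abs_nonneg _, fun y hy => (hC y (by simpa using hy)).trans (le_abs_self C)⟩

theorem exists_bound_ball {u : Rn n → F} (hu : ContDiff ℝ ∞ u) (k : ℕ) (R : ℝ) :
    ∃ C : ℝ, 0 ≤ C ∧ ∀ y : Rn n, ‖y‖ ≤ R → ‖iteratedFDeriv ℝ k u y‖ ≤ C := by
  have hc : Continuous (iteratedFDeriv ℝ k u) :=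
    hu.continuous_iteratedFDeriv (by exact_mod_cast le_top)
  obtain ⟨C, hC⟩ := (isCompact_closedBall (0 : Rn n) R).exists_bound_of_continuousOn hc.continuousOn
  exact ⟨|C|, abs_nonneg _, fun y hy => (hC y (by simpa using hy)).trans (le_abs_self C)⟩

theorem PBound.fderiv {u : Rn n → F} (hu : PBound σ A u) : PBound (σ - 1) A (fderiv ℝ u) := by
  refine ⟨hu.1.fderiv_of_isOpen isOpen_compl_zero (by norm_num), fun k => ?_⟩
  obtain ⟨C, hC⟩ := hu.2 (k + 1)
  refine ⟨C, fun x hx h0 => ?_⟩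
  rw [norm_iteratedFDeriv_fderiv]
  convert hC x hx h0 using 3
  push_cast; ring

/-- In the unit ball `|x|^(-k) ≥ 1`, so bounded derivatives suffice. -/
theorem nearBound_of_contDiff {u : Rn n → F} (hu : ContDiff ℝ ∞ u) : NearBound 0 u := by
  refine ⟨hu.contDiffOn, fun k => ?_⟩
  obtain ⟨C, hC0, hC⟩ := exists_bound_ball hu k 1
  refine ⟨C, fun x hx h0 => (hC x hx).trans ?_⟩
  refine le_mul_of_one_le_right hC0 (one_le_rpow_of_pos_of_le_one_of_nonpos
    (norm_pos_iff.2 h0) hx (by simp))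

end PBound

/-! ### Homogeneous functions and polynomials -/

section Hom

variable {n : ℕ} {σ τ : ℝ}

/-- Smooth functions on `ℝⁿ ∖ {0}` that are positively homogeneous of degree `σ`. -/
def HomFun (σ : ℝ) (f : Rn n → ℂ) : Prop :=
  ContDiffOn ℝ ∞ f {0}ᶜ ∧ ∀ t : ℝ, 0 < t → ∀ x, x ≠ 0 → f (t • x) = ((t ^ σ : ℝ) : ℂ) * f x

/-- Dilation only multiplies `f` by `ρ ^ σ`, so bounds on the unit sphere give bounds everywhere,
near the origin and near infinity alike. -/
theorem HomFun.pbound {f : Rn n → ℂ} (hf : HomFun σ f) (A : Set (Rn n)) : PBound σ A f := by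
  refine pbound_of_scaling hf.1 fun k => ?_
  obtain ⟨C, hC0, hC⟩ := exists_bound_sphere hf.1 k
  refine ⟨C, fun ρ hρ y hy _ => ?_⟩
  have hy0 : y ≠ 0 := by rintro rfl; simp at hy
  rw [iteratedFDeriv_congr_off (v := fun y => (ρ ^ σ : ℝ) • f y)
    (fun x hx => by rw [hf.2 ρ hρ x hx]; simp) hy0]
  have := iteratedFDeriv_const_smul_apply (𝕜 := ℝ) (a := (ρ ^ σ : ℝ)) (contDiffAt_of_off hf.1 hy0 k)
  have e : (fun y => (ρ ^ σ : ℝ) • f y) = (ρ ^ σ : ℝ) • f := rfl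
  rw [e, this, norm_smul, Real.norm_of_nonneg (by positivity), mul_comm]
  exact mul_le_mul_of_nonneg_right (hC y hy) (by positivity)

theorem HomFun.add {f g : Rn n → ℂ} (hf : HomFun σ f) (hg : HomFun σ g) :
    HomFun σ (fun x => f x + g x) :=
  ⟨hf.1.add hg.1, fun t ht x hx => by
    beta_reduce; rw [hf.2 t ht x hx, hg.2 t ht x hx]; ring⟩

theorem HomFun.mul {f g : Rn n → ℂ} (hf : HomFun σ f) (hg : HomFun τ g) :
    HomFun (σ + τ) (fun x => f x * g x) :=
  ⟨hf.1.mul hg.1, fun t ht x hx => by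
    beta_reduce; rw [hf.2 t ht x hx, hg.2 t ht x hx, rpow_add ht]; push_cast; ring⟩

theorem HomFun.const_mul {f : Rn n → ℂ} (c : ℂ) (hf : HomFun σ f) :
    HomFun σ (fun x => c * f x) :=
  ⟨contDiffOn_const.mul hf.1, fun t ht x hx => by
    beta_reduce; rw [hf.2 t ht x hx]; ring⟩

theorem HomFun.zero : HomFun σ (fun _ : Rn n => (0 : ℂ)) :=
  ⟨contDiffOn_const, fun t ht x hx => by simp⟩

theorem HomFun.sum {ι : Type*} {s : Finset ι} {f : ι → Rn n → ℂ}
    (h : ∀ i ∈ s, HomFun σ (f i)) : HomFun σ (fun x => ∑ i ∈ s, f i x) :=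
  ⟨ContDiffOn.sum fun i hi => (h i hi).1, fun t ht x hx => by
    beta_reduce; rw [Finset.mul_sum]
    exact Finset.sum_congr rfl fun i hi => (h i hi).2 t ht x hx⟩

theorem contDiffOn_norm_off : ContDiffOn ℝ ∞ (fun x : Rn n => ‖x‖) {0}ᶜ :=
  fun _ hx => (contDiffAt_norm ℝ hx).contDiffWithinAt

theorem homFun_norm_rpow (σ : ℝ) : HomFun σ (fun x : Rn n => ((‖x‖ ^ σ : ℝ) : ℂ)) := by
  refine ⟨?_, fun t ht x hx => ?_⟩
  · exact Complex.ofRealCLM.contDiff.comp_contDiffOn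
      (contDiffOn_norm_off.rpow_const_of_ne fun _ hx => norm_ne_zero_iff.2 hx)
  · beta_reduce; rw [norm_smul, Real.norm_of_nonneg ht.le, mul_rpow ht.le (norm_nonneg _)]; push_cast; rfl

theorem contDiffOn_log_norm : ContDiffOn ℝ ∞ (fun x : Rn n => (Real.log ‖x‖ : ℂ)) {0}ᶜ :=
  Complex.ofRealCLM.contDiff.comp_contDiffOn
    (contDiffOn_norm_off.log fun _ hx => norm_ne_zero_iff.2 hx)

/-- On the sphere of radius `ρ` the function is `log ρ + log|y|`. The constant `log ρ` matters only
for `k = 0`; the condition `1 ≤ C * ρ ^ σ` pays for the bounded derivatives of `log|y|`. -/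
theorem pbound_log {A : Set (Rn n)} {C : ℝ} (hA : ∀ ρ : ℝ, 0 < ρ → ∀ y : Rn n, ‖y‖ = 1 →
    ρ • y ∈ A → |Real.log ρ| ≤ C * ρ ^ σ ∧ 1 ≤ C * ρ ^ σ) :
    PBound σ A (fun x : Rn n => (Real.log ‖x‖ : ℂ)) := by
  refine pbound_of_scaling contDiffOn_log_norm fun k => ?_
  obtain ⟨C', hC0, hC'⟩ := exists_bound_sphere (contDiffOn_log_norm (n := n)) k
  refine ⟨C + C' * C, fun ρ hρ y hy hyA => ?_⟩
  obtain ⟨h1, h2⟩ := hA ρ hρ y hy hyA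
  have hy0 : y ≠ 0 := by rintro rfl; simp at hy
  rw [iteratedFDeriv_congr_off (v := (fun _ => (Real.log ρ : ℂ)) + fun y => (Real.log ‖y‖ : ℂ))
    (fun x hx => by
      simp only [Pi.add_apply]
      rw [norm_smul, Real.norm_of_nonneg hρ.le, Real.log_mul hρ.ne' (norm_ne_zero_iff.2 hx)]
      push_cast; rfl) hy0,
    iteratedFDeriv_add_apply contDiffAt_const (contDiffAt_of_off contDiffOn_log_norm hy0 k)]
  refine (norm_add_le _ _).trans ?_
  rw [add_mul]
  refine add_le_add ?_ ?_
  · rcases Nat.eq_zero_or_pos k with rfl | hk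
    · simpa using h1
    · rw [iteratedFDeriv_const_of_ne hk.ne']
      simp only [Pi.zero_apply, norm_zero]; linarith
  · refine (hC' y hy).trans ?_
    rw [mul_assoc]
    exact le_mul_of_one_le_right hC0 h2

/-- A logarithm costs an arbitrarily small power. The constant `δ⁻¹` comes from `log y ≤ y ^ δ / δ`
at `y = ρ⁻¹`. -/
theorem nearBound_log {δ : ℝ} (hδ : 0 < δ) :
    NearBound (-δ) (fun x : Rn n => (Real.log ‖x‖ : ℂ)) := by
  refine pbound_log (C := max 1 δ⁻¹) fun ρ hρ y hy hA => ?_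
  have hρ1 : ρ ≤ 1 := by
    simpa [norm_smul, hy, abs_of_pos hρ] using hA
  have h1 : 1 ≤ ρ ^ (-δ) := one_le_rpow_of_pos_of_le_one_of_nonpos hρ hρ1 (by linarith)
  refine ⟨?_, ?_⟩
  · have h2 := Real.log_le_rpow_div (inv_nonneg.2 hρ.le) hδ
    rw [Real.log_inv, inv_rpow hρ.le, ← rpow_neg hρ.le] at h2
    rw [abs_of_nonpos (Real.log_nonpos hρ.le hρ1)]
    refine h2.trans ?_
    rw [div_eq_inv_mul]
    gcongr
    exact le_max_right _ _
  · calc (1 : ℝ) ≤ 1 * ρ ^ (-δ) := by linarith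
      _ ≤ _ := by gcongr; exact le_max_left _ _

theorem farBound_log {δ : ℝ} (hδ : 0 < δ) :
    FarBound δ (fun x : Rn n => (Real.log ‖x‖ : ℂ)) := by
  refine pbound_log (C := max 1 δ⁻¹) fun ρ hρ y hy hA => ?_
  have hρ1 : 1 ≤ ρ := by
    simpa [norm_smul, hy, abs_of_pos hρ] using hA
  have h1 : 1 ≤ ρ ^ δ := one_le_rpow hρ1 hδ.le
  refine ⟨?_, ?_⟩
  · have h2 := Real.log_le_rpow_div hρ.le hδ
    rw [abs_of_nonneg (Real.log_nonneg hρ1)]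
    refine h2.trans ?_
    rw [div_eq_inv_mul]
    gcongr
    exact le_max_right _ _
  · calc (1 : ℝ) ≤ 1 * ρ ^ δ := by linarith
      _ ≤ _ := by gcongr; exact le_max_left _ _

/-- Homogeneous polynomials of degree `σ` (only `0` unless `σ ∈ ℕ`). -/
def PolyHom (σ : ℝ) (p : MvPolynomial (Fin n) ℂ) : Prop :=
  p = 0 ∨ ∃ k : ℕ, (k : ℝ) = σ ∧ p.IsHomogeneous k

theorem PolyHom.zero : PolyHom σ (0 : MvPolynomial (Fin n) ℂ) := Or.inl rfl

theorem PolyHom.eq_zero {p : MvPolynomial (Fin n) ℂ} (hp : PolyHom σ p)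
    (h : ¬ ∃ k : ℕ, (k : ℝ) = σ) : p = 0 := by
  rcases hp with h0 | ⟨k, hk, _⟩
  · exact h0
  · exact absurd ⟨k, hk⟩ h

theorem PolyHom.isHomogeneous {k : ℕ} {p : MvPolynomial (Fin n) ℂ} (hp : PolyHom (k : ℝ) p) :
    p.IsHomogeneous k := by
  rcases hp with rfl | ⟨l, hl, h⟩
  · exact MvPolynomial.isHomogeneous_zero _ _ _
  · rwa [← (by exact_mod_cast hl : l = k)]

theorem PolyHom.add {p q : MvPolynomial (Fin n) ℂ} (hp : PolyHom σ p) (hq : PolyHom σ q) :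
    PolyHom σ (p + q) := by
  by_cases h : ∃ k : ℕ, (k : ℝ) = σ
  · obtain ⟨k, rfl⟩ := h
    exact Or.inr ⟨k, rfl, hp.isHomogeneous.add hq.isHomogeneous⟩
  · rw [hp.eq_zero h, hq.eq_zero h]; left; simp

theorem PolyHom.C_mul {p : MvPolynomial (Fin n) ℂ} (c : ℂ) (hp : PolyHom σ p) :
    PolyHom σ (MvPolynomial.C c * p) := by
  rcases hp with rfl | ⟨k, hk, h⟩
  · left; simp
  · exact Or.inr ⟨k, hk, by simpa using (MvPolynomial.isHomogeneous_C _ c).mul h⟩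

theorem contDiff_polyEval (p : MvPolynomial (Fin n) ℂ) : ContDiff ℝ ∞ (polyEval (n := n) p) := by
  unfold polyEval
  induction p using MvPolynomial.induction_on with
  | C a => simpa using contDiff_const
  | add p q hp hq => simpa using hp.add hq
  | mul_X p i hp =>
    simp only [map_mul, MvPolynomial.eval_X]
    refine hp.mul (Complex.ofRealCLM.contDiff.comp ?_)
    exact (EuclideanSpace.proj i : Rn n →L[ℝ] ℝ).contDiff

theorem polyEval_add (p q : MvPolynomial (Fin n) ℂ) (x : Rn n) :
    polyEval (p + q) x = polyEval p x + polyEval q x := by simp [polyEval]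

theorem polyEval_C_mul (c : ℂ) (p : MvPolynomial (Fin n) ℂ) (x : Rn n) :
    polyEval (MvPolynomial.C c * p) x = c * polyEval p x := by simp [polyEval]

theorem polyEval_zero (x : Rn n) : polyEval (0 : MvPolynomial (Fin n) ℂ) x = 0 := by
  simp [polyEval]

theorem polyEval_smul {k : ℕ} {p : MvPolynomial (Fin n) ℂ} (hp : p.IsHomogeneous k) (t : ℝ)
    (x : Rn n) : polyEval p (t • x) = (t : ℂ) ^ k * polyEval p x := by
  unfold polyEval
  rw [MvPolynomial.eval_eq, MvPolynomial.eval_eq, Finset.mul_sum]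
  refine Finset.sum_congr rfl fun d hd => ?_
  have hdeg := hp (MvPolynomial.mem_support_iff.1 hd)
  have : ∏ i ∈ d.support, (((t • x) i : ℝ) : ℂ) ^ d i
      = (t : ℂ) ^ k * ∏ i ∈ d.support, ((x i : ℝ) : ℂ) ^ d i := by
    rw [← hdeg, Finsupp.weight_apply, Finsupp.sum, ← Finset.prod_pow_eq_pow_sum,
      ← Finset.prod_mul_distrib]
    refine Finset.prod_congr rfl fun i _ => ?_
    simp [mul_pow]
  rw [this]; ring

theorem PolyHom.homFun {p : MvPolynomial (Fin n) ℂ} (hp : PolyHom σ p) : HomFun σ (polyEval p) := by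
  refine ⟨(contDiff_polyEval p).contDiffOn, fun t ht x hx => ?_⟩
  rcases hp with rfl | ⟨k, rfl, h⟩
  · simp [polyEval_zero]
  · rw [polyEval_smul h, rpow_natCast]; push_cast; rfl

end Hom


/-! ### A radial cutoff -/

section Cutoff

variable {n : ℕ}

/-- A smooth even step function: `0` for `r² ≤ 1/2`, `1` for `r² ≥ 1`. -/
def step (r : ℝ) : ℝ := Real.smoothTransition (2 * r ^ 2 - 1)

theorem contDiff_step : ContDiff ℝ ∞ step :=
  Real.smoothTransition.contDiff.comp (by fun_prop)

theorem step_of_one_le {r : ℝ} (h : 1 ≤ r) : step r = 1 :=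
  Real.smoothTransition.one_of_one_le (by nlinarith)

theorem step_of_le_half {r : ℝ} (h : |r| ≤ 1 / 2) : step r = 0 :=
  Real.smoothTransition.zero_of_nonpos (by nlinarith [sq_abs r, abs_nonneg r])

theorem step_nonneg (r : ℝ) : 0 ≤ step r := Real.smoothTransition.nonneg _

theorem step_le_one (r : ℝ) : step r ≤ 1 := Real.smoothTransition.le_one _

/-- The patch function `ξ ↦ step |ξ|`. -/
def patch (x : Rn n) : ℝ := step ‖x‖

/-- `step` depends on `r ^ 2` alone, so the norm enters only through its smooth square. -/
theorem contDiff_patch : ContDiff ℝ ∞ (patch (n := n)) := by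
  have : patch (n := n) = fun x => Real.smoothTransition (2 * ‖x‖ ^ 2 - 1) := rfl
  rw [this]
  exact Real.smoothTransition.contDiff.comp
    ((contDiff_const.mul (contDiff_norm_sq ℝ)).sub contDiff_const)

theorem contDiff_patch_complex : ContDiff ℝ ∞ (fun x : Rn n => (patch x : ℂ)) :=
  Complex.ofRealCLM.contDiff.comp contDiff_patch

theorem patch_of_one_le {x : Rn n} (h : 1 ≤ ‖x‖) : patch x = 1 := step_of_one_le h

theorem patch_of_le_half {x : Rn n} (h : ‖x‖ ≤ 1 / 2) : patch x = 0 :=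
  step_of_le_half (by rwa [abs_of_nonneg (norm_nonneg _)])

theorem eventually_patch_eq_zero : ∀ᶠ x in 𝓝 (0 : Rn n), patch x = 0 := by
  filter_upwards [Metric.closedBall_mem_nhds (0 : Rn n) (by norm_num : (0 : ℝ) < 1 / 2)] with x hx
  exact patch_of_le_half (by simpa using hx)

/-- The cutoff function `1 - patch`. -/
def bump (x : Rn n) : ℝ := 1 - patch x

theorem contDiff_bump : ContDiff ℝ ∞ (bump (n := n)) := contDiff_const.sub contDiff_patch

theorem contDiff_bump_complex : ContDiff ℝ ∞ (fun x : Rn n => (bump x : ℂ)) :=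
  Complex.ofRealCLM.contDiff.comp contDiff_bump

theorem bump_of_one_le {x : Rn n} (h : 1 ≤ ‖x‖) : bump x = 0 := by simp [bump, patch_of_one_le h]

theorem bump_of_le_half {x : Rn n} (h : ‖x‖ ≤ 1 / 2) : bump x = 1 := by
  simp [bump, patch_of_le_half h]

theorem hasCompactSupport_of_one_le {F : Type*} [Zero F] {u : Rn n → F}
    (h : ∀ x, 1 ≤ ‖x‖ → u x = 0) : HasCompactSupport u := by
  refine HasCompactSupport.intro (isCompact_closedBall (0 : Rn n) 1) fun x hx => h x ?_
  simp only [Metric.mem_closedBall, dist_zero_right, not_le] at hx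
  exact hx.le

theorem isPatch_patch : IsPatch (patch (n := n)) := by
  refine ⟨bump, ⟨contDiff_bump, hasCompactSupport_of_one_le fun x hx => bump_of_one_le hx,
    fun x => ⟨?_, ?_⟩, ?_⟩, fun x => by simp [bump]⟩
  · have := step_le_one ‖x‖
    simp only [bump, patch]; linarith
  · have := step_nonneg ‖x‖
    simp only [bump, patch]; linarith
  · filter_upwards [eventually_patch_eq_zero] with x hx
    simp [bump, hx]

theorem contDiff_patch_mul {u : Rn n → ℂ} (hu : ContDiffOn ℝ ∞ u {0}ᶜ) :
    ContDiff ℝ ∞ (fun x => (patch x : ℂ) * u x) := by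
  rw [contDiff_iff_contDiffAt]
  intro x
  by_cases hx : x = 0
  · subst hx
    refine (contDiffAt_const (c := (0 : ℂ))).congr_of_eventuallyEq ?_
    filter_upwards [eventually_patch_eq_zero] with x hx
    simp [hx]
  · exact contDiff_patch_complex.contDiffAt.mul (hu.contDiffAt (isOpen_compl_zero.mem_nhds hx))

end Cutoff

/-! ### Symbols and Schwartz functions -/

section Symbols

variable {n : ℕ} {F : Type*} [NormedAddCommGroup F] [NormedSpace ℝ F] {σ τ : ℝ}

theorem rpow_le_two_rpow_abs {y τ : ℝ} (h1 : 1 ≤ y) (h2 : y ≤ 2) : y ^ τ ≤ 2 ^ |τ| :=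
  (rpow_le_rpow_of_exponent_le h1 (le_abs_self τ)).trans
    (rpow_le_rpow (by linarith) h2 (abs_nonneg τ))

/-- For `r ≥ 1` the quotient `(1 + r) / r` lies in `[1, 2]`, so `r ^ τ` and `(1 + r) ^ τ` are
comparable for either sign of `τ`. -/
theorem rpow_le_one_add_rpow {r : ℝ} (hr : 1 ≤ r) (τ : ℝ) : r ^ τ ≤ 2 ^ |τ| * (1 + r) ^ τ := by
  have h0 : 0 < r := by linarith
  have h := rpow_le_two_rpow_abs (y := (1 + r) / r) (τ := -τ) (by rw [le_div_iff₀ h0]; linarith)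
    (by rw [div_le_iff₀ h0]; linarith)
  rw [div_rpow (by linarith) h0.le, rpow_neg (by linarith), rpow_neg h0.le, abs_neg,
    inv_div_inv, div_le_iff₀ (by positivity)] at h
  exact h

theorem one_add_rpow_le_rpow {r : ℝ} (hr : 1 ≤ r) (τ : ℝ) : (1 + r) ^ τ ≤ 2 ^ |τ| * r ^ τ := by
  have h0 : 0 < r := by linarith
  have h := rpow_le_two_rpow_abs (y := (1 + r) / r) (τ := τ) (by rw [le_div_iff₀ h0]; linarith)
    (by rw [div_le_iff₀ h0]; linarith)
  rw [div_rpow (by linarith) h0.le, div_le_iff₀ (by positivity)] at h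
  exact h

theorem one_le_two_rpow_mul {y τ : ℝ} (h1 : 1 ≤ y) (h2 : y ≤ 2) : 1 ≤ 2 ^ |τ| * y ^ τ := by
  have h0 : 0 < y := by linarith
  have h := rpow_le_two_rpow_abs (τ := -τ) h1 h2
  rw [abs_neg, rpow_neg h0.le] at h
  calc (1 : ℝ) = (y ^ τ)⁻¹ * y ^ τ := (inv_mul_cancel₀ (by positivity)).symm
    _ ≤ _ := by gcongr

/-- On the unit ball a smooth function obeys every such bound by compactness. Symbols can thus be
handled with the calculus of `PBound`. -/
theorem isSymbol_iff {a : Rn n → ℂ} : IsSymbol σ a ↔ ContDiff ℝ ∞ a ∧ FarBound σ a := by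
  constructor
  · rintro ⟨h1, h2⟩
    refine ⟨h1, h1.contDiffOn, fun k => ?_⟩
    obtain ⟨C, hC⟩ := h2 k
    refine ⟨|C| * 2 ^ |σ - k|, fun x hx _ => (hC x).trans ?_⟩
    calc C * (1 + ‖x‖) ^ (σ - k) ≤ |C| * (1 + ‖x‖) ^ (σ - k) := by gcongr; exact le_abs_self C
      _ ≤ |C| * (2 ^ |σ - k| * ‖x‖ ^ (σ - k)) := by gcongr; exact one_add_rpow_le_rpow hx _
      _ = _ := by ring
  · rintro ⟨h1, h2⟩
    refine ⟨h1, fun k => ?_⟩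
    obtain ⟨C, hC0, hC⟩ := h2.bound k
    obtain ⟨C', hC0', hC'⟩ := exists_bound_ball h1 k 1
    refine ⟨C * 2 ^ |σ - k| + C' * 2 ^ |σ - k|, fun x => ?_⟩
    have hp : 0 ≤ (1 + ‖x‖) ^ (σ - k) := by positivity
    rw [add_mul]
    rcases le_total 1 ‖x‖ with hx | hx
    · have h0 : x ≠ 0 := by rintro rfl; simp at hx; linarith
      calc _ ≤ C * ‖x‖ ^ (σ - k) := hC x hx h0
        _ ≤ C * (2 ^ |σ - k| * (1 + ‖x‖) ^ (σ - k)) := by gcongr; exact rpow_le_one_add_rpow hx _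
        _ ≤ _ := by rw [← mul_assoc]; exact le_add_of_nonneg_right (by positivity)
    · calc _ ≤ C' := hC' x hx
        _ ≤ C' * (2 ^ |σ - k| * (1 + ‖x‖) ^ (σ - k)) :=
          le_mul_of_one_le_right hC0'
            (one_le_two_rpow_mul (by linarith [norm_nonneg x]) (by linarith))
        _ ≤ _ := by rw [← mul_assoc]; exact le_add_of_nonneg_left (by positivity)

/-- Equality on the closed set `|x| ≥ 1` is used to identify derivatives only in its interior, so
the shell `1 ≤ |x| ≤ 2` is treated by compactness instead. -/
theorem farBound_of_contDiff {u v : Rn n → F} (hu : ContDiff ℝ ∞ u) (hv : FarBound σ v)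
    (h : ∀ x, 1 ≤ ‖x‖ → u x = v x) : FarBound σ u := by
  refine ⟨hu.contDiffOn, fun k => ?_⟩
  obtain ⟨C, hC0, hC⟩ := hv.bound k
  obtain ⟨C', hC0', hC'⟩ := exists_bound_ball hu k 2
  refine ⟨C + C' * 2 ^ |σ - k|, fun x (hx : 1 ≤ ‖x‖) h0 => ?_⟩
  have hp : 0 ≤ ‖x‖ ^ (σ - k) := by positivity
  rw [add_mul]
  rcases le_or_gt ‖x‖ 2 with h2 | h2
  · calc _ ≤ C' := hC' x h2
      _ ≤ C' * (2 ^ |σ - k| * ‖x‖ ^ (σ - k)) :=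
        le_mul_of_one_le_right hC0' (one_le_two_rpow_mul hx h2)
      _ ≤ _ := by rw [← mul_assoc]; exact le_add_of_nonneg_left (by positivity)
  · have e : iteratedFDeriv ℝ k u x = iteratedFDeriv ℝ k v x := by
      refine (Filter.EventuallyEq.iteratedFDeriv ℝ ?_ k).eq_of_nhds
      have : {y : Rn n | 1 < ‖y‖} ∈ 𝓝 x :=
        (isOpen_lt continuous_const continuous_norm).mem_nhds (by simp; linarith)
      filter_upwards [this] with y hy
      exact h y (le_of_lt hy)
    rw [e]
    exact (hC x hx h0).trans (le_add_of_nonneg_right (by positivity))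

theorem isSymbol_patch_mul {u : Rn n → ℂ} (hu : FarBound σ u) :
    IsSymbol σ (fun x => (patch x : ℂ) * u x) :=
  isSymbol_iff.2 ⟨contDiff_patch_mul hu.1, farBound_of_contDiff (contDiff_patch_mul hu.1) hu
    fun x hx => by rw [patch_of_one_le hx]; simp⟩

theorem exists_schwartz {u : Rn n → F} (hu : ContDiff ℝ ∞ u) (h : ∀ N : ℕ, FarBound (-N : ℝ) u) :
    ∃ H : 𝓢(Rn n, F), ∀ x, H x = u x := by
  refine ⟨⟨u, hu, fun k l => ?_⟩, fun x => rfl⟩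
  obtain ⟨C, hC0, hC⟩ := (h k).bound l
  obtain ⟨C', hC0', hC'⟩ := exists_bound_ball hu l 1
  refine ⟨C + C', fun x => ?_⟩
  rcases le_total 1 ‖x‖ with hx | hx
  · have h0 : x ≠ 0 := by rintro rfl; simp at hx; linarith
    have hx0 : 0 < ‖x‖ := by linarith
    calc _ ≤ ‖x‖ ^ k * (C * ‖x‖ ^ (-(k : ℝ) - l)) := by gcongr; exact hC x hx h0
      _ = C * ‖x‖ ^ (-(l : ℝ)) := by
        rw [mul_left_comm, ← rpow_natCast, ← rpow_add hx0]; congr 2; ring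
      _ ≤ C * 1 := by
        gcongr; exact rpow_le_one_of_one_le_of_nonpos hx (by simp)
      _ ≤ C + C' := by linarith
  · calc _ ≤ 1 * C' := by
          gcongr
          · exact pow_le_one₀ (norm_nonneg _) hx
          · exact hC' x hx
      _ ≤ _ := by linarith

theorem schwartz_farBound (H : 𝓢(Rn n, F)) (σ : ℝ) : FarBound σ (H : Rn n → F) := by
  refine ⟨(H.smooth ⊤).contDiffOn, fun k => ?_⟩
  obtain ⟨N, hN⟩ := exists_nat_ge (k - σ)
  obtain ⟨C, hC⟩ := H.decay N k
  refine ⟨C, fun x (hx : 1 ≤ ‖x‖) h0 => ?_⟩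
  have hx0 : 0 < ‖x‖ := by linarith
  have hC0 : 0 ≤ C := le_trans (by positivity) (hC.2 x)
  have h1 : ‖iteratedFDeriv ℝ k H x‖ ≤ C * ‖x‖ ^ (-(N : ℝ)) := by
    rw [rpow_neg hx0.le, rpow_natCast, ← div_eq_mul_inv, le_div_iff₀ (by positivity), mul_comm]
    exact hC.2 x
  exact h1.trans (mul_le_mul_of_nonneg_left (rpow_le_rpow_of_exponent_le hx (by linarith)) hC0)

theorem schwartz_isSymbol (H : 𝓢(Rn n, ℂ)) (σ : ℝ) : IsSymbol σ (H : Rn n → ℂ) :=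
  isSymbol_iff.2 ⟨H.smooth ⊤, schwartz_farBound H σ⟩

theorem IsSymbol.add {a b : Rn n → ℂ} (ha : IsSymbol σ a) (hb : IsSymbol σ b) :
    IsSymbol σ (fun x => a x + b x) := by
  rw [isSymbol_iff] at *
  exact ⟨ha.1.add hb.1, ha.2.add hb.2⟩

theorem IsSymbol.sub {a b : Rn n → ℂ} (ha : IsSymbol σ a) (hb : IsSymbol σ b) :
    IsSymbol σ (fun x => a x - b x) := by
  rw [isSymbol_iff] at *
  exact ⟨ha.1.sub hb.1, ha.2.sub hb.2⟩

theorem IsSymbol.sum {ι : Type*} {s : Finset ι} {a : ι → Rn n → ℂ}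
    (h : ∀ i ∈ s, IsSymbol σ (a i)) : IsSymbol σ (fun x => ∑ i ∈ s, a i x) := by
  simp only [isSymbol_iff] at *
  exact ⟨ContDiff.sum fun i hi => (h i hi).1, PBound.sum fun i hi => (h i hi).2⟩

theorem IsSymbol.mono {a : Rn n → ℂ} (ha : IsSymbol σ a) (h : σ ≤ τ) : IsSymbol τ a := by
  rw [isSymbol_iff] at *
  exact ⟨ha.1, ha.2.mono h⟩

theorem IsSymbol.exists_schwartz {a : Rn n → ℂ} (h : ∀ N : ℕ, IsSymbol (-N : ℝ) a) :
    ∃ H : 𝓢(Rn n, ℂ), ∀ x, H x = a x :=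
  _root_.exists_schwartz (h 0).1 fun N => (isSymbol_iff.1 (h N)).2

end Symbols

/-! ### Functions as tempered distributions -/

section Dist

variable {n : ℕ}

/-- Measurable functions that are integrable after division by a power of `1 + |x|`. -/
def Moderate (u : Rn n → ℂ) : Prop :=
  AEStronglyMeasurable u volume ∧ ∃ k : ℕ, Integrable (fun x => ‖u x‖ * ((1 + ‖x‖) ^ k)⁻¹)

theorem Moderate.mono_exp {u : Rn n → ℂ} (hm : AEStronglyMeasurable u volume) {k l : ℕ}
    (hkl : k ≤ l) (h : Integrable (fun x => ‖u x‖ * ((1 + ‖x‖) ^ k)⁻¹)) :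
    Integrable (fun x => ‖u x‖ * ((1 + ‖x‖) ^ l)⁻¹) := by
  refine h.mono ?_ (Eventually.of_forall fun x => ?_)
  · refine hm.norm.mul (Continuous.aestronglyMeasurable ?_)
    exact Continuous.inv₀ (by fun_prop) fun x => by positivity
  · have : ((1 + ‖x‖) ^ l)⁻¹ ≤ ((1 + ‖x‖) ^ k)⁻¹ := by
      gcongr
      linarith [norm_nonneg x]
    rw [norm_of_nonneg (by positivity), norm_of_nonneg (by positivity)]
    gcongr

theorem Moderate.bound {u : Rn n → ℂ} {k : ℕ} (φ : 𝓢(Rn n, ℂ)) (x : Rn n) :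
    ‖u x * φ x‖ ≤ (2 ^ k * (Finset.Iic (k, 0)).sup (schwartzSeminormFamily ℂ (Rn n) ℂ) φ) *
      (‖u x‖ * ((1 + ‖x‖) ^ k)⁻¹) := by
  have h := SchwartzMap.one_add_le_sup_seminorm_apply (𝕜 := ℂ) (m := (k, 0)) (k := k) (n := 0)
    le_rfl le_rfl φ x
  rw [norm_iteratedFDeriv_zero] at h
  have hp : 0 < (1 + ‖x‖) ^ k := by positivity
  rw [norm_mul, mul_left_comm]
  refine mul_le_mul_of_nonneg_left ?_ (norm_nonneg _)
  rw [← div_eq_mul_inv, le_div_iff₀ hp, mul_comm]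
  exact h

theorem Moderate.integrable_mul {u : Rn n → ℂ} (hu : Moderate u) (φ : 𝓢(Rn n, ℂ)) :
    Integrable (fun x => u x * φ x) := by
  obtain ⟨hm, k, hk⟩ := hu
  exact (hk.const_mul _).mono' (hm.mul φ.continuous.aestronglyMeasurable)
    (Eventually.of_forall fun x => Moderate.bound φ x)

theorem Moderate.exists_isGivenBy {u : Rn n → ℂ} (hu : Moderate u) :
    ∃ T : 𝓢'(Rn n, ℂ), IsGivenBy T u := by
  obtain ⟨k, hk⟩ := hu.2
  let L : 𝓢(Rn n, ℂ) →L[ℂ] ℂ := SchwartzMap.mkCLMtoNormedSpace (fun φ => ∫ x, u x * φ x)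
    (fun f g => by
      rw [← integral_add (hu.integrable_mul f) (hu.integrable_mul g)]
      simp [mul_add])
    (fun a f => by
      rw [smul_eq_mul, RingHom.id_apply, ← integral_const_mul]
      congr 1; ext x; simp; ring)
    ⟨Finset.Iic (k, 0), 2 ^ k * ∫ x, ‖u x‖ * ((1 + ‖x‖) ^ k)⁻¹,
      mul_nonneg (by positivity) (integral_nonneg fun x => by positivity), fun φ => by
        refine (norm_integral_le_of_norm_le (hk.const_mul _)
          (Eventually.of_forall fun x => Moderate.bound φ x)).trans ?_
        rw [integral_const_mul]
        apply le_of_eq; ring⟩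
  refine ⟨ContinuousLinearMap.toPointwiseConvergenceCLM _ _ _ _ L, fun φ =>
    ⟨hu.integrable_mul φ, rfl⟩⟩

theorem Moderate.add {u v : Rn n → ℂ} (hu : Moderate u) (hv : Moderate v) :
    Moderate (fun x => u x + v x) := by
  obtain ⟨hm, k, hk⟩ := hu
  obtain ⟨hm', l, hl⟩ := hv
  refine ⟨hm.add hm', max k l, ?_⟩
  refine ((Moderate.mono_exp hm (le_max_left k l) hk).add
    (Moderate.mono_exp hm' (le_max_right k l) hl)).mono' ?_ (Eventually.of_forall fun x => ?_)
  · refine (hm.add hm').norm.mul (Continuous.aestronglyMeasurable ?_)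
    exact Continuous.inv₀ (by fun_prop) fun x => by positivity
  · rw [norm_of_nonneg (by positivity), Pi.add_apply, ← add_mul]
    gcongr
    exact norm_add_le _ _

theorem moderate_of_integrable {u : Rn n → ℂ} (hu : Integrable u) : Moderate u :=
  ⟨hu.1, 0, by simpa using hu.norm⟩

theorem moderate_of_bound {u : Rn n → ℂ} (hm : AEStronglyMeasurable u volume) {C : ℝ} {k : ℕ}
    (h : ∀ x, ‖u x‖ ≤ C * (1 + ‖x‖) ^ k) : Moderate u := by
  -- The additional `finrank + 1` powers leave the integrable weight `(1 + |x|)^(-n-1)`.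
  refine ⟨hm, k + (Module.finrank ℝ (Rn n) + 1), ?_⟩
  have hi : Integrable (fun x : Rn n => C * (1 + ‖x‖) ^ (-(Module.finrank ℝ (Rn n) + 1 : ℝ))) :=
    (integrable_one_add_norm (by simp)).const_mul C
  refine hi.mono' ?_ (Eventually.of_forall fun x => ?_)
  · refine hm.norm.mul (Continuous.aestronglyMeasurable ?_)
    exact Continuous.inv₀ (by fun_prop) fun x => by positivity
  · rw [norm_of_nonneg (by positivity), pow_add, mul_inv, ← mul_assoc]
    have e : (1 + ‖x‖) ^ (-(Module.finrank ℝ (Rn n) + 1 : ℝ))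
        = ((1 + ‖x‖) ^ (Module.finrank ℝ (Rn n) + 1))⁻¹ := by
      rw [rpow_neg (by positivity)]; norm_cast
    rw [e]
    gcongr
    rw [← div_eq_mul_inv, div_le_iff₀ (by positivity)]
    exact h x

theorem IsGivenBy.unique {T T' : 𝓢'(Rn n, ℂ)} {u : Rn n → ℂ} (h : IsGivenBy T u)
    (h' : IsGivenBy T' u) : T = T' := by
  ext φ
  rw [(h φ).2, (h' φ).2]

theorem IsGivenBy.add {T T' : 𝓢'(Rn n, ℂ)} {u u' : Rn n → ℂ} (h : IsGivenBy T u)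
    (h' : IsGivenBy T' u') : IsGivenBy (T + T') (fun x => u x + u' x) := fun φ => by
  have e : (fun x => (u x + u' x) * φ x) = fun x => u x * φ x + u' x * φ x := by
    ext x; ring
  rw [e]
  refine ⟨(h φ).1.add (h' φ).1, ?_⟩
  rw [integral_add (h φ).1 (h' φ).1, ← (h φ).2, ← (h' φ).2]
  rfl

theorem IsGivenBy.const_smul {T : 𝓢'(Rn n, ℂ)} {u : Rn n → ℂ} (c : ℂ) (h : IsGivenBy T u) :
    IsGivenBy (c • T) (fun x => c * u x) := fun φ => by
  simp only [mul_assoc]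
  refine ⟨(h φ).1.const_mul c, ?_⟩
  rw [integral_const_mul, ← (h φ).2]
  rfl

theorem IsGivenBy.sub {T T' : 𝓢'(Rn n, ℂ)} {u u' : Rn n → ℂ} (h : IsGivenBy T u)
    (h' : IsGivenBy T' u') : IsGivenBy (T - T') (fun x => u x - u' x) := fun φ => by
  have e : (fun x => (u x - u' x) * φ x) = fun x => u x * φ x - u' x * φ x := by
    ext x; ring
  rw [e]
  refine ⟨(h φ).1.sub (h' φ).1, ?_⟩
  rw [integral_sub (h φ).1 (h' φ).1, ← (h φ).2, ← (h' φ).2]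
  rfl

theorem IsGivenBy.congr_ae {T : 𝓢'(Rn n, ℂ)} {u v : Rn n → ℂ} (h : IsGivenBy T u)
    (e : u =ᵐ[volume] v) : IsGivenBy T v := fun φ => by
  have e' : (fun x => u x * φ x) =ᵐ[volume] fun x => v x * φ x := by
    filter_upwards [e] with x hx; rw [hx]
  exact ⟨(h φ).1.congr e', by rw [(h φ).2, integral_congr_ae e']⟩

theorem IsGivenBy.sum {ι : Type*} {s : Finset ι} {T : ι → 𝓢'(Rn n, ℂ)} {u : ι → Rn n → ℂ}
    (h : ∀ i ∈ s, IsGivenBy (T i) (u i)) :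
    IsGivenBy (∑ i ∈ s, T i) (fun x => ∑ i ∈ s, u i x) := by
  classical
  induction s using Finset.induction_on with
  | empty => intro φ; simp
  | insert a s ha ih =>
    simp only [Finset.sum_insert ha]
    exact (h a (Finset.mem_insert_self _ _)).add
      (ih fun i hi => h i (Finset.mem_insert_of_mem hi))

theorem isGivenBy_schwartz (H : 𝓢(Rn n, ℂ)) :
    IsGivenBy (SchwartzMap.toTemperedDistributionCLM (Rn n) ℂ volume H) H := fun φ => by
  refine ⟨(moderate_of_integrable H.integrable).integrable_mul φ, ?_⟩
  refine (SchwartzMap.toTemperedDistributionCLM_apply_apply volume H φ).trans ?_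
  congr 1; ext x; rw [smul_eq_mul, mul_comm]

theorem IsGivenBy.eq_of_continuous {T : 𝓢'(Rn n, ℂ)} {u v : Rn n → ℂ} (hu : Continuous u)
    (hv : Continuous v) (h : IsGivenBy T u) (h' : IsGivenBy T v) : u = v := by
  refine (Continuous.ae_eq_iff_eq volume hu hv).1 ?_
  refine ae_eq_of_integral_contDiff_smul_eq hu.locallyIntegrable hv.locallyIntegrable
    fun g hg hgs => ?_
  have h1 : ContDiff ℝ ∞ (fun x => (g x : ℂ)) := Complex.ofRealCLM.contDiff.comp hg
  have h2 : HasCompactSupport (fun x => (g x : ℂ)) :=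
    hgs.comp_left (g := Complex.ofReal) Complex.ofReal_zero
  have := ((h (h2.toSchwartzMap h1)).2).symm.trans ((h' (h2.toSchwartzMap h1)).2)
  have e : ∀ x, h2.toSchwartzMap h1 x = (g x : ℂ) := fun x => rfl
  simpa only [e, Complex.real_smul, mul_comm] using this

theorem ae_eq_of_off (hn : 1 ≤ n) {u v : Rn n → ℂ} (h : ∀ x, x ≠ 0 → u x = v x) :
    u =ᵐ[volume] v := by
  have : Nonempty (Fin n) := ⟨⟨0, hn⟩⟩
  have : Nontrivial (Rn n) := inferInstance
  have : ({0}ᶜ : Set (Rn n)) ∈ ae (volume : Measure (Rn n)) := by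
    rw [mem_ae_iff, compl_compl]; exact measure_singleton 0
  filter_upwards [this] with x hx using h x hx

end Dist


/-! ### Smooth dependence of integrals on parameters -/

section Param

variable {α G F : Type*} [MeasurableSpace α] {μ : Measure α}
  [NormedAddCommGroup G] [NormedSpace ℝ G] [NormedAddCommGroup F] [NormedSpace ℝ F]

/-- Differentiation under the integral sign with the derivative stored through an isometry `I`.
Taking for `I` the currying of multilinear maps, the derivative of the `m`-th derivative is the `(m
+ 1)`-st one with the same norm. -/
theorem hasFDerivAt_integral_isometry {E M : Type*} [NormedAddCommGroup E] [NormedSpace ℝ E]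
    [NormedAddCommGroup M] [NormedSpace ℝ M] (I : M ≃ₗᵢ[ℝ] (G →L[ℝ] E)) {f : α → G → E}
    {D : α → G → M} {b b' : α → ℝ} {x : G} {U : Set G} (hU : U ∈ 𝓝 x)
    (hm : ∀ᶠ y in 𝓝 x, AEStronglyMeasurable (fun t => f t y) μ)
    (hm' : AEStronglyMeasurable (fun t => D t x) μ)
    (hb' : Integrable b' μ) (hfb : ∀ᵐ t ∂μ, ‖f t x‖ ≤ b' t)
    (hb : Integrable b μ) (hDb : ∀ᵐ t ∂μ, ∀ y ∈ U, ‖D t y‖ ≤ b t)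
    (hd : ∀ᵐ t ∂μ, ∀ y ∈ U, HasFDerivAt (f t) (I (D t y)) y) :
    HasFDerivAt (fun y => ∫ t, f t y ∂μ) (I (∫ t, D t x ∂μ)) x := by
  have e : I (∫ t, D t x ∂μ) = ∫ t, I (D t x) ∂μ :=
    (I.toContinuousLinearEquiv.integral_comp_comm fun t => D t x).symm
  rw [e]
  refine hasFDerivAt_integral_of_dominated_of_fderiv_le (s := U)
    (F' := fun y t => I (D t y)) (bound := b) hU hm ?_ ?_ ?_ hb hd
  · exact hb'.mono' hm.self_of_nhds hfb
  · exact I.continuous.comp_aestronglyMeasurable hm'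
  · filter_upwards [hDb] with t ht y hy
    rw [I.norm_map]
    exact ht y hy

theorem hasFTaylorSeriesUpToOn_integral {Φ : α → G → F} {Ω : Set G} (hΩ : IsOpen Ω)
    (hs : ∀ᵐ t ∂μ, ContDiffOn ℝ ∞ (Φ t) Ω)
    (hm : ∀ k : ℕ, ∀ x ∈ Ω, AEStronglyMeasurable (fun t => iteratedFDeriv ℝ k (Φ t) x) μ)
    (hb : ∀ k : ℕ, ∀ x ∈ Ω, ∃ b : α → ℝ, Integrable b μ ∧ ∃ U ∈ 𝓝 x,
      ∀ᵐ t ∂μ, ∀ y ∈ U, ‖iteratedFDeriv ℝ k (Φ t) y‖ ≤ b t) :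
    HasFTaylorSeriesUpToOn ∞ (fun x => ∫ t, Φ t x ∂μ)
      (fun x k => ∫ t, iteratedFDeriv ℝ k (Φ t) x ∂μ) Ω := by
  have key : ∀ m : ℕ, ∀ x ∈ Ω, HasFDerivAt (fun x => ∫ t, iteratedFDeriv ℝ m (Φ t) x ∂μ)
      (∫ t, iteratedFDeriv ℝ (m + 1) (Φ t) x ∂μ).curryLeft x := by
    intro m x hx
    obtain ⟨b, hbi, U, hU, hbU⟩ := hb (m + 1) x hx
    obtain ⟨b0, hbi0, U0, hU0, hbU0⟩ := hb m x hx
    refine hasFDerivAt_integral_isometry (U := U ∩ Ω)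
      (continuousMultilinearCurryLeftEquiv ℝ (fun _ : Fin (m + 1) => G) F)
      (D := fun t y => iteratedFDeriv ℝ (m + 1) (Φ t) y)
      (Filter.inter_mem hU (hΩ.mem_nhds hx)) ?_ (hm (m + 1) x hx) hbi0 ?_ hbi ?_ ?_
    · filter_upwards [hΩ.mem_nhds hx] with y hy using hm m y hy
    · exact hbU0.mono fun t ht => ht x (mem_of_mem_nhds hU0)
    · filter_upwards [hbU] with t ht y hy using ht y hy.1
    · filter_upwards [hs] with t ht y hy
      have h1 := (ht.ftaylorSeriesWithin hΩ.uniqueDiffOn).fderivWithin m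
        (by exact_mod_cast WithTop.coe_lt_top _) y hy.2
      have h2 := h1.hasFDerivAt (hΩ.mem_nhds hy.2)
      have e1 : ftaylorSeriesWithin ℝ (Φ t) Ω y (m + 1) = iteratedFDeriv ℝ (m + 1) (Φ t) y :=
        iteratedFDerivWithin_of_isOpen _ hΩ hy.2
      rw [← e1]
      refine h2.congr_of_eventuallyEq ?_
      filter_upwards [hΩ.mem_nhds hy.2] with z hz
      exact (iteratedFDerivWithin_of_isOpen m hΩ hz).symm
  refine ⟨fun x hx => ?_, fun m _ x hx => (key m x hx).hasFDerivWithinAt, fun m _ x hx =>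
    (key m x hx).continuousAt.continuousWithinAt⟩
  exact ((continuousMultilinearCurryFin0 ℝ G F).toContinuousLinearEquiv.integral_comp_comm _).symm

theorem contDiffOn_integral {Φ : α → G → F} {Ω : Set G} (hΩ : IsOpen Ω)
    (hs : ∀ᵐ t ∂μ, ContDiffOn ℝ ∞ (Φ t) Ω)
    (hm : ∀ k : ℕ, ∀ x ∈ Ω, AEStronglyMeasurable (fun t => iteratedFDeriv ℝ k (Φ t) x) μ)
    (hb : ∀ k : ℕ, ∀ x ∈ Ω, ∃ b : α → ℝ, Integrable b μ ∧ ∃ U ∈ 𝓝 x,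
      ∀ᵐ t ∂μ, ∀ y ∈ U, ‖iteratedFDeriv ℝ k (Φ t) y‖ ≤ b t) :
    ContDiffOn ℝ ∞ (fun x => ∫ t, Φ t x ∂μ) Ω ∧ ∀ k : ℕ, ∀ x ∈ Ω,
      iteratedFDeriv ℝ k (fun x => ∫ t, Φ t x ∂μ) x = ∫ t, iteratedFDeriv ℝ k (Φ t) x ∂μ := by
  have h := hasFTaylorSeriesUpToOn_integral hΩ hs hm hb
  refine ⟨h.contDiffOn, fun k x hx => ?_⟩
  rw [← iteratedFDerivWithin_of_isOpen k hΩ hx]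
  exact (h.eq_iteratedFDerivWithin_of_uniqueDiffOn (by exact_mod_cast le_top)
    hΩ.uniqueDiffOn hx).symm

/-- Integrals over `(0,1]` of families that are smooth uniformly up to the ends. -/
theorem contDiffOn_integral_Ioc [LocallyCompactSpace G] {Ψ : ℝ → G → F} {w : ℝ → ℝ} {Ω : Set G}
    (hΩ : IsOpen Ω) (hw : IntegrableOn w (Ioc 0 1)) (hs : ∀ t ∈ Icc (0 : ℝ) 1, ContDiffOn ℝ ∞ (Ψ t) Ω)
    (hc : ∀ k : ℕ, ContinuousOn (fun q : ℝ × G => iteratedFDeriv ℝ k (Ψ q.1) q.2)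
      (Icc 0 1 ×ˢ Ω)) :
    ContDiffOn ℝ ∞ (fun x => ∫ t in Ioc (0 : ℝ) 1, w t • Ψ t x) Ω := by
  have hd : ∀ k : ℕ, ∀ x ∈ Ω, ∀ t ∈ Ioc (0 : ℝ) 1,
      iteratedFDeriv ℝ k (fun y => w t • Ψ t y) x = w t • iteratedFDeriv ℝ k (Ψ t) x := by
    intro k x hx t ht
    exact iteratedFDeriv_const_smul_apply
      ((((hs t (Ioc_subset_Icc_self ht)).contDiffAt (hΩ.mem_nhds hx))).of_le
        (by exact_mod_cast le_top))
  refine (contDiffOn_integral (μ := volume.restrict (Ioc (0 : ℝ) 1))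
    (Φ := fun t x => w t • Ψ t x) hΩ ?_ ?_ ?_).1
  · exact (ae_restrict_mem measurableSet_Ioc).mono fun t ht =>
      contDiffOn_const.smul (hs t (Ioc_subset_Icc_self ht))
  · intro k x hx
    have h1 : AEStronglyMeasurable (fun t => w t • iteratedFDeriv ℝ k (Ψ t) x)
        (volume.restrict (Ioc (0 : ℝ) 1)) := by
      refine hw.aestronglyMeasurable.smul (ContinuousOn.aestronglyMeasurable ?_ measurableSet_Ioc)
      exact (hc k).comp (f := fun t : ℝ => (t, x)) (by fun_prop)
        fun t ht => ⟨Ioc_subset_Icc_self ht, hx⟩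
    exact h1.congr ((ae_restrict_mem measurableSet_Ioc).mono fun t ht => (hd k x hx t ht).symm)
  · intro k x hx
    -- Joint continuity on the compact set `[0, 1] × K` gives a single bound, so that a multiple of
    -- `‖w t‖` dominates near `x`.
    obtain ⟨K, hK, hxK, hKΩ⟩ := exists_compact_subset hΩ hx
    obtain ⟨C, hC⟩ := ((isCompact_Icc (a := (0 : ℝ)) (b := 1)).prod hK).exists_bound_of_continuousOn
      ((hc k).mono (prod_mono_right hKΩ))
    refine ⟨fun t => ‖w t‖ * C, hw.norm.mul_const C, K, mem_interior_iff_mem_nhds.1 hxK, ?_⟩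
    refine (ae_restrict_mem measurableSet_Ioc).mono fun t ht y hy => ?_
    rw [hd k y (hKΩ hy) t ht, norm_smul]
    exact mul_le_mul_of_nonneg_left (hC (t, y) ⟨Ioc_subset_Icc_self ht, hy⟩) (norm_nonneg _)

theorem contDiff_integral_comp_smul [LocallyCompactSpace G] {φ : G → F} (hφ : ContDiff ℝ ∞ φ)
    {w : ℝ → ℝ} (hw : IntegrableOn w (Ioc 0 1)) :
    ContDiff ℝ ∞ (fun x => ∫ t in Ioc (0 : ℝ) 1, w t • φ (t • x)) := by
  rw [← contDiffOn_univ]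
  refine contDiffOn_integral_Ioc (Ψ := fun t x => φ (t • x)) isOpen_univ hw (fun t _ => ?_)
    fun k => ?_
  · exact (hφ.comp (contDiff_const_smul t)).contDiffOn
  · have e : (fun q : ℝ × G => iteratedFDeriv ℝ k (fun x => φ (q.1 • x)) q.2)
        = fun q => q.1 ^ k • iteratedFDeriv ℝ k φ (q.1 • q.2) := by
      ext1 q
      rw [iteratedFDeriv_comp_const_smul q.1 (hφ.of_le (by exact_mod_cast le_top))]
    rw [e]
    have := hφ.continuous_iteratedFDeriv (m := k) (by exact_mod_cast le_top)
    exact (by fun_prop : Continuous _).continuousOn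

end Param


/-! ### The tails `∫_1^∞ t^{-σ-1} φ(t x) dt` -/

section Tail

variable {n : ℕ} {F : Type*} [NormedAddCommGroup F] [NormedSpace ℝ F] {σ : ℝ}

/-- `∫_1^∞ t^{-σ-1} φ(t x) dt`. -/
def tail (σ : ℝ) (φ : Rn n → F) (x : Rn n) : F := ∫ t in Ioi (1 : ℝ), t ^ (-σ - 1) • φ (t • x)

theorem schwartz_decay_dil (φ : 𝓢(Rn n, F)) (k N : ℕ) : ∃ C : ℝ, 0 ≤ C ∧ ∀ t : ℝ, 0 < t →
    ∀ x : Rn n, x ≠ 0 → ‖iteratedFDeriv ℝ k φ (t • x)‖ ≤ C * t ^ (-N : ℝ) * ‖x‖ ^ (-N : ℝ) := by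
  obtain ⟨C, hC⟩ := φ.decay N k
  refine ⟨C, hC.1.le, fun t ht x hx => ?_⟩
  have h := hC.2 (t • x)
  have hx0 : 0 < ‖x‖ := norm_pos_iff.2 hx
  rw [mul_assoc, ← mul_rpow ht.le hx0.le, rpow_neg (by positivity), rpow_natCast,
    ← div_eq_mul_inv, le_div_iff₀ (by positivity), mul_comm]
  rwa [norm_smul, Real.norm_of_nonneg ht.le] at h

theorem iteratedFDeriv_tail_integrand (φ : 𝓢(Rn n, F)) (k : ℕ) (c t : ℝ) (x : Rn n) :
    iteratedFDeriv ℝ k (fun y => c • φ (t • y)) x = (c * t ^ k) • iteratedFDeriv ℝ k φ (t • x) := by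
  have h1 : ContDiff ℝ k φ := φ.smooth k
  have h2 := iteratedFDeriv_comp_const_smul t h1
  have h3 := iteratedFDeriv_const_smul_apply (𝕜 := ℝ) (a := c) (x := x) (i := k)
    (f := fun y => φ (t • y)) (h1.comp (contDiff_const_smul t)).contDiffAt
  have e : (fun y => c • φ (t • y)) = c • fun y => φ (t • y) := rfl
  rw [e, h3, h2, smul_smul]

/-- Each derivative produces a factor `t`; the decay of `φ` to order `M` pays for it, and `M > k -
σ` makes the power of `t` integrable at infinity. -/
theorem tail_integrand_bound (σ : ℝ) (φ : 𝓢(Rn n, F)) (k M : ℕ) : ∃ C : ℝ, 0 ≤ C ∧ ∀ t : ℝ, 0 < t →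
    ∀ x : Rn n, x ≠ 0 → ‖iteratedFDeriv ℝ k (fun y => t ^ (-σ - 1) • φ (t • y)) x‖ ≤
      t ^ (-σ - 1 + k - M) * (C * ‖x‖ ^ (-M : ℝ)) := by
  obtain ⟨C, hC0, hC⟩ := schwartz_decay_dil φ k M
  refine ⟨C, hC0, fun t ht x hx => ?_⟩
  rw [iteratedFDeriv_tail_integrand, norm_smul, Real.norm_of_nonneg (by positivity)]
  calc _ ≤ (t ^ (-σ - 1) * t ^ k) * (C * t ^ (-M : ℝ) * ‖x‖ ^ (-M : ℝ)) := by
        gcongr; exact hC t ht x hx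
    _ = (t ^ (-σ - 1) * t ^ (k : ℝ) * t ^ (-M : ℝ)) * (C * ‖x‖ ^ (-M : ℝ)) := by
        rw [rpow_natCast]; ring
    _ = _ := by
        rw [← rpow_add ht, ← rpow_add ht]; ring_nf

theorem tail_taylor (σ : ℝ) (φ : 𝓢(Rn n, F)) : ContDiffOn ℝ ∞ (tail σ φ) {0}ᶜ ∧
    ∀ k : ℕ, ∀ x ∈ ({0}ᶜ : Set (Rn n)), iteratedFDeriv ℝ k (tail σ φ) x
      = ∫ t in Ioi (1 : ℝ), iteratedFDeriv ℝ k (fun y => t ^ (-σ - 1) • φ (t • y)) x := by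
  refine contDiffOn_integral (μ := volume.restrict (Ioi (1 : ℝ)))
    (Φ := fun t y => t ^ (-σ - 1) • φ (t • y)) isOpen_compl_zero ?_ ?_ ?_
  · exact Eventually.of_forall fun t =>
      (contDiff_const.smul ((φ.smooth ⊤).comp (contDiff_const_smul t))).contDiffOn
  · intro k x _
    simp only [iteratedFDeriv_tail_integrand]
    have hc : Continuous (iteratedFDeriv ℝ k φ) :=
      (φ.smooth k).continuous_iteratedFDeriv le_rfl
    refine ContinuousOn.aestronglyMeasurable (ContinuousOn.fun_smul (ContinuousOn.fun_mul ?_ ?_) ?_)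
      measurableSet_Ioi
    · exact continuousOn_id.rpow_const fun t ht => Or.inl (ne_of_gt (lt_trans one_pos ht))
    · fun_prop
    · fun_prop
  · intro k x hx
    obtain ⟨M, hM⟩ := exists_nat_gt (k - σ)
    obtain ⟨C, hC0, hC⟩ := tail_integrand_bound σ φ k M
    have hx0 : 0 < ‖x‖ := norm_pos_iff.2 hx
    refine ⟨fun t => t ^ (-σ - 1 + k - M) * (C * (‖x‖ / 2) ^ (-M : ℝ)),
      (integrableOn_Ioi_rpow_of_lt (by linarith) one_pos).mul_const _,
      {y | ‖x‖ / 2 < ‖y‖}, (isOpen_lt continuous_const continuous_norm).mem_nhds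
        (by simp only [mem_ofPred_eq]; linarith), ?_⟩
    refine (ae_restrict_mem measurableSet_Ioi).mono fun t ht y hy => ?_
    have ht0 : 0 < t := lt_trans one_pos ht
    have hy1 : ‖x‖ / 2 < ‖y‖ := hy
    have hy0 : y ≠ 0 := by rintro rfl; simp at hy1; linarith
    refine (hC t ht0 y hy0).trans ?_
    refine mul_le_mul_of_nonneg_left (mul_le_mul_of_nonneg_left ?_ hC0) (rpow_nonneg ht0.le _)
    exact rpow_le_rpow_of_nonpos (by positivity) hy1.le (by simp)

theorem tail_contDiffOn (σ : ℝ) (φ : 𝓢(Rn n, F)) : ContDiffOn ℝ ∞ (tail σ φ) {0}ᶜ :=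
  (tail_taylor σ φ).1

theorem tail_integrable (σ : ℝ) (φ : 𝓢(Rn n, F)) {x : Rn n} (hx : x ≠ 0) {c : ℝ} (hc : 0 < c) :
    IntegrableOn (fun t => t ^ (-σ - 1) • φ (t • x)) (Ioi c) := by
  obtain ⟨M, hM⟩ := exists_nat_gt (- σ)
  obtain ⟨C, hC0, hC⟩ := tail_integrand_bound σ φ 0 M
  refine Integrable.mono' (g := fun t => t ^ (-σ - 1 + (0 : ℕ) - M) * (C * ‖x‖ ^ (-M : ℝ)))
    ((integrableOn_Ioi_rpow_of_lt (by push_cast; linarith) hc).mul_const _) ?_ ?_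
  · refine ContinuousOn.aestronglyMeasurable (ContinuousOn.smul ?_ ?_) measurableSet_Ioi
    · exact continuousOn_id.rpow_const fun t ht => Or.inl (ne_of_gt (lt_trans hc ht))
    · have := φ.continuous
      fun_prop
  · refine (ae_restrict_mem measurableSet_Ioi).mono fun t ht => ?_
    simpa using hC t (lt_trans hc ht) x hx

theorem tail_farBound (σ : ℝ) (φ : 𝓢(Rn n, F)) (N : ℕ) : FarBound (-N : ℝ) (tail σ φ) := by
  refine ⟨tail_contDiffOn σ φ, fun k => ?_⟩
  obtain ⟨M', hM'⟩ := exists_nat_gt (k - σ)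
  -- `M > k - σ` gives convergence of the integral in `t`, and `M ≥ N + k` gives the decay
  -- `|x|^(-N-k)`.
  set M := max M' (N + k) with hMdef
  have hM : (k : ℝ) - σ < M := lt_of_lt_of_le hM' (by exact_mod_cast le_max_left _ _)
  have hM2 : (N : ℝ) + k ≤ M := by exact_mod_cast le_max_right M' (N + k)
  obtain ⟨C, hC0, hC⟩ := tail_integrand_bound σ φ k M
  refine ⟨(∫ t in Ioi (1 : ℝ), t ^ (-σ - 1 + k - M)) * C, fun x (hx : 1 ≤ ‖x‖) h0 => ?_⟩
  rw [(tail_taylor σ φ).2 k x h0]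
  have hi : IntegrableOn (fun t : ℝ => t ^ (-σ - 1 + k - M)) (Ioi 1) :=
    integrableOn_Ioi_rpow_of_lt (by linarith) one_pos
  refine (norm_integral_le_of_norm_le (hi.mul_const (C * ‖x‖ ^ (-M : ℝ)))
    ((ae_restrict_mem measurableSet_Ioi).mono fun t ht =>
      hC t (lt_trans one_pos ht) x h0)).trans ?_
  rw [integral_mul_const, mul_assoc]
  have hI : 0 ≤ ∫ t in Ioi (1 : ℝ), t ^ (-σ - 1 + k - M) :=
    setIntegral_nonneg measurableSet_Ioi fun t ht => rpow_nonneg (lt_trans one_pos ht).le _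
  refine mul_le_mul_of_nonneg_left (mul_le_mul_of_nonneg_left ?_ hC0) hI
  exact rpow_le_rpow_of_exponent_le hx (by linarith)

/-- The change of variables `t ↦ λ t` in tails. -/
theorem integral_Ioi_dil (σ : ℝ) (φ : Rn n → F) {a l : ℝ} (hl : 0 < l) (ha : 0 ≤ a) (x : Rn n) :
    ∫ t in Ioi a, t ^ (-σ - 1) • φ (t • l • x)
      = l ^ σ • ∫ t in Ioi (a * l), t ^ (-σ - 1) • φ (t • x) := by
  have h := integral_comp_mul_right_Ioi (fun t => (t ^ (-σ - 1) : ℝ) • φ (t • x)) a hl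
  have e : ∀ t ∈ Ioi a, t ^ (-σ - 1) • φ (t • l • x)
      = l ^ (σ + 1) • ((t * l) ^ (-σ - 1) • φ ((t * l) • x)) := by
    intro t ht
    have ht0 : 0 < t := lt_of_le_of_lt ha ht
    rw [smul_smul, smul_smul, mul_rpow ht0.le hl.le, mul_left_comm, ← rpow_add hl]
    simp
  rw [setIntegral_congr_fun measurableSet_Ioi e, integral_smul, h, smul_smul]
  congr 1
  rw [rpow_add hl, rpow_one, mul_assoc, mul_inv_cancel₀ hl.ne', mul_one]

end Tail

/-! ### Decomposition of tails near the origin -/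

section Decomp

variable {n : ℕ} {σ : ℝ}

/-- The tail `∫_1^∞ t^{-σ-1} φ(t x) dt` is the sum of a homogeneous function, a homogeneous
polynomial times `log|x|`, and a smooth function on `ℝⁿ`. -/
structure Decomp (σ : ℝ) (φ : 𝓢(Rn n, ℂ)) (f : Rn n → ℂ) (p : MvPolynomial (Fin n) ℂ)
    (E : Rn n → ℂ) : Prop where
  hom : HomFun σ f
  poly : PolyHom σ p
  smooth : ContDiff ℝ ∞ E
  eq : ∀ x, x ≠ 0 → tail σ φ x = f x - polyEval p x * (Real.log ‖x‖ : ℂ) - E x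

theorem integral_Ioi_split {F : Type*} [NormedAddCommGroup F] [NormedSpace ℝ F] {g : ℝ → F}
    {a b : ℝ} (hab : a ≤ b) (h1 : IntegrableOn g (Ioc a b)) (h2 : IntegrableOn g (Ioi b)) :
    ∫ t in Ioi a, g t = (∫ t in Ioc a b, g t) + ∫ t in Ioi b, g t := by
  rw [← setIntegral_union Ioc_disjoint_Ioi_same measurableSet_Ioi h1 h2,
    Ioc_union_Ioi_eq_Ioi hab]

theorem integrableOn_Ioc_rpow {r b : ℝ} (h : -1 < r) : IntegrableOn (fun t : ℝ => t ^ r) (Ioc 0 b) := by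
  rcases le_or_gt 0 b with hb | hb
  · exact (intervalIntegrable_iff_integrableOn_Ioc_of_le hb).1 (intervalIntegral.intervalIntegrable_rpow' h)
  · rw [Ioc_eq_empty (by linarith)]; exact integrableOn_empty

theorem integrableOn_Ioc_rpow_smul {F : Type*} [NormedAddCommGroup F] [NormedSpace ℝ F]
    {r : ℝ} (h : -1 < r) {g : ℝ → F} (hg : Continuous g) :
    IntegrableOn (fun t : ℝ => t ^ r • g t) (Ioc 0 1) := by
  obtain ⟨C, hC⟩ := (isCompact_Icc (a := (0 : ℝ)) (b := 1)).exists_bound_of_continuousOn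
    hg.continuousOn
  refine Integrable.mono' ((integrableOn_Ioc_rpow h).norm.mul_const C)
    ((integrableOn_Ioc_rpow h).aestronglyMeasurable.smul hg.aestronglyMeasurable) ?_
  refine (ae_restrict_mem measurableSet_Ioc).mono fun t ht => ?_
  rw [norm_smul]
  exact mul_le_mul_of_nonneg_left (hC t (Ioc_subset_Icc_self ht)) (norm_nonneg _)

/-- For `σ < 0` the integral converges at `t = 0` too. The integral over `(0, ∞)` is homogeneous by
substitution, and the part over `(0, 1]` is smooth in `x`. -/
theorem exists_decomp_of_neg (hσ : σ < 0) (φ : 𝓢(Rn n, ℂ)) : ∃ f E, Decomp σ φ f 0 E := by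
  set E : Rn n → ℂ := fun x => ∫ t in Ioc (0 : ℝ) 1, t ^ (-σ - 1) • φ (t • x) with hE
  have hEs : ContDiff ℝ ∞ E :=
    contDiff_integral_comp_smul (φ.smooth ⊤) (integrableOn_Ioc_rpow (by linarith))
  have hsum : ∀ x, x ≠ 0 → tail σ φ x + E x = ∫ t in Ioi (0 : ℝ), t ^ (-σ - 1) • φ (t • x) := by
    intro x hx
    have hφ := φ.continuous
    rw [integral_Ioi_split zero_le_one (integrableOn_Ioc_rpow_smul (by linarith) (by fun_prop))
      (tail_integrable σ φ hx one_pos), add_comm]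
    rfl
  refine ⟨fun x => tail σ φ x + E x, E, ⟨(tail_contDiffOn σ φ).add hEs.contDiffOn,
    fun t ht x hx => ?_⟩, PolyHom.zero, hEs, fun x _ => by simp [polyEval_zero]⟩
  have h := integral_Ioi_dil σ φ ht le_rfl x
  rw [zero_mul] at h
  beta_reduce
  rw [hsum x hx, hsum (t • x) (smul_ne_zero ht.ne' hx), h, Complex.real_smul]

/-- Hadamard's lemma: `g x` is the mean of the derivative of `φ` over the segment from `0` to `x`.
-/
theorem hadamard_zero {φ : Rn n → ℂ} (hφ : ContDiff ℝ ∞ φ) : ∃ g : Rn n → (Rn n →L[ℝ] ℂ),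
    ContDiff ℝ ∞ g ∧ ∀ x, φ x - φ 0 = g x x := by
  have hφ' : ContDiff ℝ ∞ (fderiv ℝ φ) := hφ.fderiv_right (by norm_num)
  refine ⟨fun x => ∫ t in Ioc (0 : ℝ) 1, (1 : ℝ) • fderiv ℝ φ (t • x),
    contDiff_integral_comp_smul hφ' (by simp), fun x => ?_⟩
  have hc : Continuous fun t : ℝ => fderiv ℝ φ (t • x) := by
    have := hφ'.continuous
    fun_prop
  have hd : ∀ t ∈ uIcc (0 : ℝ) 1, HasDerivAt (fun t : ℝ => φ (t • x)) (fderiv ℝ φ (t • x) x) t := by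
    intro t _
    have h1 : HasDerivAt (fun t : ℝ => t • x) x t := by
      simpa using (hasDerivAt_id t).smul_const x
    exact ((hφ.differentiable (by simp)) (t • x)).hasFDerivAt.comp_hasDerivAt t h1
  have h := intervalIntegral.integral_eq_sub_of_hasDerivAt hd
    ((hc.clm_apply continuous_const).intervalIntegrable _ _)
  rw [intervalIntegral.integral_of_le zero_le_one, one_smul, zero_smul] at h
  rw [← h]
  simp only [one_smul]
  rw [ContinuousLinearMap.integral_apply]
  exact (hc.integrableOn_Icc).mono_set Ioc_subset_Icc_self

/-- The integral of `φ(t x) dt/t` over `(0, 1]` diverges because of `φ 0`. Writing `φ(t x) = φ 0 + t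
h x t`, the smooth part becomes `∫_0^1 h x t dt`, while `φ 0 ∫ dt/t` accounts for the logarithm. -/
theorem exists_decomp_zero (φ : 𝓢(Rn n, ℂ)) :
    ∃ f E, Decomp 0 φ f (MvPolynomial.C (φ 0)) E := by
  obtain ⟨g, hg, hgφ⟩ := hadamard_zero (φ.smooth ⊤)
  have hgc := hg.continuous
  have hφc := φ.continuous
  set h : Rn n → ℝ → ℂ := fun x t => g (t • x) x with hh
  have hhc : ∀ x, Continuous (h x) := fun x => by
    simp only [hh]; exact Continuous.clm_apply (by fun_prop) continuous_const
  have hht : ∀ x, ∀ t : ℝ, φ (t • x) = φ 0 + t • h x t := by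
    intro x t
    have := hgφ (t • x)
    rw [(g (t • x)).map_smul t x] at this
    rw [← this]; ring
  have hhl : ∀ x, ∀ l t : ℝ, h (l • x) t = l • h x (t * l) := fun x l t => by
    simp [hh, smul_smul]
  set E : Rn n → ℂ := fun x => ∫ t in Ioc (0 : ℝ) 1, h x t with hE
  have hEs : ContDiff ℝ ∞ E := by
    have h1 := contDiff_integral_comp_smul hg (w := fun _ => 1) (by simp)
    have h2 : ContDiff ℝ ∞ fun x => (∫ t in Ioc (0 : ℝ) 1, (1 : ℝ) • g (t • x)) x :=
      h1.clm_apply contDiff_id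
    convert h2 using 2 with x
    rw [ContinuousLinearMap.integral_apply]
    · simp [hE, hh]
    · have : Continuous fun t : ℝ => (1 : ℝ) • g (t • x) := by fun_prop
      exact (this.integrableOn_Icc).mono_set Ioc_subset_Icc_self
  have hint : ∀ x, ∀ a b : ℝ, IntegrableOn (h x) (Ioc a b) := fun x a b =>
    ((hhc x).integrableOn_Icc).mono_set Ioc_subset_Icc_self
  -- homogeneity for dilations by factors at least one
  have hhom : ∀ l : ℝ, 1 ≤ l → ∀ x, x ≠ 0 →
      tail 0 φ (l • x) + φ 0 * (Real.log ‖l • x‖ : ℂ) + E (l • x)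
        = tail 0 φ x + φ 0 * (Real.log ‖x‖ : ℂ) + E x := by
    intro l hl x hx
    have hl0 : 0 < l := by linarith
    have hT : tail 0 φ (l • x) = ∫ t in Ioi l, t ^ (-0 - 1 : ℝ) • φ (t • x) := by
      have := integral_Ioi_dil 0 φ hl0 zero_le_one x
      simpa [tail] using this
    have hT' : tail 0 φ x = (∫ t in Ioc 1 l, t ^ (-0 - 1 : ℝ) • φ (t • x))
        + ∫ t in Ioi l, t ^ (-0 - 1 : ℝ) • φ (t • x) :=
      integral_Ioi_split hl ((tail_integrable 0 φ hx one_pos).mono_set Ioc_subset_Ioi_self)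
        (tail_integrable 0 φ hx hl0)
    have hE' : E (l • x) = (∫ t in Ioc 0 1, h x t) + ∫ t in Ioc 1 l, h x t := by
      rw [← setIntegral_union (Ioc_disjoint_Ioc_of_le le_rfl) measurableSet_Ioc (hint x _ _)
        (hint x _ _), Ioc_union_Ioc_eq_Ioc zero_le_one hl]
      simp only [hE, hhl]
      rw [integral_smul, ← intervalIntegral.integral_of_le zero_le_one,
        ← intervalIntegral.integral_of_le hl0.le,
        intervalIntegral.smul_integral_comp_mul_right (f := h x)]
      simp
    have hI : ∫ t in Ioc 1 l, t ^ (-0 - 1 : ℝ) • φ (t • x)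
        = φ 0 * (Real.log l : ℂ) + ∫ t in Ioc 1 l, h x t := by
      have e : ∀ t ∈ Ioc (1 : ℝ) l, t ^ (-0 - 1 : ℝ) • φ (t • x)
          = (t⁻¹ : ℝ) • φ 0 + h x t := by
        intro t ht
        have ht0 : t ≠ 0 := by have := ht.1; linarith
        rw [hht, smul_add, smul_smul]
        have : t ^ (-0 - 1 : ℝ) = t⁻¹ := by
          rw [neg_zero, zero_sub, rpow_neg_one]
        rw [this, inv_mul_cancel₀ ht0, one_smul]
      have hinv : IntegrableOn (fun t : ℝ => t⁻¹) (Ioc 1 l) :=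
        (ContinuousOn.integrableOn_Icc (continuousOn_inv₀.mono fun t ht => by
          have := ht.1; simp only [mem_compl_iff, mem_singleton_iff]; linarith)).mono_set
          Ioc_subset_Icc_self
      rw [setIntegral_congr_fun measurableSet_Ioc e, integral_add (hinv.smul_const _)
        (hint x _ _), integral_smul_const, ← intervalIntegral.integral_of_le hl,
        integral_inv_of_pos one_pos hl0, div_one, Complex.real_smul, mul_comm]
    rw [hT, hT', hE', hI, norm_smul, Real.norm_of_nonneg hl0.le,
      Real.log_mul hl0.ne' (norm_ne_zero_iff.2 hx)]
    push_cast
    simp only [hE]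
    ring
  have hsm : ContDiffOn ℝ ∞ (fun x => tail 0 φ x + φ 0 * (Real.log ‖x‖ : ℂ) + E x) {0}ᶜ :=
    ((tail_contDiffOn 0 φ).add (contDiffOn_const.mul contDiffOn_log_norm)).add hEs.contDiffOn
  refine ⟨_, E, ⟨hsm, fun l hl x hx => ?_⟩, Or.inr ⟨0, by simp, MvPolynomial.isHomogeneous_C _ _⟩,
    hEs, fun x _ => by simp [polyEval]; ring⟩
  rw [rpow_zero, Complex.ofReal_one, one_mul]
  rcases le_total 1 l with h1 | h1
  · exact hhom l h1 x hx
  -- A contraction by `l` is undone by the expansion `l⁻¹ ≥ 1` applied at `l • x`.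
  · have := hhom l⁻¹ ((one_le_inv₀ hl).2 h1) (l • x) (smul_ne_zero hl.ne' hx)
    rw [inv_smul_smul₀ hl.ne'] at this
    exact this.symm

theorem fderiv_eq_sum_lineDeriv (φ : 𝓢(Rn n, ℂ)) (x y : Rn n) :
    fderiv ℝ φ y x = ∑ i, (x i : ℂ) * (∂_{(EuclideanSpace.single i 1 : Rn n)} φ) y := by
  have hx : x = ∑ i, x i • (EuclideanSpace.single i 1 : Rn n) := by
    have := (EuclideanSpace.basisFun (Fin n) ℝ).sum_repr x
    simpa using this.symm
  conv_lhs => rw [hx]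
  rw [map_sum]
  refine Finset.sum_congr rfl fun i _ => ?_
  rw [map_smul, SchwartzMap.lineDerivOp_apply_eq_fderiv, Complex.real_smul]

/-- Integration of the `t`-derivative of `t^(-σ) φ(t x)` over `(1, ∞)`. The degree drops by one, and
the boundary term `φ x` is smooth. -/
theorem tail_recursion (hσ : σ ≠ 0) (φ : 𝓢(Rn n, ℂ)) {x : Rn n} (hx : x ≠ 0) :
    tail σ φ x = (σ : ℂ)⁻¹ * (φ x + ∑ i, (x i : ℂ) *
      tail (σ - 1) (∂_{(EuclideanSpace.single i 1 : Rn n)} φ : 𝓢(Rn n, ℂ)) x) := by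
  set ψ : Fin n → 𝓢(Rn n, ℂ) := fun i => ∂_{(EuclideanSpace.single i 1 : Rn n)} φ with hψ
  have hi : ∀ i, IntegrableOn (fun t : ℝ => t ^ (-(σ - 1) - 1) • ψ i (t • x)) (Ioi 1) := fun i =>
    tail_integrable (σ - 1) (ψ i) hx one_pos
  have h0 := tail_integrable σ φ hx one_pos
  have hsum : IntegrableOn (fun t : ℝ => ∑ i, (x i : ℂ) * (t ^ (-(σ - 1) - 1) • ψ i (t • x)))
      (Ioi 1) := integrable_finsetSum _ fun i _ => (hi i).const_mul _
  have hder : ∀ t ∈ Ioi (1 : ℝ), HasDerivAt (fun t : ℝ => t ^ (-σ) • φ (t • x))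
      (-(σ : ℂ) * (t ^ (-σ - 1) • φ (t • x))
        + ∑ i, (x i : ℂ) * (t ^ (-(σ - 1) - 1) • ψ i (t • x))) t := by
    intro t ht
    have ht0 : 0 < t := lt_trans one_pos ht
    have h1 : HasDerivAt (fun t : ℝ => t • x) x t := by
      simpa using (hasDerivAt_id t).smul_const x
    have h2 := (φ.hasFDerivAt (t • x)).comp_hasDerivAt t h1
    have h3 : HasDerivAt (fun t : ℝ => t ^ (-σ) • φ (t • x)) (t ^ (-σ) • fderiv ℝ φ (t • x) x
        + (-σ * t ^ (-σ - 1)) • φ (t • x)) t :=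
      (Real.hasDerivAt_rpow_const (x := t) (p := -σ) (Or.inl ht0.ne')).smul h2
    refine h3.congr_deriv ?_
    rw [fderiv_eq_sum_lineDeriv, add_comm, Finset.smul_sum]
    congr 1
    · simp only [Complex.real_smul]
      push_cast; ring
    · refine Finset.sum_congr rfl fun i _ => ?_
      have : -(σ - 1) - 1 = -σ := by ring
      rw [this]
      simp only [Complex.real_smul, hψ]
      ring
  have hlim : Tendsto (fun t : ℝ => t ^ (-σ) • φ (t • x)) atTop (𝓝 0) := by
    obtain ⟨M, hM⟩ := exists_nat_gt (- σ)
    obtain ⟨C, hC0, hC⟩ := schwartz_decay_dil φ 0 M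
    have hz : Tendsto (fun t : ℝ => t ^ (-(σ + M)) * (C * ‖x‖ ^ (-M : ℝ))) atTop (𝓝 0) := by
      simpa using (tendsto_rpow_neg_atTop (by linarith : 0 < σ + M)).mul_const
        (C * ‖x‖ ^ (-M : ℝ))
    refine squeeze_zero_norm' ?_ hz
    filter_upwards [eventually_gt_atTop 0] with t ht
    rw [norm_smul, Real.norm_of_nonneg (by positivity)]
    have := hC t ht x hx
    rw [norm_iteratedFDeriv_zero] at this
    calc _ ≤ t ^ (-σ) * (C * t ^ (-M : ℝ) * ‖x‖ ^ (-M : ℝ)) := by gcongr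
      _ = (t ^ (-σ) * t ^ (-M : ℝ)) * (C * ‖x‖ ^ (-M : ℝ)) := by ring
      _ = _ := by rw [← rpow_add ht]; ring_nf
  have hcont : ContinuousWithinAt (fun t : ℝ => t ^ (-σ) • φ (t • x)) (Ici 1) 1 := by
    have := φ.continuous
    refine ContinuousAt.continuousWithinAt (ContinuousAt.fun_smul ?_ ?_)
    · exact Real.continuousAt_rpow_const _ _ (Or.inl one_ne_zero)
    · fun_prop
  have key := integral_Ioi_of_hasDerivAt_of_tendsto hcont hder
    ((h0.const_mul (-(σ : ℂ))).add hsum) hlim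
  rw [integral_add (h0.const_mul _) hsum, integral_const_mul,
    integral_finsetSum _ fun i _ => (hi i).const_mul _] at key
  simp only [integral_const_mul, one_rpow, one_smul, zero_sub] at key
  have hσ' : (σ : ℂ) ≠ 0 := by exact_mod_cast hσ
  rw [eq_inv_mul_iff_mul_eq₀ hσ']
  simp only [tail]
  linear_combination -key

/-- In `tail_recursion` the factors `x i` bring the homogeneous part and the polynomial back to
degree `σ`, and the boundary term joins the smooth part. -/
theorem exists_decomp_succ (hσ : 0 < σ) (φ : 𝓢(Rn n, ℂ))
    (h : ∀ ψ : 𝓢(Rn n, ℂ), ∃ f p E, Decomp (σ - 1) ψ f p E) : ∃ f p E, Decomp σ φ f p E := by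
  choose f p E hD using fun i : Fin n => h (∂_{(EuclideanSpace.single i 1 : Rn n)} φ)
  have hcoord : ∀ i : Fin n, PolyHom 1 (MvPolynomial.X i : MvPolynomial (Fin n) ℂ) := fun i =>
    Or.inr ⟨1, by simp, MvPolynomial.isHomogeneous_X _ _⟩
  have hpe : ∀ (i : Fin n) (x : Rn n), polyEval (MvPolynomial.X i) x = (x i : ℂ) := fun i x => by
    simp [polyEval]
  have hcs : ∀ i : Fin n, ContDiff ℝ ∞ (fun x : Rn n => (x i : ℂ)) := fun i => by
    simpa only [← hpe] using contDiff_polyEval (MvPolynomial.X i)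
  refine ⟨fun x => (σ : ℂ)⁻¹ * ∑ i, (x i : ℂ) * f i x,
    MvPolynomial.C (σ : ℂ)⁻¹ * ∑ i, MvPolynomial.X i * p i,
    fun x => (σ : ℂ)⁻¹ * (∑ i, (x i : ℂ) * E i x - φ x), ?_, ?_, ?_, ?_⟩
  · refine HomFun.const_mul _ (HomFun.sum fun i _ => ?_)
    have := (hcoord i).homFun.mul (hD i).hom
    simpa only [hpe, add_sub_cancel] using this
  · refine PolyHom.C_mul _ ?_
    by_cases hk : ∃ k : ℕ, (k : ℝ) = σ - 1
    · obtain ⟨k, hk⟩ := hk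
      refine Or.inr ⟨k + 1, by push_cast; linarith, ?_⟩
      refine MvPolynomial.IsHomogeneous.sum _ _ _ fun i _ => ?_
      have h1 : (p i).IsHomogeneous k := by
        have := (hD i).poly; rw [← hk] at this; exact this.isHomogeneous
      rw [add_comm]
      exact (MvPolynomial.isHomogeneous_X _ i).mul h1
    · left
      refine Finset.sum_eq_zero fun i _ => ?_
      rw [(hD i).poly.eq_zero hk, mul_zero]
  · refine contDiff_const.mul ((ContDiff.sum fun i _ => (hcs i).mul (hD i).smooth).sub (φ.smooth ⊤))
  · intro x hx
    rw [tail_recursion hσ.ne' φ hx]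
    have e : ∀ i, (x i : ℂ) * tail (σ - 1) (∂_{(EuclideanSpace.single i 1 : Rn n)} φ : 𝓢(Rn n, ℂ)) x
        = (x i : ℂ) * f i x - (x i : ℂ) * polyEval (p i) x * (Real.log ‖x‖ : ℂ)
          - (x i : ℂ) * E i x := fun i => by rw [(hD i).eq x hx]; ring
    have e2 : polyEval (MvPolynomial.C (σ : ℂ)⁻¹ * ∑ i, MvPolynomial.X i * p i) x
        = (σ : ℂ)⁻¹ * ∑ i, (x i : ℂ) * polyEval (p i) x := by
      simp [polyEval]
    rw [Finset.sum_congr rfl fun i _ => e i, e2, Finset.sum_sub_distrib, Finset.sum_sub_distrib,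
      ← Finset.sum_mul]
    ring

theorem exists_decomp (σ : ℝ) (φ : 𝓢(Rn n, ℂ)) : ∃ f p E, Decomp σ φ f p E := by
  -- Subtracting one from a positive `σ` ends at `σ = 0` for integers, which creates the logarithm,
  -- and at a negative degree otherwise.
  have main : ∀ N : ℕ, ∀ σ : ℝ, σ ≤ N → ∀ φ : 𝓢(Rn n, ℂ), ∃ f p E, Decomp σ φ f p E := by
    intro N
    induction N with
    | zero =>
      intro σ hσ φ
      rcases lt_or_eq_of_le (by simpa using hσ : σ ≤ 0) with h | rfl
      · obtain ⟨f, E, h⟩ := exists_decomp_of_neg h φ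
        exact ⟨f, 0, E, h⟩
      · obtain ⟨f, E, h⟩ := exists_decomp_zero φ
        exact ⟨f, _, E, h⟩
    | succ N ih =>
      intro σ hσ φ
      by_cases h : σ ≤ N
      · exact ih σ h φ
      · push Not at h
        exact exists_decomp_succ (lt_of_le_of_lt (Nat.cast_nonneg N) h) φ
          fun ψ => ih (σ - 1) (by push_cast at hσ; linarith) ψ
  obtain ⟨N, hN⟩ := exists_nat_ge σ
  exact main N σ hN φ

end Decomp


/-! ### Fourier identities -/

section Fourier

variable {n : ℕ}

theorem schwartzFourier_eq (φ : 𝓢(Rn n, ℂ)) (ξ : Rn n) :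
    schwartzFourier n φ ξ = 𝓕 (φ : Rn n → ℂ) ((2 * π)⁻¹ • ξ) := by
  rw [← SchwartzMap.fourier_coe]; rfl

theorem schwartzFourier_surjective : Function.Surjective (schwartzFourier n) := by
  intro ψ
  refine ⟨𝓕⁻ (SchwartzMap.compCLMOfContinuousLinearEquiv ℂ (dilationEquiv n).symm ψ), ?_⟩
  ext ξ
  have : schwartzFourier n (𝓕⁻ (SchwartzMap.compCLMOfContinuousLinearEquiv ℂ
      (dilationEquiv n).symm ψ)) ξ = (𝓕 (𝓕⁻ (SchwartzMap.compCLMOfContinuousLinearEquiv ℂ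
      (dilationEquiv n).symm ψ))) (dilationEquiv n ξ) := rfl
  rw [this, FourierTransform.fourier_fourierInv_eq]
  simp

/-- `ψ(t ·)` as a Schwartz function. -/
def schwartzDil (t : ℝ) (ht : t ≠ 0) : 𝓢(Rn n, ℂ) →L[ℂ] 𝓢(Rn n, ℂ) :=
  SchwartzMap.compCLMOfContinuousLinearEquiv ℂ (dil n t ht)

theorem schwartzDil_apply (t : ℝ) (ht : t ≠ 0) (ψ : 𝓢(Rn n, ℂ)) (x : Rn n) :
    schwartzDil t ht ψ x = ψ (t • x) := rfl

theorem integral_comp_smul_Rn {F : Type*} [NormedAddCommGroup F] [NormedSpace ℝ F]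
    (f : Rn n → F) {t : ℝ} (ht : 0 < t) :
    ∫ x, f (t • x) = t ^ (-n : ℝ) • ∫ x, f x := by
  rw [Measure.integral_comp_smul, finrank_euclideanSpace_fin, abs_of_pos (by positivity),
    rpow_neg ht.le, rpow_natCast]

theorem schwartzFourier_schwartzDil {t : ℝ} (ht : 0 < t) (ψ : 𝓢(Rn n, ℂ)) (ξ : Rn n) :
    schwartzFourier n (schwartzDil t ht.ne' ψ) ξ
      = ((t ^ (-n : ℝ) : ℝ) : ℂ) * schwartzFourier n ψ (t⁻¹ • ξ) := by
  rw [schwartzFourier_apply, schwartzFourier_apply, ← Complex.real_smul,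
    ← integral_comp_smul_Rn _ ht]
  refine integral_congr_ae (Eventually.of_forall fun x => ?_)
  simp only [schwartzDil_apply, inner_smul_left, inner_smul_right]
  have : (t : ℂ) ≠ 0 := by exact_mod_cast ht.ne'
  simp [this]

theorem integral_schwartzFourier_mul (φ ψ : 𝓢(Rn n, ℂ)) :
    ∫ x, schwartzFourier n φ x * ψ x = ∫ x, φ x * schwartzFourier n ψ x := by
  -- The factor `(2π)⁻¹` in the pairing converts the kernel `e^(-2πi x·ξ)` into `e^(-i x·ξ)`; as the
  -- pairing is symmetric, `L` and `L.flip` give the same transform.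
  set L : Rn n →ₗ[ℝ] Rn n →ₗ[ℝ] ℝ := (2 * π)⁻¹ • innerₗ (Rn n) with hL
  have h1 : ∀ (φ : 𝓢(Rn n, ℂ)) x, schwartzFourier n φ x
      = VectorFourier.fourierIntegral 𝐞 volume L φ x := fun φ x => by
    rw [schwartzFourier_eq, Real.fourier_eq]
    refine integral_congr_ae (Eventually.of_forall fun y => ?_)
    simp [hL, inner_smul_right]
  have h2 : ∀ (φ : 𝓢(Rn n, ℂ)) x, schwartzFourier n φ x
      = VectorFourier.fourierIntegral 𝐞 volume L.flip φ x := fun φ x => by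
    rw [schwartzFourier_eq, Real.fourier_eq]
    refine integral_congr_ae (Eventually.of_forall fun y => ?_)
    simp [hL, inner_smul_right, real_inner_comm]
  simp only [h1 φ, h2 ψ]
  refine VectorFourier.integral_fourierIntegral_smul_eq_flip (L := L) Real.continuous_fourierChar
    ?_ φ.integrable ψ.integrable
  simp only [hL, LinearMap.smul_apply, innerₗ_apply_apply]
  fun_prop

/-- `(2π)^{-n} ∫ e^{i x·ξ} κ(x) dx`. -/
def invFourier (κ : Rn n → ℂ) (ξ : Rn n) : ℂ :=
  (((2 * π) ^ (-n : ℝ) : ℝ) : ℂ) * 𝓕 κ (-((2 * π)⁻¹ • ξ))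

/-- Only `ψ` is written as a transform, by inversion on Schwartz functions, so integrability of `κ`
is enough; this matters because `cutTail` may jump on the unit sphere. -/
theorem integral_mul_eq_invFourier {κ : Rn n → ℂ} (hκ : Integrable κ) (ψ : 𝓢(Rn n, ℂ)) :
    ∫ x, κ x * ψ x = ∫ ξ, invFourier κ ξ * schwartzFourier n ψ ξ := by
  have h1 : ∫ x, κ x * ψ x = ∫ w, 𝓕 κ w * (𝓕⁻ ψ : 𝓢(Rn n, ℂ)) w := by
    have := VectorFourier.integral_fourierIntegral_smul_eq_flip (L := innerₗ (Rn n))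
      (μ := volume) (ν := volume)
      Real.continuous_fourierChar continuous_inner hκ (𝓕⁻ ψ : 𝓢(Rn n, ℂ)).integrable
    rw [flip_innerₗ] at this
    refine Eq.trans ?_ this.symm
    refine integral_congr_ae (Eventually.of_forall fun y => ?_)
    have h : ψ y = (𝓕 (𝓕⁻ ψ : 𝓢(Rn n, ℂ))) y := by rw [FourierTransform.fourier_fourierInv_eq]
    beta_reduce
    rw [h]; rfl
  rw [h1, ← integral_neg_eq_self]
  have h2 := integral_comp_smul_Rn (n := n)
    (fun w => 𝓕 κ (-w) * (𝓕⁻ ψ : 𝓢(Rn n, ℂ)) (-w)) (t := (2 * π)⁻¹) (by positivity)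
  rw [inv_rpow (by positivity), ← rpow_neg (by positivity), neg_neg] at h2
  have h3 : (∫ w, 𝓕 κ (-w) * (𝓕⁻ ψ : 𝓢(Rn n, ℂ)) (-w)) = (2 * π) ^ (-n : ℝ) •
      ∫ x : Rn n, 𝓕 κ (-((2 * π)⁻¹ • x)) * (𝓕⁻ ψ : 𝓢(Rn n, ℂ)) (-((2 * π)⁻¹ • x)) := by
    rw [h2, smul_smul, ← rpow_add (by positivity)]; simp
  rw [h3, Complex.real_smul, ← integral_const_mul]
  refine integral_congr_ae (Eventually.of_forall fun y => ?_)
  simp only [invFourier, schwartzFourier_eq]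
  have : (𝓕⁻ ψ : 𝓢(Rn n, ℂ)) (-((2 * π)⁻¹ • y)) = 𝓕 (ψ : Rn n → ℂ) ((2 * π)⁻¹ • y) := by
    rw [SchwartzMap.fourierInv_coe, Real.fourierInv_eq_fourier_neg, neg_neg]
  rw [this]; ring

theorem integral_mul_comp_smul_eq_invFourier {κ : Rn n → ℂ} (hκ : Integrable κ) (ψ : 𝓢(Rn n, ℂ))
    {ε : ℝ} (hε : 0 < ε) :
    ∫ x, κ x * ψ (ε • x) = ∫ ξ, invFourier κ (ε • ξ) * schwartzFourier n ψ ξ := by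
  have h := integral_mul_eq_invFourier hκ (schwartzDil ε hε.ne' ψ)
  simp only [schwartzDil_apply, schwartzFourier_schwartzDil hε] at h
  rw [h]
  have h2 := integral_comp_smul_Rn (n := n)
    (fun ξ => invFourier κ ξ * schwartzFourier n ψ (ε⁻¹ • ξ)) hε
  simp only [inv_smul_smul₀ hε.ne'] at h2
  rw [h2, Complex.real_smul, ← integral_const_mul]
  refine integral_congr_ae (Eventually.of_forall fun y => ?_)
  beta_reduce; ring

theorem invFourier_contDiff {κ : Rn n → ℂ} (hκ : ∀ k : ℕ, Integrable fun v => ‖v‖ ^ k * ‖κ v‖) :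
    ContDiff ℝ ∞ (invFourier κ) := by
  refine contDiff_const.mul ((Real.contDiff_fourier (N := ⊤) fun k _ => hκ k).comp ?_)
  fun_prop

theorem norm_iteratedFDeriv_invFourier_le {κ : Rn n → ℂ}
    (hκ : ∀ k : ℕ, Integrable fun v => ‖v‖ ^ k * ‖κ v‖) (k : ℕ) :
    ∃ C : ℝ, 0 ≤ C ∧ ∀ ξ, ‖iteratedFDeriv ℝ k (invFourier κ) ξ‖
      ≤ C * ‖iteratedFDeriv ℝ k (𝓕 κ) (-((2 * π)⁻¹ • ξ))‖ := by
  set L : Rn n ≃L[ℝ] Rn n := dil n (-(2 * π)⁻¹) (neg_ne_zero.2 (inv_ne_zero two_pi_pos.ne'))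
  have hs : ContDiff ℝ ∞ (𝓕 κ) := Real.contDiff_fourier (N := ⊤) fun k _ => hκ k
  refine ⟨‖(((2 * π) ^ (-n : ℝ) : ℝ) : ℂ)‖ * ∏ _i : Fin k, ‖(L : Rn n →L[ℝ] Rn n)‖,
    mul_nonneg (norm_nonneg _) (Finset.prod_nonneg fun _ _ => norm_nonneg _), fun ξ => ?_⟩
  have hL : ∀ ξ : Rn n, (L : Rn n →L[ℝ] Rn n) ξ = -((2 * π)⁻¹ • ξ) := fun ξ => by
    simp [L, dil_apply, neg_smul]
  have e : invFourier κ = (((2 * π) ^ (-n : ℝ) : ℝ) : ℂ) • (𝓕 κ ∘ (L : Rn n →L[ℝ] Rn n)) := by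
    ext ξ
    simp only [invFourier, Pi.smul_apply, Function.comp_apply, hL, smul_eq_mul]
  have hcd : ContDiff ℝ ∞ (𝓕 κ ∘ (L : Rn n →L[ℝ] Rn n)) := hs.comp (ContinuousLinearMap.contDiff _)
  rw [e, iteratedFDeriv_const_smul_apply (hcd.contDiffAt.of_le (by exact_mod_cast le_top)), norm_smul,
    mul_assoc]
  refine mul_le_mul_of_nonneg_left ?_ (norm_nonneg _)
  rw [ContinuousLinearMap.iteratedFDeriv_comp_right _ hs _ (by exact_mod_cast le_top), mul_comm,
    ← hL]
  exact ContinuousMultilinearMap.norm_compContinuousLinearMap_le _ _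

theorem invFourier_bound {κ : Rn n → ℂ} (hm : AEStronglyMeasurable κ volume)
    (hκ : ∀ k : ℕ, Integrable fun v => ‖v‖ ^ k * ‖κ v‖) (k : ℕ) :
    ∃ C : ℝ, ∀ ξ, ‖iteratedFDeriv ℝ k (invFourier κ) ξ‖ ≤ C := by
  obtain ⟨C, hC0, hC⟩ := norm_iteratedFDeriv_invFourier_le hκ k
  refine ⟨C * ∫ v, (2 * π * ‖(innerSL ℝ : Rn n →L[ℝ] _)‖) ^ k * ‖v‖ ^ k * ‖κ v‖,
    fun ξ => (hC ξ).trans (mul_le_mul_of_nonneg_left ?_ hC0)⟩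
  rw [Real.iteratedFDeriv_fourier (N := ⊤) (fun k _ => hκ k) hm le_top]
  refine (VectorFourier.norm_fourierIntegral_le_integral_norm _ _ _ _ _).trans ?_
  refine integral_mono_of_nonneg (Eventually.of_forall fun v => norm_nonneg _) ?_
    (Eventually.of_forall fun v => VectorFourier.norm_fourierPowSMulRight_le _ _ _ _)
  simpa only [mul_assoc] using (hκ k).const_mul _

end Fourier


/-! ### Taylor polynomials -/

section Taylor

variable {n : ℕ} {F : Type*} [NormedAddCommGroup F] [NormedSpace ℝ F]

/-- The homogeneous part of degree `k` of the Taylor expansion at the origin. -/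
def taylorTerm (Φ : Rn n → F) (k : ℕ) (x : Rn n) : F :=
  (k.factorial : ℝ)⁻¹ • iteratedFDeriv ℝ k Φ 0 (fun _ => x)

theorem taylorTerm_smul (Φ : Rn n → F) (k : ℕ) (t : ℝ) (x : Rn n) :
    taylorTerm Φ k (t • x) = t ^ k • taylorTerm Φ k x := by
  unfold taylorTerm
  have := (iteratedFDeriv ℝ k Φ 0).map_smul_univ (fun _ => t) (fun _ => x)
  rw [this, smul_comm]; simp

theorem norm_taylorTerm_le (Φ : Rn n → F) (k : ℕ) (x : Rn n) :
    ‖taylorTerm Φ k x‖ ≤ ‖iteratedFDeriv ℝ k Φ 0‖ * ‖x‖ ^ k := by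
  unfold taylorTerm
  rw [norm_smul]
  have h1 := (iteratedFDeriv ℝ k Φ 0).le_opNorm (fun _ => x)
  simp only [Finset.prod_const, Finset.card_univ, Fintype.card_fin] at h1
  have h2 : ‖(k.factorial : ℝ)⁻¹‖ ≤ 1 := by
    rw [norm_inv, Real.norm_natCast]
    exact inv_le_one_of_one_le₀ (by exact_mod_cast Nat.one_le_iff_ne_zero.2 k.factorial_ne_zero)
  calc _ ≤ 1 * (‖iteratedFDeriv ℝ k Φ 0‖ * ‖x‖ ^ k) :=
        mul_le_mul h2 h1 (norm_nonneg _) zero_le_one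
    _ = _ := one_mul _

theorem iteratedDeriv_comp_smul_const {Φ : Rn n → F} (hΦ : ContDiff ℝ ∞ Φ) (x : Rn n) (k : ℕ)
    (t : ℝ) : iteratedDeriv k (fun t : ℝ => Φ (t • x)) t = iteratedFDeriv ℝ k Φ (t • x) fun _ => x := by
  have e : (fun t : ℝ => Φ (t • x)) = Φ ∘ (ContinuousLinearMap.toSpanSingleton ℝ x) := by
    ext t; simp
  rw [iteratedDeriv_eq_iteratedFDeriv, e,
    ContinuousLinearMap.iteratedFDeriv_comp_right _ hΦ _ (by exact_mod_cast le_top)]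
  simp

/-- Taylor's formula in one variable for `t ↦ Φ(t x)` on `[0, 1]`; the factorial in the remainder is
thrown away. -/
theorem norm_sub_taylor_le {Φ : Rn n → F} (hΦ : ContDiff ℝ ∞ Φ) (K : ℕ) (x : Rn n) {C : ℝ}
    (hC : ∀ t ∈ Icc (0 : ℝ) 1, ‖iteratedFDeriv ℝ (K + 1) Φ (t • x)‖ ≤ C) :
    ‖Φ x - ∑ k ∈ Finset.range (K + 1), taylorTerm Φ k x‖ ≤ C * ‖x‖ ^ (K + 1) := by
  set g : ℝ → F := fun t => Φ (t • x) with hg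
  have hgs : ContDiff ℝ ∞ g := hΦ.comp (by fun_prop)
  have hit : ∀ k, ∀ t ∈ Icc (0 : ℝ) 1, iteratedDerivWithin k g (Icc 0 1) t
      = iteratedFDeriv ℝ k Φ (t • x) fun _ => x := fun k t ht => by
    rw [iteratedDerivWithin_eq_iteratedDeriv (uniqueDiffOn_Icc zero_lt_one)
      (hgs.contDiffAt.of_le (by exact_mod_cast le_top)) ht, iteratedDeriv_comp_smul_const hΦ]
  have h := taylor_mean_remainder_bound (f := g) (n := K) (C := C * ‖x‖ ^ (K + 1)) zero_le_one
    (hgs.contDiffOn.of_le (by exact_mod_cast le_top)) (x := 1) (by simp) (fun t ht => by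
      rw [hit _ t ht]
      refine ((iteratedFDeriv ℝ (K + 1) Φ (t • x)).le_opNorm _).trans ?_
      simp only [Finset.prod_const, Finset.card_univ, Fintype.card_fin]
      exact mul_le_mul_of_nonneg_right (hC t ht) (by positivity))
  have e : taylorWithinEval g K (Icc 0 1) 0 1 = ∑ k ∈ Finset.range (K + 1), taylorTerm Φ k x := by
    rw [taylor_within_apply]
    refine Finset.sum_congr rfl fun k _ => ?_
    rw [hit k 0 (by simp)]
    simp [taylorTerm]
  have hC0 : 0 ≤ C * ‖x‖ ^ (K + 1) :=
    mul_nonneg ((norm_nonneg _).trans (hC 0 (by simp))) (by positivity)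
  rw [e] at h
  simp only [hg, one_smul, sub_zero, one_pow, mul_one] at h
  exact h.trans (div_le_self hC0 (by exact_mod_cast Nat.one_le_iff_ne_zero.2 K.factorial_ne_zero))

/-- The form `∑ w(f) x_{f 0} ⋯ x_{f (k-1)}`. -/
def formPoly {k : ℕ} (w : (Fin k → Fin n) → ℂ) : MvPolynomial (Fin n) ℂ :=
  ∑ f, MvPolynomial.C (w f) * ∏ i, MvPolynomial.X (f i)

theorem formPoly_isHomogeneous {k : ℕ} (w : (Fin k → Fin n) → ℂ) :
    (formPoly w).IsHomogeneous k := by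
  refine MvPolynomial.IsHomogeneous.sum _ _ _ fun f _ => ?_
  have h := MvPolynomial.IsHomogeneous.prod (R := ℂ) Finset.univ
    (fun i : Fin k => MvPolynomial.X (f i)) (fun _ => 1)
    (fun i _ => MvPolynomial.isHomogeneous_X _ (f i))
  simp only [Finset.sum_const, Finset.card_univ, Fintype.card_fin, smul_eq_mul, mul_one] at h
  have h2 := (MvPolynomial.isHomogeneous_C (Fin n) (w f)).mul h
  rwa [zero_add] at h2

theorem polyEval_formPoly {k : ℕ} (w : (Fin k → Fin n) → ℂ) (x : Rn n) :
    polyEval (formPoly w) x = ∑ f, w f * ∏ i, (x (f i) : ℂ) := by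
  simp [polyEval, formPoly]

theorem exists_poly_taylorTerm (Φ : Rn n → ℂ) (k : ℕ) : ∃ q : MvPolynomial (Fin n) ℂ,
    q.IsHomogeneous k ∧ ∀ x, polyEval q x = taylorTerm Φ k x := by
  refine ⟨formPoly fun f => (((k.factorial : ℝ)⁻¹ : ℝ) : ℂ) *
    iteratedFDeriv ℝ k Φ 0 fun i => EuclideanSpace.single (f i) 1,
    formPoly_isHomogeneous _, fun x => ?_⟩
  have hx : x = ∑ i, x i • (EuclideanSpace.single i 1 : Rn n) := by
    have := (EuclideanSpace.basisFun (Fin n) ℝ).sum_repr x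
    simpa using this.symm
  have h1 : iteratedFDeriv ℝ k Φ 0 (fun _ => x) = ∑ f : Fin k → Fin n, (∏ i, x (f i)) •
      iteratedFDeriv ℝ k Φ 0 fun i => EuclideanSpace.single (f i) 1 := by
    conv_lhs => rw [hx]
    rw [ContinuousMultilinearMap.map_sum]
    exact Finset.sum_congr rfl fun f _ => ContinuousMultilinearMap.map_smul_univ _ _ _
  rw [polyEval_formPoly, taylorTerm, h1, Complex.real_smul, Finset.mul_sum]
  refine Finset.sum_congr rfl fun f _ => ?_
  rw [Complex.real_smul]
  push_cast; ring

theorem contDiff_taylorTerm (Φ : Rn n → ℂ) (k : ℕ) : ContDiff ℝ ∞ (taylorTerm Φ k) := by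
  obtain ⟨q, -, hq⟩ := exists_poly_taylorTerm Φ k
  have : taylorTerm Φ k = polyEval q := funext fun x => (hq x).symm
  rw [this]; exact contDiff_polyEval q

theorem integrable_pow_mul (g : 𝓢(Rn n, ℂ)) (M : ℕ) :
    Integrable fun x => (1 + ‖x‖) ^ M * ‖g x‖ := by
  have h : Moderate fun x : Rn n => ((1 + ‖x‖ : ℝ) : ℂ) ^ M := by
    refine moderate_of_bound (C := 1) (k := M) (Continuous.aestronglyMeasurable (by fun_prop))
      fun x => ?_
    rw [norm_pow, Complex.norm_real, Real.norm_of_nonneg (by positivity), one_mul]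
  refine (h.integrable_mul g).norm.congr (Eventually.of_forall fun x => ?_)
  simp only [norm_mul, norm_pow]
  rw [Complex.norm_real, Real.norm_of_nonneg (by positivity)]

/-- Asymptotic expansion of `∫ Φ(ε x) g(x) dx`. -/
theorem exists_expansion {Φ : Rn n → ℂ} (hΦ : ContDiff ℝ ∞ Φ)
    (hb : ∀ k : ℕ, ∃ (C : ℝ) (M : ℕ), ∀ x, ‖iteratedFDeriv ℝ k Φ x‖ ≤ C * (1 + ‖x‖) ^ M)
    (g : 𝓢(Rn n, ℂ)) (K : ℕ) : ∃ C : ℝ, ∀ ε : ℝ, 0 < ε → ε ≤ 1 →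
      ‖(∫ x, Φ (ε • x) * g x) - ∑ k ∈ Finset.range (K + 1), (ε : ℂ) ^ k * ∫ x, taylorTerm Φ k x * g x‖
        ≤ C * ε ^ (K + 1) := by
  obtain ⟨C, M, hC⟩ := hb (K + 1)
  obtain ⟨C₀, M₀, hC₀⟩ := hb 0
  have hC' : 0 ≤ C := by have := (norm_nonneg _).trans (hC 0); simpa using this
  have hC₀' : 0 ≤ C₀ := by have := (norm_nonneg _).trans (hC₀ 0); simpa using this
  have hint : ∀ ε : ℝ, 0 < ε → ε ≤ 1 → Integrable fun x => Φ (ε • x) * g x := by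
    intro ε h0 h1
    refine (moderate_of_bound (C := C₀) (k := M₀) (Continuous.aestronglyMeasurable
      (hΦ.continuous.comp (by fun_prop))) fun x => ?_).integrable_mul g
    have := hC₀ (ε • x)
    rw [norm_iteratedFDeriv_zero, norm_smul, Real.norm_of_nonneg h0.le] at this
    refine this.trans ?_
    gcongr
    exact mul_le_of_le_one_left (norm_nonneg _) h1
  have hint' : ∀ k, Integrable fun x => taylorTerm Φ k x * g x := fun k => by
    refine (moderate_of_bound (C := ‖iteratedFDeriv ℝ k Φ 0‖) (k := k)
      (contDiff_taylorTerm Φ k).continuous.aestronglyMeasurable fun x =>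
        (norm_taylorTerm_le Φ k x).trans ?_).integrable_mul g
    gcongr; linarith
  refine ⟨∫ x, C * ((1 + ‖x‖) ^ (M + (K + 1)) * ‖g x‖), fun ε h0 h1 => ?_⟩
  have e : (∫ x, Φ (ε • x) * g x) - ∑ k ∈ Finset.range (K + 1), (ε : ℂ) ^ k *
      ∫ x, taylorTerm Φ k x * g x
      = ∫ x, (Φ (ε • x) - ∑ k ∈ Finset.range (K + 1), taylorTerm Φ k (ε • x)) * g x := by
    have e2 : ∀ x, (Φ (ε • x) - ∑ k ∈ Finset.range (K + 1), taylorTerm Φ k (ε • x)) * g x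
        = Φ (ε • x) * g x - ∑ k ∈ Finset.range (K + 1), (ε : ℂ) ^ k * (taylorTerm Φ k x * g x) := by
      intro x
      rw [sub_mul, Finset.sum_mul]
      congr 1
      refine Finset.sum_congr rfl fun k _ => ?_
      rw [taylorTerm_smul, Complex.real_smul]; push_cast; ring
    simp only [e2]
    rw [integral_sub (hint ε h0 h1) (integrable_finsetSum _ fun k _ => (hint' k).const_mul _),
      integral_finsetSum _ fun k _ => (hint' k).const_mul _]
    simp only [integral_const_mul]
  rw [e, ← integral_mul_const]
  refine norm_integral_le_of_norm_le (((integrable_pow_mul g _).const_mul C).mul_const _)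
    (Eventually.of_forall fun x => ?_)
  rw [norm_mul]
  have h := norm_sub_taylor_le hΦ K (ε • x) (C := C * (1 + ‖x‖) ^ M) (fun t ht => by
    refine (hC (t • ε • x)).trans ?_
    gcongr
    rw [smul_smul, norm_smul, Real.norm_of_nonneg (mul_nonneg ht.1 h0.le)]
    exact mul_le_of_le_one_left (norm_nonneg _) (mul_le_one₀ ht.2 h0.le h1))
  rw [norm_smul, Real.norm_of_nonneg h0.le, mul_pow] at h
  calc _ ≤ (C * (1 + ‖x‖) ^ M * (ε ^ (K + 1) * ‖x‖ ^ (K + 1))) * ‖g x‖ :=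
        mul_le_mul_of_nonneg_right h (norm_nonneg _)
    _ ≤ (C * (1 + ‖x‖) ^ M * (ε ^ (K + 1) * (1 + ‖x‖) ^ (K + 1))) * ‖g x‖ := by
        gcongr; linarith
    _ = _ := by rw [pow_add (1 + ‖x‖)]; ring

end Taylor

/-! ### Finite parts -/

section FinitePart

variable {I J : ℝ → ℂ} {L L' : ℂ}

theorem IsFinitePart.congr (h : IsFinitePart I L) (e : I =ᶠ[𝓝[>] 0] J) : IsFinitePart J L := by
  obtain ⟨A, c, b, hA, hI⟩ := h
  refine ⟨A, c, b, hA, hI.congr' ?_⟩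
  filter_upwards [e] with ε hε
  rw [hε]

theorem IsFinitePart.of_tendsto (h : Tendsto I (𝓝[>] 0) (𝓝 L)) : IsFinitePart I L :=
  ⟨∅, 0, 0, by simp, by simpa using h⟩

theorem IsFinitePart.add (h : IsFinitePart I L) (h' : IsFinitePart J L') :
    IsFinitePart (fun ε => I ε + J ε) (L + L') := by
  classical
  obtain ⟨A, c, b, hA, hI⟩ := h
  obtain ⟨A', c', b', hA', hJ⟩ := h'
  refine ⟨A ∪ A', fun a => (if a ∈ A then c a else 0) + (if a ∈ A' then c' a else 0), b + b',
    fun a ha => ?_, (hI.add hJ).congr fun ε => ?_⟩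
  · rcases Finset.mem_union.1 ha with h | h
    exacts [hA a h, hA' a h]
  · simp only [add_mul, Finset.sum_add_distrib, ite_mul, zero_mul]
    rw [← Finset.sum_filter, ← Finset.sum_filter, Finset.filter_mem_eq_inter,
      Finset.filter_mem_eq_inter, Finset.inter_eq_right.2 Finset.subset_union_left,
      Finset.inter_eq_right.2 Finset.subset_union_right]
    ring

theorem IsFinitePart.const_mul (z : ℂ) (h : IsFinitePart I L) :
    IsFinitePart (fun ε => z * I ε) (z * L) := by
  obtain ⟨A, c, b, hA, hI⟩ := h
  refine ⟨A, fun a => z * c a, z * b, hA, (hI.const_mul z).congr fun ε => ?_⟩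
  simp only [mul_sub, Finset.mul_sum, mul_assoc]

theorem IsFinitePart.sum {ι : Type*} {s : Finset ι} {I : ι → ℝ → ℂ} {L : ι → ℂ}
    (h : ∀ i ∈ s, IsFinitePart (I i) (L i)) :
    IsFinitePart (fun ε => ∑ i ∈ s, I i ε) (∑ i ∈ s, L i) := by
  classical
  induction s using Finset.induction_on with
  | empty => exact IsFinitePart.of_tendsto (by simp)
  | insert a s ha ih =>
    simp only [Finset.sum_insert ha]
    exact (h a (Finset.mem_insert_self _ _)).add
      (ih fun i hi => h i (Finset.mem_insert_of_mem hi))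

theorem isFinitePart_log (b : ℂ) : IsFinitePart (fun ε => b * (Real.log ε : ℂ)) 0 :=
  ⟨∅, 0, b, by simp, by simp⟩

theorem tendsto_ofReal_rpow {a : ℝ} (ha : 0 < a) :
    Tendsto (fun ε : ℝ => ((ε ^ a : ℝ) : ℂ)) (𝓝[>] 0) (𝓝 0) := by
  have h : Tendsto (fun ε : ℝ => ε ^ a) (𝓝[>] 0) (𝓝 0) := by
    have := (Real.continuousAt_rpow_const 0 a (Or.inr ha.le)).tendsto
    rw [zero_rpow ha.ne'] at this
    exact this.mono_left nhdsWithin_le_nhds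
  have h2 := (Complex.continuous_ofReal.tendsto 0).comp h
  rw [Complex.ofReal_zero] at h2
  exact h2

/-- Negative powers are discarded and positive ones tend to zero, so only the exponent `0`
contributes. -/
theorem isFinitePart_rpow (z : ℂ) (a : ℝ) :
    IsFinitePart (fun ε => z * ((ε ^ a : ℝ) : ℂ)) (if a = 0 then z else 0) := by
  rcases lt_trichotomy a 0 with h | rfl | h
  · rw [if_neg h.ne]
    exact ⟨{a}, fun _ => z, 0, by simpa using h, by simp⟩
  · exact IsFinitePart.of_tendsto (by simp)
  · rw [if_neg h.ne']
    exact IsFinitePart.of_tendsto (by simpa using (tendsto_ofReal_rpow h).const_mul z)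

/-- After multiplication by `ε^(-μ)` only the coefficient of `ε^μ` is left in the finite part, hence
nothing unless `μ` is a natural number. This is the source of the polynomial ambiguity in the
correspondence. -/
theorem isFinitePart_expansion {μ C : ℝ} {K : ℕ} {a : ℕ → ℂ} (hK : μ < K)
    (h : ∀ ε : ℝ, 0 < ε → ε ≤ 1 → ‖J ε - ∑ k ∈ Finset.range K, (ε : ℂ) ^ k * a k‖ ≤ C * ε ^ K) :
    IsFinitePart (fun ε => ((ε ^ (-μ) : ℝ) : ℂ) * J ε)
      (∑ k ∈ Finset.range K, if (k : ℝ) = μ then a k else 0) := by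
  have h1 : IsFinitePart (fun ε => ∑ k ∈ Finset.range K, a k * ((ε ^ ((k : ℝ) - μ) : ℝ) : ℂ))
      (∑ k ∈ Finset.range K, if (k : ℝ) = μ then a k else 0) := by
    refine IsFinitePart.sum fun k _ => ?_
    simpa only [sub_eq_zero] using isFinitePart_rpow (a k) ((k : ℝ) - μ)
  have h2 : Tendsto (fun ε : ℝ => ((ε ^ (-μ) : ℝ) : ℂ) *
      (J ε - ∑ k ∈ Finset.range K, (ε : ℂ) ^ k * a k)) (𝓝[>] 0) (𝓝 0) := by
    have hz : Tendsto (fun ε : ℝ => C * ‖((ε ^ ((K : ℝ) - μ) : ℝ) : ℂ)‖) (𝓝[>] 0) (𝓝 0) := by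
      simpa using (tendsto_ofReal_rpow (sub_pos.2 hK)).norm.const_mul C
    refine squeeze_zero_norm' ?_ hz
    filter_upwards [Ioc_mem_nhdsGT (zero_lt_one (α := ℝ))] with ε hε
    have hε0 := hε.1
    rw [norm_mul, Complex.norm_real, Complex.norm_real, Real.norm_of_nonneg (by positivity),
      Real.norm_of_nonneg (by positivity), sub_eq_neg_add (K : ℝ), rpow_add hε0, rpow_natCast]
    calc _ ≤ ε ^ (-μ) * (C * ε ^ K) := by gcongr; exact h ε hε0 hε.2
      _ = _ := by ring
  have h3 := h1.add (IsFinitePart.of_tendsto h2)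
  rw [add_zero] at h3
  refine h3.congr ?_
  filter_upwards [self_mem_nhdsWithin] with ε (hε : 0 < ε)
  rw [mul_sub, Finset.mul_sum]
  have : ∀ k : ℕ, a k * ((ε ^ ((k : ℝ) - μ) : ℝ) : ℂ) = ((ε ^ (-μ) : ℝ) : ℂ) * ((ε : ℂ) ^ k * a k) := by
    intro k
    rw [sub_eq_neg_add, rpow_add hε, rpow_natCast]; push_cast; ring
  simp only [this]; ring

/-- Induction on the most singular exponent `m`: after multiplication by `ε^(-m)` everything but `c
m` tends to zero, so `c m = 0`. In the end only `b log ε` remains, which is unbounded unless `b =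
0`. -/
theorem finitePart_aux (A : Finset ℝ) : ∀ (c : ℝ → ℂ) (b z : ℂ), (∀ a ∈ A, a < 0) →
    Tendsto (fun ε : ℝ => ∑ a ∈ A, c a * ((ε ^ a : ℝ) : ℂ) + b * (Real.log ε : ℂ)) (𝓝[>] 0) (𝓝 z) →
    z = 0 := by
  classical
  refine Finset.induction_on_min A ?_ ?_
  · intro c b z _ h
    simp only [Finset.sum_empty, zero_add] at h
    by_cases hb : b = 0
    · subst hb
      simp only [zero_mul] at h
      exact tendsto_nhds_unique h tendsto_const_nhds
    · exfalso
      have h1 : Tendsto (fun ε : ℝ => ‖b * (Real.log ε : ℂ)‖) (𝓝[>] 0) atTop := by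
        simp only [norm_mul, Complex.norm_real]
        exact (tendsto_abs_atBot_atTop.comp Real.tendsto_log_nhdsGT_zero).const_mul_atTop
          (norm_pos_iff.2 hb)
      exact not_tendsto_nhds_of_tendsto_atTop h1 _ h.norm
  · intro m A hm ih c b z hA h
    have hmA : m ∉ A := fun hmem => lt_irrefl _ (hm m hmem)
    have hm0 : m < 0 := hA m (Finset.mem_insert_self _ _)
    have hcm : c m = 0 := by
      have h1 := (tendsto_ofReal_rpow (neg_pos.2 hm0)).mul h
      rw [zero_mul] at h1
      have h2 : Tendsto (fun ε : ℝ => ((ε ^ (-m) : ℝ) : ℂ) * (b * (Real.log ε : ℂ))) (𝓝[>] 0) (𝓝 0) := by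
        have := tendsto_log_mul_rpow_nhdsGT_zero (neg_pos.2 hm0)
        have h3 := ((Complex.continuous_ofReal.tendsto 0).comp this).const_mul b
        simp only [Complex.ofReal_zero, mul_zero] at h3
        refine h3.congr fun ε => ?_
        simp only [Function.comp_apply]; push_cast; ring
      have h4 : Tendsto (fun ε : ℝ => ∑ a ∈ A, c a * ((ε ^ (a - m) : ℝ) : ℂ)) (𝓝[>] 0) (𝓝 0) := by
        have : ∀ a ∈ A, Tendsto (fun ε : ℝ => c a * ((ε ^ (a - m) : ℝ) : ℂ)) (𝓝[>] 0) (𝓝 0) :=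
          fun a ha => by
            simpa using (tendsto_ofReal_rpow (sub_pos.2 (hm a ha))).const_mul (c a)
        simpa using tendsto_finsetSum A this
      have h5 := (h1.sub h2).sub h4
      simp only [sub_zero] at h5
      refine tendsto_nhds_unique (tendsto_const_nhds.congr' ?_) h5
      filter_upwards [self_mem_nhdsWithin] with ε (hε : 0 < ε)
      rw [Finset.sum_insert hmA]
      have e1 : ((ε ^ (-m) : ℝ) : ℂ) * ((ε ^ m : ℝ) : ℂ) = 1 := by
        rw [← Complex.ofReal_mul, ← rpow_add hε]; simp
      have e2 : ((ε ^ (-m) : ℝ) : ℂ) * ∑ a ∈ A, c a * ((ε ^ a : ℝ) : ℂ)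
          = ∑ a ∈ A, c a * ((ε ^ (a - m) : ℝ) : ℂ) := by
        rw [Finset.mul_sum]
        refine Finset.sum_congr rfl fun a _ => ?_
        rw [sub_eq_add_neg, rpow_add hε]; push_cast; ring
      linear_combination -(c m) * e1 - e2
    refine ih c b z (fun a ha => hA a (Finset.mem_insert_of_mem ha)) (h.congr fun ε => ?_)
    rw [Finset.sum_insert hmA, hcm]; ring

theorem IsFinitePart.unique (h : IsFinitePart I L) (h' : IsFinitePart I L') : L = L' := by
  have h1 := h.add (h'.const_mul (-1))
  have h2 : IsFinitePart (fun _ => 0) (L + -1 * L') := by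
    refine h1.congr (Eventually.of_forall fun ε => ?_)
    ring
  obtain ⟨A, c, b, hA, hI⟩ := h2
  have h3 := finitePart_aux A c b (-(L + -1 * L')) hA (hI.neg.congr fun ε => by ring)
  linear_combination -h3

end FinitePart

/-! ### Uniqueness of finite part prolongations -/

section Prolongation

variable {n : ℕ} {T T' : 𝓢'(Rn n, ℂ)} {u v : Rn n → ℂ}

theorem IsProlongation.unique (h : IsProlongation T u) (h' : IsProlongation T' u) : T = T' := by
  ext φ
  exact (h φ).unique (h' φ)

end Prolongation


/-! ### The smooth part of a tail as a symbol -/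

section DecompSymbol

variable {n : ℕ} {σ : ℝ} {φ : 𝓢(Rn n, ℂ)} {f E : Rn n → ℂ} {p : MvPolynomial (Fin n) ℂ}

/-- The smooth part of a tail is, up to a Schwartz function, the homogeneous and logarithmic part
cut off near the origin. -/
theorem Decomp.exists_schwartz (h : Decomp σ φ f p E) : ∃ S : 𝓢(Rn n, ℂ), ∀ x, E x
    = S x + (patch x : ℂ) * f x - (patch x : ℂ) * (polyEval p x * (Real.log ‖x‖ : ℂ)) := by
  set u : Rn n → ℂ := fun x => E x - (patch x : ℂ) * f x
    + (patch x : ℂ) * (polyEval p x * (Real.log ‖x‖ : ℂ)) with hu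
  have hus : ContDiff ℝ ∞ u := (h.smooth.sub (contDiff_patch_mul h.hom.1)).add
    (contDiff_patch_mul ((contDiff_polyEval p).contDiffOn.mul contDiffOn_log_norm))
  -- For `|x| ≥ 1` the function `u` is minus the tail, which decays rapidly.
  obtain ⟨S, hS⟩ := _root_.exists_schwartz hus fun N =>
    farBound_of_contDiff hus (tail_farBound σ φ N).neg fun x hx => by
      have h0 : x ≠ 0 := by rintro rfl; simp at hx; linarith
      simp only [hu]
      rw [h.eq x h0, patch_of_one_le hx]; push_cast; ring
  exact ⟨S, fun x => by rw [hS]; simp only [hu]; ring⟩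

theorem PolyHom.farBound_mul_log (hp : PolyHom σ p) {δ : ℝ} (hδ : 0 < δ) :
    FarBound (σ + δ) (fun x : Rn n => polyEval p x * (Real.log ‖x‖ : ℂ)) :=
  (hp.homFun.pbound _).mul (farBound_log hδ)

/-- The order `σ + 1` instead of `σ` absorbs the logarithm; the later arguments only need polynomial
growth of `E` and its derivatives. -/
theorem Decomp.isSymbol (h : Decomp σ φ f p E) : IsSymbol (σ + 1) E := by
  obtain ⟨S, hS⟩ := h.exists_schwartz
  have h1 := ((schwartz_isSymbol S (σ + 1)).add
    ((isSymbol_patch_mul (h.hom.pbound _)).mono (by linarith : σ ≤ σ + 1))).sub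
    (isSymbol_patch_mul (h.poly.farBound_mul_log one_pos))
  exact (funext hS : E = _) ▸ h1

theorem IsSymbol.exists_pow_bound {a : Rn n → ℂ} (ha : IsSymbol σ a) (k : ℕ) :
    ∃ (C : ℝ) (M : ℕ), ∀ x, ‖iteratedFDeriv ℝ k a x‖ ≤ C * (1 + ‖x‖) ^ M := by
  obtain ⟨C, hC⟩ := ha.2 k
  obtain ⟨M, hM⟩ := exists_nat_ge (σ - k)
  refine ⟨|C|, M, fun x => (hC x).trans ?_⟩
  have h1 : 1 ≤ 1 + ‖x‖ := by linarith [norm_nonneg x]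
  rw [← rpow_natCast]
  refine mul_le_mul (le_abs_self C) (rpow_le_rpow_of_exponent_le h1 hM) (by positivity)
    (abs_nonneg C)

theorem IsSymbol.moderate {a : Rn n → ℂ} (ha : IsSymbol σ a) : Moderate a := by
  obtain ⟨C, M, h⟩ := ha.exists_pow_bound 0
  exact moderate_of_bound ha.1.continuous.aestronglyMeasurable
    (by simpa only [norm_iteratedFDeriv_zero] using h)

end DecompSymbol

/-! ### Fourier transforms of tails -/

section TailFourier

variable {n : ℕ}

theorem schwartz_norm_le (g : 𝓢(Rn n, ℂ)) : ∃ C : ℝ, 0 ≤ C ∧ ∀ x, ‖g x‖ ≤ C := by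
  obtain ⟨C, hC⟩ := g.decay 0 0
  exact ⟨C, hC.1.le, fun x => by simpa using hC.2 x⟩

theorem fubini_dil (g h : 𝓢(Rn n, ℂ)) {a : ℝ} (ha : 0 < a) (b r : ℝ) :
    Integrable (fun x => (∫ t in Ioc a b, t ^ r • g (t • x)) * h x) ∧
    ∫ x, (∫ t in Ioc a b, t ^ r • g (t • x)) * h x
      = ∫ t in Ioc a b, ((t ^ r : ℝ) : ℂ) * ∫ x, g (t • x) * h x := by
  obtain ⟨C, hC0, hC⟩ := schwartz_norm_le g
  have hr : IntegrableOn (fun t : ℝ => t ^ r) (Ioc a b) :=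
    (ContinuousOn.integrableOn_Icc (continuousOn_id.rpow_const fun t ht =>
      Or.inl (ne_of_gt (lt_of_lt_of_le ha ht.1)))).mono_set Ioc_subset_Icc_self
  set f : ℝ × Rn n → ℂ := fun q => ((q.1 ^ r : ℝ) : ℂ) * (g (q.1 • q.2) * h q.2) with hf
  have hfi : Integrable f ((volume.restrict (Ioc a b)).prod volume) := by
    refine Integrable.mono' ((hr.norm.mul_prod (h.integrable.norm)).const_mul C) ?_
      (Eventually.of_forall fun q => ?_)
    · refine Measurable.aestronglyMeasurable ?_
      have h1 : Measurable fun q : ℝ × Rn n => g (q.1 • q.2) :=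
        (g.continuous.comp (by fun_prop)).measurable
      have h2 : Measurable fun q : ℝ × Rn n => h q.2 := (h.continuous.comp (by fun_prop)).measurable
      have h3 : Measurable fun q : ℝ × Rn n => ((q.1 ^ r : ℝ) : ℂ) := by fun_prop
      exact h3.mul (h1.mul h2)
    · simp only [hf, norm_mul, Complex.norm_real]
      calc _ ≤ ‖q.1 ^ r‖ * (C * ‖h q.2‖) := by gcongr; exact hC _
        _ = _ := by ring
  have e : ∀ x, (∫ t in Ioc a b, t ^ r • g (t • x)) * h x = ∫ t in Ioc a b, f (t, x) := fun x => by
    rw [← integral_mul_const]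
    simp only [hf, Complex.real_smul, mul_assoc]
  simp only [e]
  refine ⟨hfi.integral_prod_right, ?_⟩
  rw [← integral_integral_swap (f := fun t x => f (t, x)) hfi]
  simp only [hf, integral_const_mul]

theorem integral_Ioc_inv {G : ℝ → ℂ} {s ε : ℝ} (hε : 0 < ε) :
    ∫ t in Ioc 1 ε⁻¹, ((t ^ (-s - 1) : ℝ) : ℂ) * G t
      = ∫ t in Ioc ε 1, ((t ^ (s - 1) : ℝ) : ℂ) * G t⁻¹ := by
  -- Inversion maps `Ioc ε 1` onto `Ico 1 ε⁻¹`, which is why the ends are exchanged; they have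
  -- measure zero.
  set g : ℝ → ℂ := indicator (Ico 1 ε⁻¹) fun t => ((t ^ (-s - 1) : ℝ) : ℂ) * G t with hg
  have h := integral_comp_rpow_Ioi g (p := -1) (by norm_num)
  have e1 : ∫ y in Ioi 0, g y = ∫ t in Ioc 1 ε⁻¹, ((t ^ (-s - 1) : ℝ) : ℂ) * G t := by
    rw [hg, setIntegral_indicator measurableSet_Ico, inter_eq_right.2 (show Ico 1 ε⁻¹ ⊆ Ioi 0 from
      fun t ht => lt_of_lt_of_le one_pos ht.1), integral_Ico_eq_integral_Ioo, integral_Ioc_eq_integral_Ioo]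
  have e2 : ∀ x ∈ Ioi (0 : ℝ), (|(-1 : ℝ)| * x ^ ((-1 : ℝ) - 1)) • g (x ^ (-1 : ℝ))
      = indicator (Ioc ε 1) (fun t => ((t ^ (s - 1) : ℝ) : ℂ) * G t⁻¹) x := by
    intro x (hx : 0 < x)
    rw [rpow_neg_one, hg]
    by_cases hm : x ∈ Ioc ε 1
    · have hm' : x⁻¹ ∈ Ico 1 ε⁻¹ :=
        ⟨(one_le_inv₀ hx).2 hm.2, (inv_lt_inv₀ hx hε).2 hm.1⟩
      rw [indicator_of_mem hm, indicator_of_mem hm', inv_rpow hx.le, ← rpow_neg hx.le,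
        Complex.real_smul, ← mul_assoc, ← Complex.ofReal_mul, abs_neg, abs_one, one_mul,
        ← rpow_add hx, show (-1 : ℝ) - 1 + -(-s - 1) = s - 1 by ring]
    · have hm' : x⁻¹ ∉ Ico 1 ε⁻¹ := fun h' =>
        hm ⟨(inv_lt_inv₀ hx hε).1 h'.2, (one_le_inv₀ hx).1 h'.1⟩
      rw [indicator_of_notMem hm, indicator_of_notMem hm', smul_zero]
  rw [setIntegral_congr_fun measurableSet_Ioi e2, setIntegral_indicator measurableSet_Ioc,
    inter_eq_right.2 (show Ioc ε 1 ⊆ Ioi 0 from fun t ht => lt_trans hε ht.1), e1] at h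
  exact h.symm

/-- Parseval's identity for the truncated integrals `∫_ε^1 t^{-μ-1} φ(t ξ) dt`. -/
theorem parseval_truncated (φ ψ : 𝓢(Rn n, ℂ)) {μ s : ℝ} (hs : s = -n - μ) {ε : ℝ} (hε : 0 < ε) :
    ∫ x, (∫ t in Ioc 1 ε⁻¹, t ^ (-s - 1) • schwartzFourier n φ (t • x)) * ψ x
      = ∫ ξ, (∫ t in Ioc ε 1, t ^ (-μ - 1) • φ (t • ξ)) * schwartzFourier n ψ ξ := by
  rw [(fubini_dil _ _ one_pos _ _).2, (fubini_dil _ _ hε _ _).2, integral_Ioc_inv hε]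
  refine setIntegral_congr_fun measurableSet_Ioc fun t ht => ?_
  have ht0 : 0 < t := lt_trans hε ht.1
  -- The transform of `φ(t ·)` is `t^(-n) φ̂(·/t)`. This factor is what forces `s = -n - μ`.
  have h1 := integral_schwartzFourier_mul (schwartzDil t ht0.ne' φ) ψ
  simp only [schwartzFourier_schwartzDil ht0, schwartzDil_apply, mul_assoc,
    integral_const_mul] at h1
  beta_reduce
  rw [← h1, ← mul_assoc, ← Complex.ofReal_mul, ← rpow_add ht0, hs,
    show -(n : ℝ) - μ - 1 = -μ - 1 + -n by ring]

theorem integral_Ioi_eq_tail (σ : ℝ) (φ : 𝓢(Rn n, ℂ)) (x : Rn n) {a : ℝ} (ha : 0 < a) :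
    ∫ t in Ioi a, t ^ (-σ - 1) • φ (t • x) = ((a ^ (-σ) : ℝ) : ℂ) * tail σ φ (a • x) := by
  have h := integral_Ioi_dil σ φ ha zero_le_one x
  rw [one_mul] at h
  rw [tail, h, Complex.real_smul, ← mul_assoc, ← Complex.ofReal_mul, ← rpow_add ha]
  simp

theorem integral_Ioc_eq_tail (σ : ℝ) (φ : 𝓢(Rn n, ℂ)) {x : Rn n} (hx : x ≠ 0) {a b : ℝ}
    (ha : 0 < a) (hab : a ≤ b) :
    ∫ t in Ioc a b, t ^ (-σ - 1) • φ (t • x)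
      = ((a ^ (-σ) : ℝ) : ℂ) * tail σ φ (a • x) - ((b ^ (-σ) : ℝ) : ℂ) * tail σ φ (b • x) := by
  rw [← integral_Ioi_eq_tail σ φ x ha, ← integral_Ioi_eq_tail σ φ x (ha.trans_le hab),
    integral_Ioi_split hab ((tail_integrable σ φ hx ha).mono_set Ioc_subset_Ioi_self)
      (tail_integrable σ φ hx (ha.trans_le hab))]
  ring

/-- The function that is `E` in the unit ball and minus the tail outside. -/
def cutTail (s : ℝ) (g : 𝓢(Rn n, ℂ)) (E : Rn n → ℂ) (y : Rn n) : ℂ :=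
  {y : Rn n | 1 ≤ ‖y‖}.indicator (fun y => -tail s g y) y
    + {y : Rn n | ‖y‖ < 1}.indicator E y

theorem measurableSet_norm_ge (r : ℝ) : MeasurableSet {y : Rn n | r ≤ ‖y‖} :=
  (isClosed_le continuous_const continuous_norm).measurableSet

theorem measurableSet_norm_lt (r : ℝ) : MeasurableSet {y : Rn n | ‖y‖ < r} :=
  (isOpen_lt continuous_norm continuous_const).measurableSet

theorem aestronglyMeasurable_cutTail (s : ℝ) (g : 𝓢(Rn n, ℂ)) {E : Rn n → ℂ} (hE : ContDiff ℝ ∞ E) :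
    AEStronglyMeasurable (cutTail s g E) volume := by
  refine AEStronglyMeasurable.add ?_ ?_
  · refine (aestronglyMeasurable_indicator_iff (measurableSet_norm_ge 1)).2 ?_
    refine ContinuousOn.aestronglyMeasurable ?_ (measurableSet_norm_ge 1)
    refine ((tail_contDiffOn s g).continuousOn.neg).mono fun y (hy : 1 ≤ ‖y‖) => ?_
    rintro rfl; simp at hy; linarith
  · exact (aestronglyMeasurable_indicator_iff (measurableSet_norm_lt 1)).2
      hE.continuous.aestronglyMeasurable.restrict

/-- Boundedness in the unit ball and rapid decay outside make all moments finite, so `invFourier` of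
`cutTail` is smooth with bounded derivatives and can be Taylor expanded. -/
theorem cutTail_moments (s : ℝ) (g : 𝓢(Rn n, ℂ)) {E : Rn n → ℂ} (hE : ContDiff ℝ ∞ E) (k : ℕ) :
    Integrable fun y => ‖y‖ ^ k * ‖cutTail s g E y‖ := by
  obtain ⟨C, hC0, hC⟩ := (tail_farBound s g (k + (n + 1))).norm_le
  obtain ⟨C', hC0', hC'⟩ := exists_bound_ball hE 0 1
  -- The power of two comes from `1 + |y| ≤ 2|y|` outside the unit ball and `1 + |y| ≤ 2` inside.
  set D : ℝ := 2 ^ (n + 1) * (C + C') with hD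
  refine Integrable.mono' (g := fun y : Rn n => D * (1 + ‖y‖) ^ (-(n + 1 : ℝ)))
    ((integrable_one_add_norm (by simp)).const_mul D)
    ((continuous_norm.pow k).aestronglyMeasurable.mul
      (aestronglyMeasurable_cutTail s g hE).norm) (Eventually.of_forall fun y => ?_)
  have hy1 : 0 < 1 + ‖y‖ := by positivity
  rw [Real.norm_of_nonneg (by positivity), rpow_neg hy1.le, ← div_eq_mul_inv, le_div_iff₀ (by positivity)]
  have hcast : (1 + ‖y‖) ^ (n + 1 : ℝ) = (1 + ‖y‖) ^ (n + 1) := by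
    rw [← rpow_natCast]; push_cast; rfl
  rw [hcast]
  by_cases hy : 1 ≤ ‖y‖
  · have h0 : y ≠ 0 := by rintro rfl; simp at hy; linarith
    have e : cutTail s g E y = -tail s g y := by
      rw [cutTail, indicator_of_mem (by exact hy), indicator_of_notMem (by simpa using hy), add_zero]
    have h := hC y hy h0
    rw [rpow_neg (norm_nonneg _), rpow_natCast, ← div_eq_mul_inv, le_div_iff₀ (by positivity)] at h
    rw [e, norm_neg]
    calc _ ≤ ‖y‖ ^ k * ‖tail s g y‖ * (2 * ‖y‖) ^ (n + 1) := by
          gcongr; linarith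
      _ = 2 ^ (n + 1) * (‖tail s g y‖ * ‖y‖ ^ (k + (n + 1))) := by
          rw [mul_pow, pow_add]; ring
      _ ≤ 2 ^ (n + 1) * C := by gcongr
      _ ≤ D := by rw [hD]; gcongr; linarith
  · have hy' : ‖y‖ < 1 := not_le.1 hy
    have e : cutTail s g E y = E y := by
      rw [cutTail, indicator_of_notMem (by exact hy), indicator_of_mem (by exact hy'), zero_add]
    have h := hC' y hy'.le
    rw [norm_iteratedFDeriv_zero] at h
    rw [e]
    calc _ ≤ 1 ^ k * C' * (1 + 1) ^ (n + 1) := by gcongr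
      _ = 2 ^ (n + 1) * C' := by norm_num; ring
      _ ≤ D := by rw [hD]; gcongr; linarith

/-- The volume of the ball is a multiple of `ε ^ n ≤ ε`. The linear bound is small enough to absorb
a factor `log ε`. -/
theorem norm_integral_ball_le (hn : 1 ≤ n) {u : Rn n → ℂ} (hu : Continuous u) :
    ∃ C : ℝ, ∀ ε : ℝ, 0 < ε → ε ≤ 1 → ‖∫ x in {x : Rn n | ‖x‖ < ε}, u x‖ ≤ C * ε := by
  obtain ⟨C, hC⟩ := (isCompact_closedBall (0 : Rn n) 1).exists_bound_of_continuousOn hu.continuousOn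
  have hC0 : 0 ≤ C := (norm_nonneg _).trans (hC 0 (by simp))
  refine ⟨C * volume.real (Metric.ball (0 : Rn n) 1), fun ε h0 h1 => ?_⟩
  have e : {x : Rn n | ‖x‖ < ε} = Metric.ball 0 ε := by ext; simp
  rw [e]
  refine (norm_setIntegral_le_of_norm_le_const (C := C) measure_ball_lt_top
    fun x hx => hC x ?_).trans ?_
  · simp only [Metric.mem_ball, dist_zero_right, Metric.mem_closedBall] at hx ⊢; linarith
  · have : Nonempty (Fin n) := ⟨⟨0, hn⟩⟩
    rw [Measure.real, Measure.addHaar_ball _ _ h0.le, ENNReal.toReal_mul, finrank_euclideanSpace_fin,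
      ENNReal.toReal_ofReal (by positivity), mul_assoc, mul_comm (ε ^ n)]
    have : ε ^ n ≤ ε := by
      simpa using pow_le_pow_of_le_one h0.le h1 hn
    exact mul_le_mul_of_nonneg_left (mul_le_mul_of_nonneg_left this ENNReal.toReal_nonneg) hC0

end TailFourier


/-! ### Parseval's identity for tails and its finite part -/

section TailFourier

variable {n : ℕ} {μ s : ℝ} {φ : 𝓢(Rn n, ℂ)} {h E f E' : Rn n → ℂ} {p p' : MvPolynomial (Fin n) ℂ}

/-- The integral is a difference of two rescaled tails, in which the homogeneous part cancels and
the logarithmic part leaves `-log ε` times `p`. -/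
theorem Decomp.integral_Ioc (hD : Decomp μ φ h p E) {ε : ℝ} (hε : 0 < ε) (h1 : ε ≤ 1) {ξ : Rn n}
    (hξ : ξ ≠ 0) : ∫ t in Ioc ε 1, t ^ (-μ - 1) • φ (t • ξ)
      = E ξ - ((ε ^ (-μ) : ℝ) : ℂ) * E (ε • ξ) - (Real.log ε : ℂ) * polyEval p ξ := by
  have hεξ : ε • ξ ≠ 0 := smul_ne_zero hε.ne' hξ
  rw [integral_Ioc_eq_tail μ φ hξ hε h1, one_smul, hD.eq _ hξ, hD.eq _ hεξ, hD.hom.2 ε hε ξ hξ,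
    hD.poly.homFun.2 ε hε ξ hξ, norm_smul, Real.norm_of_nonneg hε.le,
    Real.log_mul hε.ne' (norm_ne_zero_iff.2 hξ), one_rpow]
  have : ((ε ^ (-μ) : ℝ) : ℂ) * ((ε ^ μ : ℝ) : ℂ) = 1 := by
    rw [← Complex.ofReal_mul, ← rpow_add hε]; simp
  push_cast
  linear_combination (h ξ - polyEval p ξ * (Real.log ε : ℂ) - polyEval p ξ * (Real.log ‖ξ‖ : ℂ)) * this

/-- Outside the `ε`-ball the part of the tail integral over `t > 1/ε` is `ε^s` times the tail at
`x/ε`. Inside, the homogeneous parts cancel as in `Decomp.integral_Ioc`. `cutTail` unites both cases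
in the dilate of one integrable function, up to a term supported in the shrinking ball. -/
theorem Decomp.indicator_tail (hD : Decomp s φ f p' E') {ε : ℝ} (hε : 0 < ε) (h1 : ε ≤ 1)
    {x : Rn n} (hx : x ≠ 0) :
    {x : Rn n | ε ≤ ‖x‖}.indicator (tail s φ) x
      = (∫ t in Ioc 1 ε⁻¹, t ^ (-s - 1) • φ (t • x)) - ((ε ^ s : ℝ) : ℂ) * cutTail s φ E' (ε⁻¹ • x)
        + {x : Rn n | ‖x‖ < ε}.indicator (fun x => E' x + (Real.log ε : ℂ) * polyEval p' x) x := by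
  have hi : 0 < ε⁻¹ := inv_pos.2 hε
  have hnorm : ‖ε⁻¹ • x‖ = ε⁻¹ * ‖x‖ := by rw [norm_smul, Real.norm_of_nonneg hi.le]
  have hx' : ε⁻¹ • x ≠ 0 := smul_ne_zero hi.ne' hx
  have hiff : 1 ≤ ‖ε⁻¹ • x‖ ↔ ε ≤ ‖x‖ := by
    rw [hnorm, inv_mul_eq_div, one_le_div hε]
  rw [integral_Ioc_eq_tail s φ hx one_pos ((one_le_inv₀ hε).2 h1), one_smul, one_rpow,
    inv_rpow hε.le, rpow_neg hε.le, inv_inv, cutTail]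
  by_cases hc : ε ≤ ‖x‖
  · rw [indicator_of_mem (by exact hc), indicator_of_mem (by exact hiff.2 hc),
      indicator_of_notMem (by simpa using hiff.2 hc), indicator_of_notMem (by simpa using hc)]
    push_cast; ring
  · have hc' : ‖x‖ < ε := not_le.1 hc
    have hc2 : ‖ε⁻¹ • x‖ < 1 := by rw [← not_le, hiff]; exact hc
    rw [indicator_of_notMem (by exact hc), indicator_of_notMem (by exact not_le.2 hc2),
      indicator_of_mem (by exact hc2), indicator_of_mem (by exact hc'), hD.eq _ hx, hD.eq _ hx',
      hD.hom.2 _ hi x hx, hD.poly.homFun.2 _ hi x hx, hnorm,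
      Real.log_mul hi.ne' (norm_ne_zero_iff.2 hx), Real.log_inv, inv_rpow hε.le]
    have : ((ε ^ s : ℝ) : ℂ) * (((ε ^ s)⁻¹ : ℝ) : ℂ) = 1 := by
      rw [← Complex.ofReal_mul, mul_inv_cancel₀ (by positivity)]; simp
    push_cast at this ⊢
    linear_combination (-f x + polyEval p' x * ((Real.log ‖x‖ : ℂ) - (Real.log ε : ℂ))) * -this

theorem moderate_polyEval_of_polyHom {σ : ℝ} (hp : PolyHom σ p) : Moderate (polyEval (n := n) p) := by
  rcases hp with rfl | ⟨k, -, hk⟩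
  · have : polyEval (0 : MvPolynomial (Fin n) ℂ) = fun _ : Rn n => (0 : ℂ) := funext polyEval_zero
    rw [this]; exact moderate_of_integrable (integrable_zero _ _ _)
  · obtain ⟨C, hC0, hC⟩ := exists_bound_ball (contDiff_polyEval p) 0 1
    refine moderate_of_bound (contDiff_polyEval p).continuous.aestronglyMeasurable (C := C) (k := k)
      fun x => ?_
    have h0 : 0 < 1 + ‖x‖ := by positivity
    have e : x = (1 + ‖x‖) • ((1 + ‖x‖)⁻¹ • x) := by rw [smul_inv_smul₀ h0.ne']
    have hb := hC ((1 + ‖x‖)⁻¹ • x) (by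
      rw [norm_smul, norm_inv, Real.norm_of_nonneg h0.le, inv_mul_le_iff₀ h0]; linarith)
    rw [norm_iteratedFDeriv_zero] at hb
    rw [e, polyEval_smul hk, norm_mul, norm_pow, Complex.norm_real, Real.norm_of_nonneg h0.le, ← e,
      mul_comm]
    gcongr

/-- The truncated integral of a tail. -/
theorem integral_tail_mul (hn : 1 ≤ n) (h1 : Decomp μ φ h p E)
    (h2 : Decomp s (schwartzFourier n φ) f p' E') (hs : s = -n - μ) (ψ : 𝓢(Rn n, ℂ)) {ε : ℝ}
    (hε : 0 < ε) (hε1 : ε ≤ 1) :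
    ∫ x in {x : Rn n | ε ≤ ‖x‖}, tail s (schwartzFourier n φ) x * ψ x
      = (∫ ξ, E ξ * schwartzFourier n ψ ξ)
        - ((ε ^ (-μ) : ℝ) : ℂ) * (∫ ξ, (E (ε • ξ)
            + invFourier (cutTail s (schwartzFourier n φ) E') (ε • ξ)) * schwartzFourier n ψ ξ)
        - (Real.log ε : ℂ) * (∫ ξ, polyEval p ξ * schwartzFourier n ψ ξ)
        + ((∫ x in {x : Rn n | ‖x‖ < ε}, E' x * ψ x)
        + (Real.log ε : ℂ) * ∫ x in {x : Rn n | ‖x‖ < ε}, polyEval p' x * ψ x) := by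
  set g := schwartzFourier n φ with hg
  set κ := cutTail s g E' with hκ
  set ψ' := schwartzFourier n ψ with hψ'
  have hi : 0 < ε⁻¹ := inv_pos.2 hε
  have hκm := cutTail_moments s g h2.smooth
  have hκa := aestronglyMeasurable_cutTail s g h2.smooth
  have hκi : Integrable κ := by
    refine (integrable_norm_iff hκa).1 ?_
    simpa using hκm 0
  have hKs := invFourier_contDiff hκm
  have hKb : Moderate fun ξ => invFourier κ (ε • ξ) := by
    obtain ⟨C, hC⟩ := invFourier_bound hκa hκm 0
    refine moderate_of_bound (C := C) (k := 0) (Continuous.aestronglyMeasurable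
      (hKs.continuous.comp (by fun_prop))) fun x => ?_
    simpa using hC (ε • x)
  have hE := h1.isSymbol.moderate
  have hEε : Moderate fun ξ => E (ε • ξ) := by
    obtain ⟨C, M, hC⟩ := h1.isSymbol.exists_pow_bound 0
    have hC0 : 0 ≤ C := by have := (norm_nonneg _).trans (hC 0); simpa using this
    refine moderate_of_bound (C := C) (k := M) (Continuous.aestronglyMeasurable
      (h1.smooth.continuous.comp (by fun_prop))) fun x => ?_
    have := hC (ε • x)
    rw [norm_iteratedFDeriv_zero, norm_smul, Real.norm_of_nonneg hε.le] at this
    refine this.trans ?_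
    gcongr
    exact mul_le_of_le_one_left (norm_nonneg _) hε1
  have hp := moderate_polyEval_of_polyHom h1.poly
  have hp' := moderate_polyEval_of_polyHom h2.poly
  have hE' := h2.isSymbol.moderate
  -- the left-hand side
  have hL : ∫ x in {x : Rn n | ε ≤ ‖x‖}, tail s g x * ψ x
      = (∫ x, (∫ t in Ioc 1 ε⁻¹, t ^ (-s - 1) • g (t • x)) * ψ x)
        - ((ε ^ s : ℝ) : ℂ) * (∫ x, κ (ε⁻¹ • x) * ψ x)
        + ((∫ x in {x : Rn n | ‖x‖ < ε}, E' x * ψ x)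
        + (Real.log ε : ℂ) * ∫ x in {x : Rn n | ‖x‖ < ε}, polyEval p' x * ψ x) := by
    have hlast : (∫ x in {x : Rn n | ‖x‖ < ε}, E' x * ψ x)
        + (Real.log ε : ℂ) * (∫ x in {x : Rn n | ‖x‖ < ε}, polyEval p' x * ψ x)
        = ∫ x, {x : Rn n | ‖x‖ < ε}.indicator
          (fun x => E' x * ψ x + (Real.log ε : ℂ) * (polyEval p' x * ψ x)) x := by
      rw [integral_indicator (measurableSet_norm_lt ε), integral_add (hE'.integrable_mul ψ).restrict
        ((hp'.integrable_mul ψ).restrict.const_mul _), integral_const_mul]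
    have hi1 := (fubini_dil g ψ one_pos ε⁻¹ (-s - 1)).1
    have hi2 : Integrable fun x => ((ε ^ s : ℝ) : ℂ) * (κ (ε⁻¹ • x) * ψ x) :=
      ((moderate_of_integrable (hκi.comp_smul hi.ne')).integrable_mul ψ).const_mul _
    have hi3 : Integrable ({x : Rn n | ‖x‖ < ε}.indicator
          (fun x => E' x * ψ x + (Real.log ε : ℂ) * (polyEval p' x * ψ x))) :=
      ((hE'.integrable_mul ψ).add ((hp'.integrable_mul ψ).const_mul _)).indicator
        (measurableSet_norm_lt ε)
    have hi4 : Integrable fun x => (∫ t in Ioc 1 ε⁻¹, t ^ (-s - 1) • g (t • x)) * ψ x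
        - ((ε ^ s : ℝ) : ℂ) * (κ (ε⁻¹ • x) * ψ x) := hi1.sub hi2
    rw [hlast, ← integral_const_mul, ← integral_sub hi1 hi2, ← integral_add hi4 hi3,
      ← integral_indicator (measurableSet_norm_ge ε)]
    refine integral_congr_ae (ae_eq_of_off hn fun x hx => ?_)
    have h := h2.indicator_tail hε hε1 hx
    by_cases hc : ε ≤ ‖x‖
    · have hc' : x ∉ {x : Rn n | ‖x‖ < ε} := by simpa using hc
      rw [indicator_of_mem (by exact hc), indicator_of_notMem hc'] at h ⊢
      rw [h]; ring
    · have hc' : x ∈ {x : Rn n | ‖x‖ < ε} := by simpa using hc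
      rw [indicator_of_notMem (by exact hc), indicator_of_mem hc'] at h ⊢
      linear_combination ψ x * h
  have hR : ∫ ξ, (∫ t in Ioc ε 1, t ^ (-μ - 1) • φ (t • ξ)) * ψ' ξ
      = (∫ ξ, E ξ * ψ' ξ) - ((ε ^ (-μ) : ℝ) : ℂ) * (∫ ξ, E (ε • ξ) * ψ' ξ)
        - (Real.log ε : ℂ) * (∫ ξ, polyEval p ξ * ψ' ξ) := by
    have hi4 : Integrable fun ξ => E ξ * ψ' ξ - ((ε ^ (-μ) : ℝ) : ℂ) * (E (ε • ξ) * ψ' ξ) :=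
      (hE.integrable_mul ψ').sub ((hEε.integrable_mul ψ').const_mul _)
    rw [← integral_const_mul, ← integral_const_mul, ← integral_sub (hE.integrable_mul ψ')
      ((hEε.integrable_mul ψ').const_mul _), ← integral_sub hi4
      ((hp.integrable_mul ψ').const_mul _)]
    refine integral_congr_ae (ae_eq_of_off hn fun x hx => ?_)
    rw [h1.integral_Ioc hε hε1 hx]; ring
  -- Rescaling yields `ε^n`, and `ε^(s+n) = ε^(-μ)` is the factor carried by `E(ε ξ)` too. The two
  -- dilated terms therefore merge.
  have hK : ∫ x, κ (ε⁻¹ • x) * ψ x = ((ε ^ (n : ℝ) : ℝ) : ℂ) * ∫ ξ, invFourier κ (ε • ξ) * ψ' ξ := by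
    rw [← integral_mul_comp_smul_eq_invFourier hκi ψ hε, ← Complex.real_smul]
    have := integral_comp_smul_Rn (n := n) (fun x => κ x * ψ (ε • x)) hi
    simp only [smul_inv_smul₀ hε.ne'] at this
    rw [this, inv_rpow hε.le, rpow_neg hε.le, inv_inv]
  have hsplit : ∫ ξ, (E (ε • ξ) + invFourier κ (ε • ξ)) * ψ' ξ
      = (∫ ξ, E (ε • ξ) * ψ' ξ) + ∫ ξ, invFourier κ (ε • ξ) * ψ' ξ := by
    rw [← integral_add (hEε.integrable_mul ψ') (hKb.integrable_mul ψ')]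
    simp only [add_mul]
  rw [hL, parseval_truncated φ ψ hs hε, hR, hK, hsplit, ← mul_assoc, ← Complex.ofReal_mul,
    ← rpow_add hε, show s + n = -μ by rw [hs]; ring]
  ring

/-- The tail of `φ̂` has a prolongation which is the Fourier transform of the smooth part of the
tail of `φ`, up to a homogeneous polynomial. -/
theorem exists_prolongation_tail (hn : 1 ≤ n) (h1 : Decomp μ φ h p E)
    (h2 : Decomp s (schwartzFourier n φ) f p' E') (hs : s = -n - μ) :
    ∃ q : MvPolynomial (Fin n) ℂ, PolyHom μ q ∧ ∀ T : 𝓢'(Rn n, ℂ),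
      IsGivenBy T (fun ξ => E ξ + polyEval q ξ) →
        IsProlongation (distFourier n T) (tail s (schwartzFourier n φ)) := by
  set g := schwartzFourier n φ with hg
  set κ := cutTail s g E' with hκ
  -- `Φ(ε ξ)` collects all that is multiplied by `ε^(-μ)`; in the finite part only its Taylor term
  -- of degree `μ` is seen.
  set Φ : Rn n → ℂ := fun ξ => E ξ + invFourier κ ξ with hΦ
  have hκm := cutTail_moments s g h2.smooth
  have hKs := invFourier_contDiff hκm
  have hΦs : ContDiff ℝ ∞ Φ := h1.smooth.add hKs
  have hΦb : ∀ k : ℕ, ∃ (C : ℝ) (M : ℕ), ∀ x, ‖iteratedFDeriv ℝ k Φ x‖ ≤ C * (1 + ‖x‖) ^ M := by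
    intro k
    obtain ⟨C, M, hC⟩ := h1.isSymbol.exists_pow_bound k
    obtain ⟨C', hC'⟩ := invFourier_bound (aestronglyMeasurable_cutTail s g h2.smooth) hκm k
    have hC0' : 0 ≤ C' := (norm_nonneg _).trans (hC' 0)
    refine ⟨C + C', M, fun x => ?_⟩
    have e : Φ = E + invFourier κ := rfl
    rw [e, iteratedFDeriv_add_apply (h1.smooth.contDiffAt.of_le (by exact_mod_cast le_top))
      (hKs.contDiffAt.of_le (by exact_mod_cast le_top)), add_mul]
    refine (norm_add_le _ _).trans (add_le_add (hC x) ((hC' x).trans ?_))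
    exact le_mul_of_one_le_right hC0' (one_le_pow₀ (by linarith [norm_nonneg x]))
  -- One polynomial serves all test functions: the Taylor term of `Φ` of degree `μ`, or `0` if `μ`
  -- is not a natural number.
  obtain ⟨q, hq, hqe⟩ : ∃ q : MvPolynomial (Fin n) ℂ, PolyHom μ q ∧ ∀ (g : 𝓢(Rn n, ℂ)) (K : ℕ),
      μ < K → (∑ k ∈ Finset.range K, if (k : ℝ) = μ then ∫ ξ, taylorTerm Φ k ξ * g ξ else 0)
        = ∫ ξ, polyEval q ξ * g ξ := by
    by_cases hμ : ∃ k : ℕ, (k : ℝ) = μ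
    · obtain ⟨k, rfl⟩ := hμ
      obtain ⟨q, hq, hqe⟩ := exists_poly_taylorTerm Φ k
      refine ⟨q, Or.inr ⟨k, rfl, hq⟩, fun g K hK => ?_⟩
      simp only [Nat.cast_inj, hqe]
      rw [Finset.sum_ite_eq', if_pos (Finset.mem_range.2 (by exact_mod_cast hK))]
    · refine ⟨0, Or.inl rfl, fun g K _ => ?_⟩
      simp only [polyEval_zero, zero_mul, integral_zero]
      exact Finset.sum_eq_zero fun k _ => if_neg fun hk => hμ ⟨k, hk⟩
  -- The sign is that of the `ε^(-μ)` term in `integral_tail_mul`.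
  have hqn : PolyHom μ (MvPolynomial.C (-1) * q) := hq.C_mul _
  refine ⟨MvPolynomial.C (-1) * q, hqn, fun T hT ψ => ?_⟩
  set ψ' := schwartzFourier n ψ with hψ'
  obtain ⟨K, hK⟩ := exists_nat_gt μ
  obtain ⟨C, hC⟩ := exists_expansion hΦs hΦb ψ' K
  have hFP := isFinitePart_expansion (μ := μ) (K := K + 1) (by push_cast; linarith) hC
  rw [hqe ψ' (K + 1) (by push_cast; linarith)] at hFP
  have hval : distFourier n T ψ = (∫ ξ, E ξ * ψ' ξ) + -1 * ∫ ξ, polyEval q ξ * ψ' ξ := by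
    have : distFourier n T ψ = T ψ' := rfl
    rw [this, (hT ψ').2, ← integral_const_mul, ← integral_add
      (h1.isSymbol.moderate.integrable_mul ψ')
      (((moderate_polyEval_of_polyHom hq).integrable_mul ψ').const_mul _)]
    refine integral_congr_ae (Eventually.of_forall fun ξ => ?_)
    simp only [polyEval_C_mul]; ring
  obtain ⟨C1, hC1⟩ := norm_integral_ball_le hn (u := fun x => E' x * ψ x)
    (h2.smooth.continuous.mul ψ.continuous)
  obtain ⟨C2, hC2⟩ := norm_integral_ball_le hn (u := fun x => polyEval p' x * ψ x)
    ((contDiff_polyEval p').continuous.mul ψ.continuous)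
  -- The integrals over the shrinking ball are `O(ε)` and `O(ε log ε)`.
  have hz : Tendsto (fun ε : ℝ => (∫ x in {x : Rn n | ‖x‖ < ε}, E' x * ψ x)
        + (Real.log ε : ℂ) * ∫ x in {x : Rn n | ‖x‖ < ε}, polyEval p' x * ψ x) (𝓝[>] 0) (𝓝 0) := by
    have hb : Tendsto (fun ε : ℝ => C1 * ε + |Real.log ε * ε ^ (1 : ℝ)| * C2) (𝓝[>] 0) (𝓝 0) := by
      have t1 : Tendsto (fun ε : ℝ => ε) (𝓝[>] 0) (𝓝 0) := nhdsWithin_le_nhds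
      have t2 := (tendsto_log_mul_rpow_nhdsGT_zero one_pos).abs
      simpa using (t1.const_mul C1).add (t2.mul_const C2)
    refine squeeze_zero_norm' ?_ hb
    filter_upwards [Ioc_mem_nhdsGT (zero_lt_one (α := ℝ))] with ε hε
    refine (norm_add_le _ _).trans (add_le_add (hC1 ε hε.1 hε.2) ?_)
    rw [norm_mul, Complex.norm_real, rpow_one, abs_mul, abs_of_pos hε.1, Real.norm_eq_abs, mul_assoc,
      mul_comm ε]
    exact mul_le_mul_of_nonneg_left (hC2 ε hε.1 hε.2) (abs_nonneg _)
  have hall := (((IsFinitePart.of_tendsto (tendsto_const_nhds (x := ∫ ξ, E ξ * ψ' ξ))).add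
    (hFP.const_mul (-1))).add (isFinitePart_log (-∫ ξ, polyEval p ξ * ψ' ξ))).add
    (IsFinitePart.of_tendsto hz)
  rw [hval]
  simp only [add_zero] at hall
  refine hall.congr ?_
  filter_upwards [Ioc_mem_nhdsGT (zero_lt_one (α := ℝ))] with ε hε
  rw [integral_tail_mul hn h1 h2 hs ψ hε.1 hε.2]
  ring

end TailFourier


/-! ### Prolongations -/

section Prolongation

variable {n : ℕ} {T T' : 𝓢'(Rn n, ℂ)} {u v : Rn n → ℂ} {σ : ℝ}

/-- `u` is continuous off the origin and bounded near infinity. -/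
def OffBounded (u : Rn n → ℂ) : Prop :=
  ContinuousOn u {0}ᶜ ∧ ∃ C : ℝ, ∀ x, 1 ≤ ‖x‖ → ‖u x‖ ≤ C

theorem OffBounded.of_eq_zero (h : ContinuousOn u {0}ᶜ) (h0 : ∀ x, 1 ≤ ‖x‖ → u x = 0) :
    OffBounded u := ⟨h, 0, fun x hx => by simp [h0 x hx]⟩

theorem OffBounded.add (hu : OffBounded u) (hv : OffBounded v) :
    OffBounded fun x => u x + v x := by
  obtain ⟨C, hC⟩ := hu.2
  obtain ⟨C', hC'⟩ := hv.2
  exact ⟨hu.1.add hv.1, C + C', fun x hx => (norm_add_le _ _).trans (add_le_add (hC x hx) (hC' x hx))⟩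

theorem OffBounded.const_mul (c : ℂ) (hu : OffBounded u) : OffBounded fun x => c * u x := by
  obtain ⟨C, hC⟩ := hu.2
  refine ⟨continuousOn_const.mul hu.1, ‖c‖ * C, fun x hx => ?_⟩
  rw [norm_mul]
  exact mul_le_mul_of_nonneg_left (hC x hx) (norm_nonneg c)

theorem PBound.offBounded (hu : FarBound σ u) (hσ : σ ≤ 0) : OffBounded u := by
  obtain ⟨C, hC0, hC⟩ := (hu.mono hσ).norm_le
  refine ⟨hu.1.continuousOn, C, fun x hx => ?_⟩
  have h0 : x ≠ 0 := by rintro rfl; simp at hx; linarith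
  simpa using hC x hx h0

theorem schwartz_offBounded (g : 𝓢(Rn n, ℂ)) : OffBounded (g : Rn n → ℂ) :=
  (schwartz_farBound g 0).offBounded le_rfl

theorem OffBounded.integrableOn (hu : OffBounded u) (φ : 𝓢(Rn n, ℂ)) {ε : ℝ} (hε : 0 < ε) :
    IntegrableOn (fun x => u x * φ x) {x : Rn n | ε ≤ ‖x‖} := by
  obtain ⟨C, hC⟩ := hu.2
  have hsub : {x : Rn n | ε ≤ ‖x‖} ⊆ {0}ᶜ := fun x (hx : ε ≤ ‖x‖) => by
    rintro rfl; simp at hx; linarith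
  have hK : IsCompact ({x : Rn n | ε ≤ ‖x‖} ∩ Metric.closedBall 0 1) :=
    (isCompact_closedBall (0 : Rn n) 1).inter_left (isClosed_le continuous_const continuous_norm)
  obtain ⟨C', hC'⟩ := hK.exists_bound_of_continuousOn
    (hu.1.mono (inter_subset_left.trans hsub))
  refine Integrable.mono' (g := fun x => max C C' * ‖φ x‖) (φ.integrable.norm.const_mul _).integrableOn
    (((hu.1.mono hsub).mul φ.continuous.continuousOn).aestronglyMeasurable (measurableSet_norm_ge ε))
    ((ae_restrict_mem (measurableSet_norm_ge ε)).mono fun x hx => ?_)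
  rw [norm_mul]
  refine mul_le_mul_of_nonneg_right ?_ (norm_nonneg _)
  rcases le_total 1 ‖x‖ with h | h
  · exact (hC x h).trans (le_max_left _ _)
  · exact (hC' x ⟨hx, by simpa using h⟩).trans (le_max_right _ _)

theorem IsProlongation.add (h : IsProlongation T u) (h' : IsProlongation T' v) (hu : OffBounded u)
    (hv : OffBounded v) : IsProlongation (T + T') (fun x => u x + v x) := fun φ => by
  refine ((h φ).add (h' φ)).congr ?_
  filter_upwards [self_mem_nhdsWithin] with ε (hε : 0 < ε)
  rw [← integral_add (hu.integrableOn φ hε) (hv.integrableOn φ hε)]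
  simp only [add_mul]

theorem IsProlongation.const_smul (c : ℂ) (h : IsProlongation T u) :
    IsProlongation (c • T) (fun x => c * u x) := fun φ => by
  refine ((h φ).const_mul c).congr (Eventually.of_forall fun ε => ?_)
  simp only [mul_assoc, integral_const_mul]

theorem IsProlongation.congr (h : IsProlongation T u) (e : ∀ x, x ≠ 0 → u x = v x) :
    IsProlongation T v := fun φ => by
  refine (h φ).congr ?_
  filter_upwards [self_mem_nhdsWithin] with ε (hε : 0 < ε)
  refine setIntegral_congr_fun (measurableSet_norm_ge ε) fun x (hx : ε ≤ ‖x‖) => ?_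
  have : x ≠ 0 := by rintro rfl; simp at hx; linarith
  rw [e x this]

theorem IsProlongation.zero : IsProlongation (0 : 𝓢'(Rn n, ℂ)) (fun _ => 0) := fun φ => by
  refine IsFinitePart.of_tendsto ?_
  simp

theorem IsProlongation.sum {ι : Type*} {s : Finset ι} {T : ι → 𝓢'(Rn n, ℂ)} {u : ι → Rn n → ℂ}
    (h : ∀ i ∈ s, IsProlongation (T i) (u i)) (hu : ∀ i ∈ s, OffBounded (u i)) :
    IsProlongation (∑ i ∈ s, T i) (fun x => ∑ i ∈ s, u i x)
      ∧ OffBounded fun x => ∑ i ∈ s, u i x := by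
  classical
  induction s using Finset.induction_on with
  | empty => simpa using ⟨IsProlongation.zero, continuousOn_const, 0, by simp⟩
  | insert a s ha ih =>
    simp only [Finset.sum_insert ha]
    have h1 := ih (fun i hi => h i (Finset.mem_insert_of_mem hi))
      (fun i hi => hu i (Finset.mem_insert_of_mem hi))
    have h2 := hu a (Finset.mem_insert_self _ _)
    exact ⟨(h a (Finset.mem_insert_self _ _)).add h1.1 h2 h1.2, h2.add h1.2⟩

theorem ae_ne_zero (hn : 1 ≤ n) : ∀ᵐ x : Rn n, x ≠ 0 := by
  have : (fun x : Rn n => if x = 0 then (1 : ℂ) else 0) =ᵐ[volume] fun _ => 0 :=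
    ae_eq_of_off hn fun x hx => if_neg hx
  filter_upwards [this] with x hx hx0
  simp [hx0] at hx

theorem IsGivenBy.isProlongation (hn : 1 ≤ n) (h : IsGivenBy T u) : IsProlongation T u := fun φ => by
  refine IsFinitePart.of_tendsto ?_
  rw [(h φ).2]
  have hi := (h φ).1
  simp only [← integral_indicator (measurableSet_norm_ge _)]
  refine tendsto_integral_filter_of_dominated_convergence (fun x => ‖u x * φ x‖)
    (Eventually.of_forall fun ε => hi.1.indicator (measurableSet_norm_ge ε))
    (Eventually.of_forall fun ε => Eventually.of_forall fun x => norm_indicator_le_norm_self _ _)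
    hi.norm ?_
  filter_upwards [ae_ne_zero hn] with x hx
  refine tendsto_const_nhds.congr' ?_
  filter_upwards [Ioc_mem_nhdsGT (norm_pos_iff.2 hx)] with ε hε
  rw [indicator_of_mem (by exact hε.2)]

/-- Functions that are `O(|x|^σ)` near the origin, `σ > -n`, and vanish for `|x| ≥ 1`. -/
theorem PBound.integrable (hn : 1 ≤ n) (hu : NearBound σ u) (hσ : -(n : ℝ) < σ)
    (h0 : ∀ x, 1 ≤ ‖x‖ → u x = 0) : Integrable u := by
  have : Nonempty (Fin n) := ⟨⟨0, hn⟩⟩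
  obtain ⟨C, hC0, hC⟩ := hu.norm_le
  -- In polar coordinates the integrand is `r^(σ+n-1)`, integrable at zero exactly because `σ > -n`.
  have hi : IntegrableOn (fun x : Rn n => ‖x‖ ^ σ) (Metric.ball 0 1) := by
    refine (integrableOn_fun_norm_addHaar volume (f := fun r : ℝ => r ^ σ)).2 ?_
    rw [finrank_euclideanSpace_fin]
    have h1 : IntegrableOn (fun y : ℝ => y ^ (σ + n - 1)) (Ioo 0 1) :=
      (integrableOn_Ioc_rpow (by linarith)).mono_set Ioo_subset_Ioc_self
    refine h1.congr_fun (fun y hy => ?_) measurableSet_Ioo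
    have e : y ^ (n - 1) = y ^ ((n : ℝ) - 1) := by rw [← rpow_natCast]; push_cast [hn]; rfl
    beta_reduce
    rw [smul_eq_mul, e, ← rpow_add hy.1]; congr 1; ring
  have hm : AEStronglyMeasurable u volume := by
    have h1 : AEStronglyMeasurable (({0}ᶜ : Set (Rn n)).indicator u) volume :=
      (aestronglyMeasurable_indicator_iff isOpen_compl_zero.measurableSet).2
        (hu.1.continuousOn.aestronglyMeasurable isOpen_compl_zero.measurableSet)
    exact h1.congr (ae_eq_of_off hn fun x hx => indicator_of_mem (by exact hx) _)
  have hi2 : IntegrableOn u (Metric.ball 0 1) := by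
    refine Integrable.mono' (hi.const_mul C) hm.restrict ?_
    refine ae_restrict_of_ae ?_
    filter_upwards [ae_ne_zero hn] with x hx
    by_cases h1 : ‖x‖ ≤ 1
    · exact hC x h1 hx
    · rw [h0 x (not_le.1 h1).le, norm_zero]; positivity
  exact (integrableOn_iff_integrable_of_support_subset fun x hx => by
    by_contra h
    exact hx (h0 x (by simpa using h))).1 hi2

end Prolongation


/-! ### Correspondence between homogeneous functions -/

section Corr

variable {n : ℕ} {σ μ s : ℝ}

/-- A Schwartz function as a tempered distribution. -/
abbrev schwartzDist (H : 𝓢(Rn n, ℂ)) : 𝓢'(Rn n, ℂ) :=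
  SchwartzMap.toTemperedDistributionCLM (Rn n) ℂ volume H

theorem schwartzDist_add (H H' : 𝓢(Rn n, ℂ)) :
    schwartzDist (H + H') = schwartzDist H + schwartzDist H' := map_add _ _ _

theorem schwartzDist_smul (c : ℂ) (H : 𝓢(Rn n, ℂ)) :
    schwartzDist (c • H) = c • schwartzDist H := map_smul _ _ _

theorem distFourier_apply (T : 𝓢'(Rn n, ℂ)) (ψ : 𝓢(Rn n, ℂ)) :
    distFourier n T ψ = T (schwartzFourier n ψ) := rfl

theorem distFourier_add (T T' : 𝓢'(Rn n, ℂ)) :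
    distFourier n (T + T') = distFourier n T + distFourier n T' := rfl

theorem distFourier_smul (c : ℂ) (T : 𝓢'(Rn n, ℂ)) :
    distFourier n (c • T) = c • distFourier n T := rfl

theorem distFourier_sum {ι : Type*} (s : Finset ι) (T : ι → 𝓢'(Rn n, ℂ)) :
    distFourier n (∑ i ∈ s, T i) = ∑ i ∈ s, distFourier n (T i) := by
  classical
  induction s using Finset.induction_on with
  | empty => rfl
  | insert a s ha ih => rw [Finset.sum_insert ha, Finset.sum_insert ha, distFourier_add, ih]

theorem distFourier_injective : Function.Injective (distFourier n) := by
  intro T T' h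
  ext ψ
  obtain ⟨φ, rfl⟩ := schwartzFourier_surjective ψ
  rw [← distFourier_apply, ← distFourier_apply, h]

theorem distFourier_schwartzDist (S : 𝓢(Rn n, ℂ)) :
    distFourier n (schwartzDist S) = schwartzDist (schwartzFourier n S) := by
  ext ψ
  rw [distFourier_apply, (isGivenBy_schwartz S _).2, (isGivenBy_schwartz _ ψ).2,
    integral_schwartzFourier_mul]

theorem exists_schwartz_of_eq_zero {u : Rn n → ℂ} (hu : ContDiff ℝ ∞ u)
    (h0 : ∀ x, 1 ≤ ‖x‖ → u x = 0) : ∃ H : 𝓢(Rn n, ℂ), ∀ x, H x = u x :=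
  exists_schwartz hu fun _ => farBound_of_contDiff hu PBound.zero h0

/-- The radial derivative of the patch function. -/
def radialDeriv (x : Rn n) : ℂ := (fderiv ℝ (patch (n := n)) x x : ℝ)

theorem contDiff_radialDeriv : ContDiff ℝ ∞ (radialDeriv (n := n)) :=
  Complex.ofRealCLM.contDiff.comp ((contDiff_patch.fderiv_right (by norm_num)).clm_apply contDiff_id)

/-- `patch` attains its maximum at such points, so the derivative vanishes on the boundary sphere as
well. -/
theorem radialDeriv_of_one_le {x : Rn n} (h : 1 ≤ ‖x‖) : radialDeriv x = 0 := by
  have hm : IsLocalMax (patch (n := n)) x := Eventually.of_forall fun y => by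
    rw [patch_of_one_le h]; exact step_le_one _
  simp [radialDeriv, hm.fderiv_eq_zero]

theorem radialDeriv_of_le_half {x : Rn n} (h : ‖x‖ ≤ 1 / 2) : radialDeriv x = 0 := by
  have hm : IsLocalMin (patch (n := n)) x := Eventually.of_forall fun y => by
    rw [patch_of_le_half h]; exact step_nonneg _
  simp [radialDeriv, hm.fderiv_eq_zero]

theorem contDiff_radialDeriv_mul {u : Rn n → ℂ} (hu : ContDiffOn ℝ ∞ u {0}ᶜ) :
    ContDiff ℝ ∞ (fun x => radialDeriv x * u x) := by
  rw [contDiff_iff_contDiffAt]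
  intro x
  by_cases hx : x = 0
  · subst hx
    refine (contDiffAt_const (c := (0 : ℂ))).congr_of_eventuallyEq ?_
    filter_upwards [Metric.closedBall_mem_nhds (0 : Rn n) (by norm_num : (0 : ℝ) < 1 / 2)] with y hy
    rw [radialDeriv_of_le_half (by simpa using hy), zero_mul]
  · exact contDiff_radialDeriv.contDiffAt.mul (hu.contDiffAt (isOpen_compl_zero.mem_nhds hx))

theorem hasDerivAt_patch_smul (x : Rn n) {t : ℝ} (ht : t ≠ 0) :
    HasDerivAt (fun t : ℝ => (patch (t • x) : ℂ)) (((t⁻¹ : ℝ) : ℂ) * radialDeriv (t • x)) t := by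
  have h1 : HasDerivAt (fun t : ℝ => t • x) x t := by
    simpa using (hasDerivAt_id t).smul_const x
  have h2 := ((contDiff_patch (n := n)).differentiable (by simp) (t • x)).hasFDerivAt.comp_hasDerivAt t h1
  have h3 := h2.ofReal_comp
  refine h3.congr_deriv ?_
  rw [radialDeriv, map_smul, smul_eq_mul, ← Complex.ofReal_mul, inv_mul_cancel_left₀ ht]

/-- Every homogeneous function comes from a tail. -/
theorem HomFun.exists_decomp {f : Rn n → ℂ} (hf : HomFun σ f) :
    ∃ g : 𝓢(Rn n, ℂ), Decomp σ g f 0 (fun x => (patch x : ℂ) * f x) := by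
  -- For `g = (x·∇patch) f` homogeneity makes `t^(-σ-1) g(t x)` the `t`-derivative of `patch(t x)
  -- f(x)`, so the tail is `(1 - patch) f`.
  obtain ⟨g, hg⟩ := exists_schwartz_of_eq_zero (contDiff_radialDeriv_mul hf.1)
    fun x hx => by rw [radialDeriv_of_one_le hx, zero_mul]
  refine ⟨g, hf, PolyHom.zero, contDiff_patch_mul hf.1, fun x hx => ?_⟩
  have hd : ∀ t ∈ Ici (1 : ℝ), HasDerivAt (fun t : ℝ => (patch (t • x) : ℂ) * f x)
      (t ^ (-σ - 1) • g (t • x)) t := by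
    intro t ht
    have ht0 : 0 < t := lt_of_lt_of_le one_pos ht
    refine ((hasDerivAt_patch_smul x ht0.ne').mul_const (f x)).congr_deriv ?_
    rw [hg, hf.2 t ht0 x hx, Complex.real_smul]
    have : t⁻¹ = t ^ (-σ - 1) * t ^ σ := by
      rw [← rpow_add ht0, show -σ - 1 + σ = -1 by ring, rpow_neg_one]
    rw [this]; push_cast; ring
  have hlim : Tendsto (fun t : ℝ => (patch (t • x) : ℂ) * f x) atTop (𝓝 (1 * f x)) := by
    refine tendsto_const_nhds.congr' ?_
    filter_upwards [eventually_ge_atTop ‖x‖⁻¹, eventually_gt_atTop 0] with t ht ht0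
    rw [patch_of_one_le, Complex.ofReal_one]
    rw [norm_smul, Real.norm_of_nonneg ht0.le]
    exact (inv_le_iff_one_le_mul₀ (norm_pos_iff.2 hx)).1 ht
  have := integral_Ioi_of_hasDerivAt_of_tendsto' hd (tail_integrable σ g hx one_pos) hlim
  rw [tail, this, polyEval_zero]
  simp

/-- Multiplication of tails by homogeneous polynomials. -/
theorem PolyHom.exists_decomp {p : MvPolynomial (Fin n) ℂ} (hp : PolyHom σ p) :
    ∃ (g : 𝓢(Rn n, ℂ)) (f E : Rn n → ℂ), Decomp σ g f p E := by
  -- Since `bump` equals `1` at the origin, its tail of degree `0` contains the logarithm with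
  -- coefficient `-1`. Multiplying that tail by `p` gives the tail of degree `σ` of `p * bump`.
  obtain ⟨g₀, hg₀⟩ := exists_schwartz_of_eq_zero (contDiff_bump_complex (n := n))
    fun x hx => by rw [bump_of_one_le hx]; simp
  obtain ⟨g, hg⟩ := exists_schwartz_of_eq_zero ((contDiff_polyEval p).mul contDiff_bump_complex)
    fun x hx => by rw [bump_of_one_le hx]; simp
  obtain ⟨f, E, hD⟩ := exists_decomp_zero g₀
  have h1 : g₀ 0 = 1 := by rw [hg₀, bump_of_le_half (by simp)]; simp
  have hhom := hp.homFun.mul hD.hom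
  rw [add_zero] at hhom
  refine ⟨g, _, fun x => polyEval p x * E x, hhom, hp,
    (contDiff_polyEval p).mul hD.smooth, fun x hx => ?_⟩
  have e : tail σ g x = polyEval p x * tail 0 g₀ x := by
    rw [tail, tail, ← integral_const_mul]
    refine setIntegral_congr_fun measurableSet_Ioi fun t ht => ?_
    have ht0 : 0 < t := lt_trans one_pos ht
    beta_reduce
    rw [hg, hg₀, hp.homFun.2 t ht0 x hx, Complex.real_smul, Complex.real_smul,
      show (-0 - 1 : ℝ) = (-σ - 1) + σ by ring, rpow_add ht0]
    push_cast; ring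
  rw [e, hD.eq x hx, h1]
  simp [polyEval]; ring

/-- The prolongation of `f` plus `Q log|x|`, cut off, is up to a Schwartz function the Fourier
transform of `h + p log|ξ|`, cut off near the origin. -/
def Corr (f : Rn n → ℂ) (Q : MvPolynomial (Fin n) ℂ) (h : Rn n → ℂ)
    (p : MvPolynomial (Fin n) ℂ) : Prop :=
  ∃ (T₁ T₂ U : 𝓢'(Rn n, ℂ)) (H : 𝓢(Rn n, ℂ)),
    IsProlongation T₁ (fun x => (bump x : ℂ) * f x) ∧
    IsGivenBy T₂ (fun x => (bump x : ℂ) * (polyEval Q x * (Real.log ‖x‖ : ℂ))) ∧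
    IsGivenBy U (fun ξ => (patch ξ : ℂ) * h ξ + (patch ξ : ℂ) * (polyEval p ξ * (Real.log ‖ξ‖ : ℂ))) ∧
    T₁ + T₂ = distFourier n U + schwartzDist H

theorem offBounded_bump_mul {f : Rn n → ℂ} (hf : ContDiffOn ℝ ∞ f {0}ᶜ) :
    OffBounded fun x => (bump x : ℂ) * f x :=
  OffBounded.of_eq_zero (contDiff_bump_complex.continuous.continuousOn.mul hf.continuousOn)
    fun x hx => by rw [bump_of_one_le hx]; simp

theorem Corr.add_smul {f f' h h' : Rn n → ℂ} {Q Q' p p' : MvPolynomial (Fin n) ℂ}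
    (hc : Corr f Q h p) (hc' : Corr f' Q' h' p') (hf : HomFun s f) (hf' : HomFun s f') (c : ℂ) :
    Corr (fun x => f x + c * f' x) (Q + MvPolynomial.C c * Q') (fun x => h x + c * h' x)
      (p + MvPolynomial.C c * p') := by
  obtain ⟨T₁, T₂, U, H, h1, h2, h3, h4⟩ := hc
  obtain ⟨T₁', T₂', U', H', h1', h2', h3', h4'⟩ := hc'
  refine ⟨T₁ + c • T₁', T₂ + c • T₂', U + c • U', H + c • H', ?_, ?_, ?_, ?_⟩
  · exact (h1.add (h1'.const_smul c) (offBounded_bump_mul hf.1)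
      ((offBounded_bump_mul hf'.1).const_mul c)).congr fun x _ => by ring
  · refine (h2.add (h2'.const_smul c)).congr_ae (Eventually.of_forall fun x => ?_)
    beta_reduce; rw [polyEval_add, polyEval_C_mul]; ring
  · refine (h3.add (h3'.const_smul c)).congr_ae (Eventually.of_forall fun x => ?_)
    beta_reduce; rw [polyEval_add, polyEval_C_mul]; ring
  · rw [distFourier_add, distFourier_smul, schwartzDist_add, schwartzDist_smul]
    calc _ = (T₁ + T₂) + c • (T₁' + T₂') := by module
      _ = _ := by rw [h4, h4']; module

theorem moderate_bump_log (hn : 1 ≤ n) (Q : MvPolynomial (Fin n) ℂ) :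
    Moderate fun x => (bump x : ℂ) * (polyEval Q x * (Real.log ‖x‖ : ℂ)) := by
  have h : NearBound (0 + (0 + -(1 / 2))) fun x => (bump x : ℂ) * (polyEval Q x * (Real.log ‖x‖ : ℂ)) :=
    (nearBound_of_contDiff contDiff_bump_complex).mul
      ((nearBound_of_contDiff (contDiff_polyEval Q)).mul (nearBound_log (by norm_num)))
  have hn' : (1 : ℝ) ≤ n := by exact_mod_cast hn
  exact moderate_of_integrable (PBound.integrable hn h (by linarith)
    fun x hx => by rw [bump_of_one_le hx]; simp)

/-- `exists_prolongation_tail` read modulo Schwartz functions: the tail is `bump` times its singular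
part, and `E` is `patch` times its homogeneous and logarithmic part. The factors `-1` reflect the
sign of the logarithm in `Decomp`. -/
theorem corr_of_decomp (hn : 1 ≤ n) (hs : s = -n - μ) {φ : 𝓢(Rn n, ℂ)} {h E f E' : Rn n → ℂ}
    {p p' : MvPolynomial (Fin n) ℂ} (h1 : Decomp μ φ h p E)
    (h2 : Decomp s (schwartzFourier n φ) f p' E') :
    ∃ q, PolyHom μ q ∧ Corr f (MvPolynomial.C (-1) * p') (fun ξ => h ξ + polyEval q ξ)
      (MvPolynomial.C (-1) * p) := by
  obtain ⟨q, hq, hT⟩ := exists_prolongation_tail hn h1 h2 hs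
  refine ⟨q, hq, ?_⟩
  obtain ⟨T, hTg⟩ := ((h1.isSymbol.moderate).add (moderate_polyEval_of_polyHom hq)).exists_isGivenBy
  have hP := hT T hTg
  obtain ⟨S, hS⟩ := h1.exists_schwartz
  obtain ⟨S', hS'⟩ := h2.exists_schwartz
  -- `B` is the error of replacing `q` by `patch * q`.
  obtain ⟨B, hB⟩ := exists_schwartz_of_eq_zero (contDiff_bump_complex.mul (contDiff_polyEval q))
    fun x hx => by rw [bump_of_one_le hx]; simp
  have hhq := h1.hom.add hq.homFun
  have hU : IsGivenBy (T - schwartzDist (S + B)) (fun ξ => (patch ξ : ℂ) * (h ξ + polyEval q ξ)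
      + (patch ξ : ℂ) * (polyEval (MvPolynomial.C (-1) * p) ξ * (Real.log ‖ξ‖ : ℂ))) := by
    refine (hTg.sub (isGivenBy_schwartz (S + B))).congr_ae (Eventually.of_forall fun x => ?_)
    beta_reduce
    rw [hS, _root_.add_apply, hB, polyEval_C_mul, bump]
    push_cast; ring
  obtain ⟨T₂, hT₂⟩ := (moderate_bump_log hn (MvPolynomial.C (-1) * p')).exists_isGivenBy
  have hP2 : IsProlongation (distFourier n T + (-1 : ℂ) • T₂ + schwartzDist S')
      (fun x => (bump x : ℂ) * f x) := by
    have o1 : OffBounded (tail s (schwartzFourier n φ)) :=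
      (tail_farBound s (schwartzFourier n φ) 0).offBounded (by simp)
    have o2 : OffBounded fun x => (bump x : ℂ) * (polyEval (MvPolynomial.C (-1) * p') x *
        (Real.log ‖x‖ : ℂ)) := offBounded_bump_mul
      ((contDiff_polyEval _).contDiffOn.mul contDiffOn_log_norm)
    refine ((hP.add ((hT₂.isProlongation hn).const_smul (-1)) o1 (o2.const_mul _)).add
      ((isGivenBy_schwartz S').isProlongation hn) (o1.add (o2.const_mul _))
      (schwartz_offBounded S')).congr fun x hx => ?_
    rw [h2.eq x hx, hS', polyEval_C_mul, bump]
    push_cast; ring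
  refine ⟨_, T₂, _, schwartzFourier n (S + B) + S', hP2, hT₂, hU, ?_⟩
  have e : distFourier n (T - schwartzDist (S + B))
      = distFourier n T - schwartzDist (schwartzFourier n (S + B)) := by
    rw [← distFourier_schwartzDist]; rfl
  rw [e, schwartzDist_add]
  module

/-- From the singular function to the symbol. -/
theorem exists_corr_of_singular (hn : 1 ≤ n) (hs : s = -n - μ) {f : Rn n → ℂ} (hf : HomFun s f)
    {Q : MvPolynomial (Fin n) ℂ} (hQ : PolyHom s Q) :
    ∃ h p, HomFun μ h ∧ PolyHom μ p ∧ Corr f Q h p := by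
  have key : ∀ (g : 𝓢(Rn n, ℂ)) (f : Rn n → ℂ) (Q : MvPolynomial (Fin n) ℂ) (E : Rn n → ℂ),
      Decomp s g f Q E → ∃ h p, HomFun μ h ∧ PolyHom μ p ∧ Corr f (MvPolynomial.C (-1) * Q) h p := by
    intro g f Q E hD
    obtain ⟨φ, rfl⟩ := schwartzFourier_surjective g
    obtain ⟨h, p, E', hD'⟩ := exists_decomp μ φ
    obtain ⟨q, hq, hc⟩ := corr_of_decomp hn hs hD' hD
    exact ⟨_, _, hD'.hom.add hq.homFun, hD'.poly.C_mul _, hc⟩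
  -- A tail realizing the logarithm `Q` brings along an uncontrolled homogeneous part `f₂`. It is
  -- removed by subtracting this correspondence from that of `f + f₂`, which has no logarithm.
  obtain ⟨g₂, f₂, E₂, hD₂⟩ := hQ.exists_decomp
  obtain ⟨h₂, p₂, hh₂, hp₂, hc₂⟩ := key g₂ f₂ Q E₂ hD₂
  obtain ⟨g₁, hD₁⟩ := (hf.add hD₂.hom).exists_decomp
  obtain ⟨h₁, p₁, hh₁, hp₁, hc₁⟩ := key g₁ _ 0 _ hD₁
  have hc := hc₁.add_smul hc₂ (hf.add hD₂.hom) hD₂.hom (-1)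
  refine ⟨_, _, hh₁.add (hh₂.const_mul (-1)), hp₁.add (hp₂.C_mul (-1)), ?_⟩
  convert hc using 1
  · ext x; ring
  · rw [mul_zero, zero_add, ← mul_assoc, ← map_mul]; simp

/-- From the symbol to the singular function, up to a polynomial. -/
theorem exists_corr_of_symbol (hn : 1 ≤ n) (hs : s = -n - μ) {h : Rn n → ℂ} (hh : HomFun μ h)
    {p : MvPolynomial (Fin n) ℂ} (hp : PolyHom μ p) :
    ∃ f Q q, HomFun s f ∧ PolyHom s Q ∧ PolyHom μ q ∧ Corr f Q (fun ξ => h ξ + polyEval q ξ) p := by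
  have key : ∀ (φ : 𝓢(Rn n, ℂ)) (h : Rn n → ℂ) (p : MvPolynomial (Fin n) ℂ) (E : Rn n → ℂ),
      Decomp μ φ h p E → ∃ f Q q, HomFun s f ∧ PolyHom s Q ∧ PolyHom μ q ∧
        Corr f Q (fun ξ => h ξ + polyEval q ξ) (MvPolynomial.C (-1) * p) := by
    intro φ h p E hD
    obtain ⟨f, Q, E', hD'⟩ := exists_decomp s (schwartzFourier n φ)
    obtain ⟨q, hq, hc⟩ := corr_of_decomp hn hs hD hD'
    exact ⟨f, _, q, hD'.hom, hD'.poly.C_mul _, hq, hc⟩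
  -- The same subtraction as on the singular side. Here `h` is prescribed, so the polynomials `q₁`
  -- and `q₂` cannot be absorbed into it.
  obtain ⟨φ₂, h₂, E₂, hD₂⟩ := hp.exists_decomp
  obtain ⟨f₂, Q₂, q₂, hf₂, hQ₂, hq₂, hc₂⟩ := key φ₂ h₂ p E₂ hD₂
  obtain ⟨φ₁, hD₁⟩ := (hh.add hD₂.hom).exists_decomp
  obtain ⟨f₁, Q₁, q₁, hf₁, hQ₁, hq₁, hc₁⟩ := key φ₁ _ 0 _ hD₁
  have hc := hc₁.add_smul hc₂ hf₁ hf₂ (-1)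
  refine ⟨_, _, q₁ + MvPolynomial.C (-1) * q₂, hf₁.add (hf₂.const_mul (-1)),
    hQ₁.add (hQ₂.C_mul (-1)), hq₁.add (hq₂.C_mul (-1)), ?_⟩
  convert hc using 1
  · ext x; rw [polyEval_add, polyEval_C_mul]; ring
  · rw [mul_zero, zero_add, ← mul_assoc, ← map_mul]; simp

end Corr


/-! ### Fourier transforms of functions of limited regularity at the origin -/

section Remainder

variable {n : ℕ}

theorem PBound.norm_le_ball {F : Type*} [NormedAddCommGroup F] [NormedSpace ℝ F] {u : Rn n → F}
    {σ : ℝ} (hu : NearBound σ u) (h0 : u 0 = 0) : ∃ C : ℝ, 0 ≤ C ∧ ∀ x, ‖x‖ ≤ 1 → ‖u x‖ ≤ C * ‖x‖ ^ σ := by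
  obtain ⟨C, hC0, hC⟩ := hu.norm_le
  refine ⟨C, hC0, fun x hx => ?_⟩
  by_cases h : x = 0
  · rw [h, h0, norm_zero]; positivity
  · exact hC x hx h

/-- Induction on `J`: for `σ > 1` the bound `u = O(|x|^σ)` makes the derivative at the origin zero,
and `fderiv ℝ u` satisfies the hypotheses with `σ - 1`. The target space varies because derivatives
take values in other spaces. -/
theorem contDiff_of_nearBound (J : ℕ) : ∀ {F : Type*} [NormedAddCommGroup F] [NormedSpace ℝ F]
    {u : Rn n → F} {σ : ℝ}, NearBound σ u → (J : ℝ) < σ → u 0 = 0 → ContDiff ℝ J u := by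
  induction J with
  | zero =>
    intro F _ _ u σ hu hσ h0
    obtain ⟨C, hC0, hC⟩ := hu.norm_le_ball h0
    rw [Nat.cast_zero, contDiff_zero, continuous_iff_continuousAt]
    intro x
    by_cases hx : x = 0
    · subst hx
      rw [ContinuousAt, h0]
      have hb : Tendsto (fun x : Rn n => C * ‖x‖ ^ σ) (𝓝 0) (𝓝 0) := by
        have h1 : Continuous fun x : Rn n => C * ‖x‖ ^ σ :=
          continuous_const.mul (continuous_norm.rpow_const fun _ => Or.inr (by simpa using hσ.le))
        have h2 := h1.tendsto 0
        rwa [norm_zero, zero_rpow (by simpa using hσ.ne'), mul_zero] at h2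
      refine squeeze_zero_norm' ?_ hb
      filter_upwards [Metric.closedBall_mem_nhds (0 : Rn n) one_pos] with x hx
      exact hC x (by simpa using hx)
    · exact hu.1.continuousOn.continuousAt (isOpen_compl_zero.mem_nhds hx)
  | succ J ih =>
    intro F _ _ u σ hu hσ h0
    push_cast at hσ
    have hJ : (0 : ℝ) ≤ J := Nat.cast_nonneg J
    obtain ⟨C, hC0, hC⟩ := hu.norm_le_ball h0
    have hd0 : HasFDerivAt u (0 : Rn n →L[ℝ] F) 0 := by
      rw [hasFDerivAt_iff_isLittleO_nhds_zero]
      simp only [zero_add, h0, sub_zero, _root_.zero_apply]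
      have hO : u =O[𝓝 0] fun x : Rn n => ‖x‖ ^ σ := by
        refine Asymptotics.IsBigO.of_bound C ?_
        filter_upwards [Metric.closedBall_mem_nhds (0 : Rn n) one_pos] with x hx
        rw [Real.norm_of_nonneg (by positivity)]
        exact hC x (by simpa using hx)
      refine hO.trans_isLittleO (Asymptotics.IsLittleO.of_norm_right ?_)
      have h1 : Tendsto (fun x : Rn n => ‖x‖ ^ (σ - 1)) (𝓝 0) (𝓝 0) := by
        have h1 : Continuous fun x : Rn n => ‖x‖ ^ (σ - 1) :=
          continuous_norm.rpow_const fun _ => Or.inr (by linarith)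
        have h2 := h1.tendsto 0
        rwa [norm_zero, zero_rpow (by linarith)] at h2
      refine (Asymptotics.isLittleO_iff_exists_eq_mul).2 ⟨_, h1, Eventually.of_forall fun x => ?_⟩
      simp only [Pi.mul_apply]
      by_cases hx : x = 0
      · rw [hx, norm_zero, zero_rpow (by linarith), mul_zero]
      · rw [← rpow_add_one (norm_ne_zero_iff.2 hx)]; congr 1; ring
    have hd : Differentiable ℝ u := fun x => by
      by_cases hx : x = 0
      · rw [hx]; exact hd0.differentiableAt
      · exact (contDiffAt_of_off hu.1 hx 1).differentiableAt (by simp)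
    have := ih (u := fderiv ℝ u) hu.fderiv (by linarith) hd0.fderiv
    rw [Nat.cast_add, Nat.cast_one]
    exact contDiff_succ_iff_fderiv.2 ⟨hd, by simp, this⟩

/-- Differentiating a Fourier transform `k` times multiplies `v` by a form of degree `k` in `x`,
which raises the order at the origin by `k`. -/
theorem nearBound_fourierPow {v : Rn n → ℂ} {σ : ℝ} (hv : NearBound σ v) (k : ℕ) :
    NearBound (σ + k) fun x => VectorFourier.fourierPowSMulRight (innerSL ℝ) v x k := by
  set u : Rn n → (Rn n) [×k]→L[ℝ] ℝ := fun x =>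
    ContinuousMultilinearMap.compContinuousLinearMapLRight
      (ContinuousMultilinearMap.mkPiAlgebra ℝ (Fin k) ℝ) (fun _ => innerSL ℝ x) with hu
  have hus : ContDiff ℝ ∞ u := (ContinuousMultilinearMap.contDiff _).comp
    (contDiff_pi.2 fun _ => (innerSL ℝ).contDiff)
  have hub : NearBound k u := by
    refine pbound_of_scaling hus.contDiffOn fun j => ?_
    obtain ⟨C, hC0, hC⟩ := exists_bound_sphere hus.contDiffOn j
    refine ⟨C, fun ρ hρ y hy _ => ?_⟩
    have e : (fun y => u (ρ • y)) = (ρ ^ k) • u := by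
      ext1 y
      simp only [hu, map_smul, Pi.smul_apply]
      have := (ContinuousMultilinearMap.compContinuousLinearMapLRight
        (ContinuousMultilinearMap.mkPiAlgebra ℝ (Fin k) ℝ)).map_smul_univ (fun _ => ρ)
        (fun _ => innerSL ℝ y)
      simpa using this
    rw [e, iteratedFDeriv_const_smul_apply (hus.contDiffAt.of_le (by exact_mod_cast le_top)),
      norm_smul, Real.norm_of_nonneg (by positivity), rpow_natCast, mul_comm]
    exact mul_le_mul_of_nonneg_right (hC y hy) (by positivity)
  have h := (hub.bilin (ContinuousMultilinearMap.smulRightL ℝ (fun _ : Fin k => Rn n) ℂ) hv).clm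
    (((-(2 * π * Complex.I)) ^ k : ℂ) • ContinuousLinearMap.id ℝ ((Rn n) [×k]→L[ℝ] ℂ))
  rw [add_comm]
  exact h

theorem hasCompactSupport_fourierPow {v : Rn n → ℂ} (h0 : ∀ x, 1 ≤ ‖x‖ → v x = 0) (k : ℕ) :
    HasCompactSupport fun x => VectorFourier.fourierPowSMulRight (innerSL ℝ) v x k := by
  refine hasCompactSupport_of_one_le fun x hx => ?_
  ext m
  simp [h0 x hx]

/-- Functions that are `O(|x|^σ)`, with derivatives, near the origin have Fourier transforms that
decay accordingly. -/
theorem isSymbol_invFourier {v : Rn n → ℂ} {σ : ℝ} (hv : NearBound σ v) (h1 : ∀ x, 1 ≤ ‖x‖ → v x = 0)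
    (h0 : v 0 = 0) {M : ℕ} (hM : (M : ℝ) < σ) :
    Integrable v ∧ IsSymbol (-M) (invFourier v) := by
  have hcs : ∀ k : ℕ, HasCompactSupport fun x : Rn n => ‖x‖ ^ k * ‖v x‖ := fun k =>
    hasCompactSupport_of_one_le fun x hx => by rw [h1 x hx]; simp
  have hM0 : (0 : ℝ) ≤ M := Nat.cast_nonneg M
  have hvc : Continuous v := (contDiff_of_nearBound 0 hv (by simp; linarith) h0).continuous
  have hmom : ∀ k : ℕ, Integrable fun x : Rn n => ‖x‖ ^ k * ‖v x‖ := fun k =>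
    ((continuous_norm.pow k).mul hvc.norm).integrable_of_hasCompactSupport (hcs k)
  refine ⟨hvc.integrable_of_hasCompactSupport (hasCompactSupport_of_one_le h1), ?_⟩
  have hs := invFourier_contDiff hmom
  refine isSymbol_iff.2 ⟨hs, hs.contDiffOn, fun k => ?_⟩
  obtain ⟨C, hC0, hC⟩ := norm_iteratedFDeriv_invFourier_le hmom k
  -- The `k`-th derivative of the transform is the transform of `w`. Its order `σ + k > M + k` makes
  -- `w` of class `C^(M+k)` with compact support, whence the decay `|ξ|^(-M-k)`.
  set w : Rn n → (Rn n) [×k]→L[ℝ] ℂ := fun x => VectorFourier.fourierPowSMulRight (innerSL ℝ) v x k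
    with hw
  have hwc : HasCompactSupport w := hasCompactSupport_fourierPow h1 k
  have hws : ContDiff ℝ ((M + k : ℕ) : ℕ∞) w := by
    refine contDiff_of_nearBound (M + k) (nearBound_fourierPow hv k) (by push_cast; linarith) ?_
    ext m; simp [hw, h0]
  have hwi : ∀ (k' n' : ℕ), (k' : ℕ∞) ≤ ((0 : ℕ) : ℕ∞) → (n' : ℕ∞) ≤ ((M + k : ℕ) : ℕ∞) →
      Integrable fun x => ‖x‖ ^ k' * ‖iteratedFDeriv ℝ n' w x‖ := by
    intro k' n' _ hn'
    have hc : Continuous (iteratedFDeriv ℝ n' w) :=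
      hws.continuous_iteratedFDeriv (by exact_mod_cast hn')
    refine ((continuous_norm.pow k').mul hc.norm).integrable_of_hasCompactSupport ?_
    exact ((hwc.iteratedFDeriv n').norm).mul_left
  set D := (2 * π) ^ 0 * (2 * ((0 : ℕ) : ℝ) + 2) ^ (M + k) *
    ∑ p ∈ Finset.range (0 + 1) ×ˢ Finset.range (M + k + 1),
      ∫ x, ‖x‖ ^ p.1 * ‖iteratedFDeriv ℝ p.2 w x‖ with hD
  have hbound : ∀ ξ : Rn n, ‖ξ‖ ^ (M + k) * ‖iteratedFDeriv ℝ k (𝓕 v) ξ‖ ≤ D := by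
    intro ξ
    have := Real.pow_mul_norm_iteratedFDeriv_fourier_le (K := ((0 : ℕ) : ℕ∞)) (N := ((M + k : ℕ) : ℕ∞))
      (f := w) hws hwi (k := 0) (n := M + k) le_rfl le_rfl ξ
    rw [norm_iteratedFDeriv_zero] at this
    rwa [Real.iteratedFDeriv_fourier (N := ⊤) (fun k _ => hmom k) hvc.aestronglyMeasurable le_top]
  refine ⟨C * (D * (2 * π) ^ (M + k)), fun ξ (hξ : 1 ≤ ‖ξ‖) hξ0 => (hC ξ).trans ?_⟩
  have hp : 0 < ‖ξ‖ := by linarith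
  rw [mul_assoc]
  refine mul_le_mul_of_nonneg_left ?_ hC0
  have h := hbound (-((2 * π)⁻¹ • ξ))
  have e : ‖ξ‖ ^ (-(M : ℝ) - k) = (‖ξ‖ ^ (M + k))⁻¹ := by
    rw [show -(M : ℝ) - k = -((M + k : ℕ) : ℝ) by push_cast; ring, rpow_neg hp.le, rpow_natCast]
  rw [norm_neg, norm_smul, norm_inv, Real.norm_of_nonneg two_pi_pos.le, mul_pow, inv_pow] at h
  rw [e, ← div_eq_mul_inv, le_div_iff₀ (by positivity)]
  have h2 : 0 < (2 * π) ^ (M + k) := by positivity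
  calc _ = (((2 * π) ^ (M + k))⁻¹ * ‖ξ‖ ^ (M + k)
        * ‖iteratedFDeriv ℝ k (𝓕 v) (-((2 * π)⁻¹ • ξ))‖) * (2 * π) ^ (M + k) := by
        field_simp
    _ ≤ _ := mul_le_mul_of_nonneg_right h h2.le

end Remainder

/-! ### Taylor expansion with derivatives -/

section TaylorNear

variable {n : ℕ}

theorem coeff_eq_zero_of_bound (K : ℕ) : ∀ {c : ℕ → ℂ} {C : ℝ}, (∀ t : ℝ, 0 < t → t ≤ 1 →
    ‖∑ k ∈ Finset.range K, (t : ℂ) ^ k * c k‖ ≤ C * t ^ K) → ∀ k < K, c k = 0 := by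
  induction K with
  | zero => intro c C _ k hk; omega
  | succ K ih =>
    intro c C h
    have h0 : c 0 = 0 := by
      have h1 : Tendsto (fun t : ℝ => ∑ k ∈ Finset.range (K + 1), (t : ℂ) ^ k * c k) (𝓝[>] 0)
          (𝓝 (∑ k ∈ Finset.range (K + 1), ((0 : ℝ) : ℂ) ^ k * c k)) :=
        ((by fun_prop : Continuous fun t : ℝ => ∑ k ∈ Finset.range (K + 1), (t : ℂ) ^ k * c k).tendsto
          0).mono_left nhdsWithin_le_nhds
      have h2 : Tendsto (fun t : ℝ => C * t ^ (K + 1)) (𝓝[>] 0) (𝓝 0) := by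
        have := ((by fun_prop : Continuous fun t : ℝ => C * t ^ (K + 1)).tendsto 0).mono_left
          (nhdsWithin_le_nhds (s := Ioi 0))
        simpa using this
      have h3 : Tendsto (fun t : ℝ => ∑ k ∈ Finset.range (K + 1), (t : ℂ) ^ k * c k) (𝓝[>] 0) (𝓝 0) := by
        refine squeeze_zero_norm' ?_ h2
        filter_upwards [Ioc_mem_nhdsGT (zero_lt_one (α := ℝ))] with t ht
        exact h t ht.1 ht.2
      have h4 := tendsto_nhds_unique h1 h3
      rw [Finset.sum_range_succ'] at h4
      simpa using h4
    have h' : ∀ t : ℝ, 0 < t → t ≤ 1 →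
        ‖∑ k ∈ Finset.range K, (t : ℂ) ^ k * c (k + 1)‖ ≤ C * t ^ K := by
      intro t ht ht1
      have := h t ht ht1
      rw [Finset.sum_range_succ', h0, mul_zero, add_zero] at this
      have e : ∑ k ∈ Finset.range K, (t : ℂ) ^ (k + 1) * c (k + 1)
          = (t : ℂ) * ∑ k ∈ Finset.range K, (t : ℂ) ^ k * c (k + 1) := by
        rw [Finset.mul_sum]
        exact Finset.sum_congr rfl fun k _ => by ring
      rw [e, norm_mul, Complex.norm_real, Real.norm_of_nonneg ht.le, pow_succ, ← mul_assoc,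
        mul_comm] at this
      exact le_of_mul_le_mul_right this ht
    intro k hk
    cases k with
    | zero => exact h0
    | succ k => exact ih h' k (by omega)

/-- Iterating Hadamard's lemma `G x = G 0 + ∑ x_i g_i(x)` controls all derivatives of the remainder,
where `norm_sub_taylor_le` controls only its size. -/
theorem exists_homogeneous_expansion (K : ℕ) : ∀ {G : Rn n → ℂ}, ContDiff ℝ ∞ G →
    ∃ Q : ℕ → MvPolynomial (Fin n) ℂ, (∀ k, (Q k).IsHomogeneous k) ∧
      NearBound K fun x => G x - ∑ k ∈ Finset.range K, polyEval (Q k) x := by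
  induction K with
  | zero =>
    intro G hG
    exact ⟨0, fun k => MvPolynomial.isHomogeneous_zero _ _ _,
      by simpa using nearBound_of_contDiff hG⟩
  | succ K ih =>
    intro G hG
    obtain ⟨g, hg, hgG⟩ := hadamard_zero hG
    choose Q hQ hQb using fun i : Fin n => ih (G := fun x => g x (EuclideanSpace.single i 1))
      (hg.clm_apply contDiff_const)
    have hpe : ∀ (i : Fin n) (x : Rn n), polyEval (MvPolynomial.X i) x = (x i : ℂ) := fun i x => by
      simp [polyEval]
    have hcoord : ∀ i : Fin n, NearBound 1 (fun x : Rn n => (x i : ℂ)) := fun i => by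
      have : PolyHom 1 (MvPolynomial.X i : MvPolynomial (Fin n) ℂ) :=
        Or.inr ⟨1, by simp, MvPolynomial.isHomogeneous_X _ _⟩
      exact (this.homFun.pbound _).congr fun x _ => hpe i x
    refine ⟨fun k => k.casesOn (MvPolynomial.C (G 0)) fun k => ∑ i, MvPolynomial.X i * Q i k,
      fun k => ?_, ?_⟩
    · cases k with
      | zero => exact MvPolynomial.isHomogeneous_C _ _
      | succ k =>
        refine MvPolynomial.IsHomogeneous.sum _ _ _ fun i _ => ?_
        rw [add_comm]
        exact (MvPolynomial.isHomogeneous_X _ i).mul (hQ i k)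
    · have h := PBound.sum (s := Finset.univ) fun i _ => (hcoord i).mul (hQb i)
      rw [Nat.cast_add, Nat.cast_one, add_comm]
      refine h.congr fun x _ => ?_
      have hx : x = ∑ i, x i • (EuclideanSpace.single i 1 : Rn n) := by
        have := (EuclideanSpace.basisFun (Fin n) ℝ).sum_repr x
        simpa using this.symm
      have e1 : g x x = ∑ i, (x i : ℂ) * g x (EuclideanSpace.single i 1) := by
        conv_lhs => rw [hx]
        rw [map_sum]
        refine Finset.sum_congr rfl fun i _ => ?_
        rw [map_smul, ← hx, Complex.real_smul]
      have e2 : ∀ k, polyEval (∑ i, MvPolynomial.X i * Q i k) x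
          = ∑ i, (x i : ℂ) * polyEval (Q i k) x := fun k => by simp [polyEval]
      have e3 : polyEval (MvPolynomial.C (G 0)) x = G 0 := by simp [polyEval]
      have e4 : G x = g x x + G 0 := by rw [← hgG]; ring
      rw [Finset.sum_range_succ']
      change _ = G x - ((∑ k ∈ Finset.range K, polyEval (∑ i, MvPolynomial.X i * Q i k) x)
        + polyEval (MvPolynomial.C (G 0)) x)
      rw [e3, e4, add_sub_add_right_eq_sub, Finset.sum_congr rfl fun k _ => e2 k, e1,
        Finset.sum_comm, ← Finset.sum_sub_distrib]
      refine Finset.sum_congr rfl fun i _ => ?_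
      rw [mul_sub, Finset.mul_sum]

/-- Along each ray the polynomials of `exists_homogeneous_expansion` and the Taylor terms both
approximate `G` up to `O(t^K)`, so they agree degree by degree. -/
theorem nearBound_sub_taylor {G : Rn n → ℂ} (hG : ContDiff ℝ ∞ G) (K : ℕ) :
    NearBound K fun x => G x - ∑ k ∈ Finset.range K, taylorTerm G k x := by
  obtain ⟨Q, hQ, hb⟩ := exists_homogeneous_expansion K hG
  refine hb.congr fun x hx => ?_
  congr 1
  have hxn : 0 < ‖x‖ := norm_pos_iff.2 hx
  have hy : ∀ k ∈ Finset.range K, polyEval (Q k) x = taylorTerm G k x := by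
    intro k hk
    rcases K with _ | K
    · simp at hk
    obtain ⟨C, hC0, hC⟩ := hb.norm_le
    obtain ⟨C', hC0', hC'⟩ := exists_bound_ball hG (K + 1) 1
    set y := ‖x‖⁻¹ • x with hyd
    have hyn : ‖y‖ = 1 := by rw [hyd, norm_smul, norm_inv, norm_norm, inv_mul_cancel₀ hxn.ne']
    have hy0 : y ≠ 0 := by rintro h; rw [h, norm_zero] at hyn; exact zero_ne_one hyn
    have key := coeff_eq_zero_of_bound (K + 1) (c := fun k => polyEval (Q k) y - taylorTerm G k y)
      (C := C + C') (fun t ht ht1 => ?_) k (Finset.mem_range.1 hk)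
    · have hxy : x = ‖x‖ • y := by rw [hyd, smul_inv_smul₀ hxn.ne']
      rw [hxy, polyEval_smul (hQ k), taylorTerm_smul, Complex.real_smul, sub_eq_zero.1 key]
      push_cast; rfl
    · have hn1 : ‖t • y‖ = t := by rw [norm_smul, hyn, mul_one, Real.norm_of_nonneg ht.le]
      have b1 := hC (t • y) (by simp only [mem_ofPred_eq]; rw [hn1]; exact ht1) (smul_ne_zero ht.ne' hy0)
      have b2 := norm_sub_taylor_le hG K (t • y) (C := C') (fun r hr => hC' _ (by
        rw [norm_smul, hn1, Real.norm_of_nonneg hr.1]; exact mul_le_one₀ hr.2 ht.le ht1))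
      rw [hn1, rpow_natCast] at b1
      rw [hn1] at b2
      have e : ∑ k ∈ Finset.range (K + 1), (t : ℂ) ^ k * (polyEval (Q k) y - taylorTerm G k y)
          = (G (t • y) - ∑ k ∈ Finset.range (K + 1), taylorTerm G k (t • y))
            - (G (t • y) - ∑ k ∈ Finset.range (K + 1), polyEval (Q k) (t • y)) := by
        rw [sub_sub_sub_cancel_left, ← Finset.sum_sub_distrib]
        refine Finset.sum_congr rfl fun k _ => ?_
        rw [polyEval_smul (hQ k) t y, taylorTerm_smul G k t y, Complex.real_smul]; push_cast; ring
      rw [e, add_mul]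
      exact (norm_sub_le _ _).trans (by linarith)
  exact Finset.sum_congr rfl hy

theorem nearBound_of_flat {G : Rn n → ℂ} (hG : ContDiff ℝ ∞ G) {K : ℕ}
    (h : ∀ j < K, iteratedFDeriv ℝ j G 0 = 0) : NearBound K G := by
  refine (nearBound_sub_taylor hG K).congr fun x _ => ?_
  rw [Finset.sum_eq_zero, sub_zero]
  intro k hk
  rw [taylorTerm, h k (Finset.mem_range.1 hk)]; simp

end TaylorNear


/-! ### Functions that are smooth in polar coordinates up to the origin -/

section Polar

theorem contDiffOn_iteratedFDeriv_param {P E F : Type*} [NormedAddCommGroup P] [NormedSpace ℝ P]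
    [NormedAddCommGroup E] [NormedSpace ℝ E] [NormedAddCommGroup F] [NormedSpace ℝ F]
    {Ω : Set E} (hΩ : IsOpen Ω) {W : P → E → F}
    (hW : ContDiffOn ℝ ∞ (fun q : P × E => W q.1 q.2) (univ ×ˢ Ω)) (k : ℕ) :
    ContDiffOn ℝ ∞ (fun q : P × E => iteratedFDeriv ℝ k (W q.1) q.2) (univ ×ˢ Ω) := by
  have hΩ' : IsOpen ((univ : Set P) ×ˢ Ω) := isOpen_univ.prod hΩ
  induction k with
  | zero =>
    simp only [iteratedFDeriv_zero_eq_comp, Function.comp_def]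
    exact (continuousMultilinearCurryFin0 ℝ E F).symm.contDiff.comp_contDiffOn hW
  | succ k ih =>
    simp only [iteratedFDeriv_succ_eq_comp_left, Function.comp_def]
    have hL : ContDiff ℝ ∞ (continuousMultilinearCurryLeftEquiv ℝ (fun _ : Fin (k + 1) =>
        E) F).symm :=
      LinearIsometryEquiv.contDiff (𝕜 := ℝ) (E := E →L[ℝ] (E [×k]→L[ℝ] F))
        (F := E [×(k + 1)]→L[ℝ] F) _
    refine hL.comp_contDiffOn fun q hq => ?_
    refine ContDiffAt.contDiffWithinAt ?_
    refine ContDiffAt.fderiv (f := fun (q : P × E) y => iteratedFDeriv ℝ k (W q.1) y)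
      (g := fun q => q.2) (n := ∞) ?_ contDiffAt_snd (by simp)
    have h1 := ih.contDiffAt (hΩ'.mem_nhds hq)
    exact ContDiffAt.comp (f := fun r : (P × E) × E => (r.1.1, r.2)) (q, q.2) h1
      (contDiffAt_fst.fst.prodMk contDiffAt_snd)

variable {n : ℕ}

theorem isOpen_univ_prod_off : IsOpen ((univ : Set ℝ) ×ˢ ({0}ᶜ : Set (Rn n))) :=
  isOpen_univ.prod isOpen_compl_zero

/-- `u(ρ² y)` extends to a smooth function of `ρ ∈ ℝ` and `y ≠ 0`. -/
def Pol (u : Rn n → ℂ) : Prop :=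
  ∃ W : ℝ × Rn n → ℂ, ContDiffOn ℝ ∞ W (univ ×ˢ {0}ᶜ) ∧
    ∀ ρ : ℝ, ρ ≠ 0 → ∀ y : Rn n, y ≠ 0 → u (ρ ^ 2 • y) = W (ρ, y)

/-- Substituting `r = ρ² |y|` removes the boundary `r = 0`: all real `ρ` land in `[0, ∞)`, so the
composite is smooth on an open set. -/
theorem IsSmoothPolar.pol {F : ℝ → Rn n → ℂ} (hF : IsSmoothPolar F) :
    Pol fun x => F ‖x‖ (‖x‖⁻¹ • x) := by
  refine ⟨fun q => F (q.1 ^ 2 * ‖q.2‖) (‖q.2‖⁻¹ • q.2), ?_, fun ρ hρ y hy => ?_⟩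
  · have h : ContDiffOn ℝ ∞ (fun q : ℝ × Rn n => (q.1 ^ 2 * ‖q.2‖, q.2)) (univ ×ˢ {0}ᶜ) := by
      refine ContDiffOn.prodMk (ContDiffOn.mul (by fun_prop) ?_) (by fun_prop)
      exact contDiffOn_norm_off.comp (f := fun q : ℝ × Rn n => q.2) (by fun_prop) fun q hq => hq.2
    exact hF.comp h fun q hq => ⟨by simp only [mem_Ici]; positivity, hq.2⟩
  · have h2 : 0 < ρ ^ 2 := by positivity
    have e : ‖ρ ^ 2 • y‖ = ρ ^ 2 * ‖y‖ := by rw [norm_smul, Real.norm_of_nonneg h2.le]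
    simp only [e]
    rw [mul_inv, mul_comm (ρ ^ 2)⁻¹, mul_smul, inv_smul_smul₀ h2.ne']

theorem Pol.contDiffOn {u : Rn n → ℂ} (hu : Pol u) : ContDiffOn ℝ ∞ u {0}ᶜ := by
  obtain ⟨W, hW, hWu⟩ := hu
  have : ContDiffOn ℝ ∞ (fun y : Rn n => W (1, y)) {0}ᶜ :=
    hW.comp (f := fun y : Rn n => ((1 : ℝ), y)) (by fun_prop) fun y hy => ⟨mem_univ _, hy⟩
  exact this.congr fun y hy => by rw [← hWu 1 one_ne_zero y hy, one_pow, one_smul]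

/-- Near the unit sphere `u(ρ ·)` is `W(√ρ, ·)`, whose derivatives in `y` are bounded on the compact
set `[0, 1] × S^(n-1)`, uniformly down to `ρ = 0`. -/
theorem Pol.nearBound {u : Rn n → ℂ} (hu : Pol u) : NearBound 0 u := by
  refine pbound_of_scaling hu.contDiffOn fun k => ?_
  obtain ⟨W, hW, hWu⟩ := hu
  have hc := (contDiffOn_iteratedFDeriv_param (W := fun ρ y => W (ρ, y)) isOpen_compl_zero hW
    k).continuousOn
  obtain ⟨C, hC⟩ := ((isCompact_Icc (a := (0 : ℝ)) (b := 1)).prod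
    (isCompact_sphere (0 : Rn n) 1)).exists_bound_of_continuousOn
    (hc.mono (prod_mono (subset_univ _) fun y hy => by
      rintro rfl; simp at hy))
  refine ⟨C, fun ρ hρ y hy hA => ?_⟩
  have hy0 : y ≠ 0 := by rintro rfl; simp at hy
  have hρ1 : ρ ≤ 1 := by
    simpa [norm_smul, hy, abs_of_pos hρ] using hA
  rw [rpow_zero, mul_one, iteratedFDeriv_congr_off (v := fun y => W (√ρ, y)) (fun x hx => by
    rw [← hWu _ (Real.sqrt_pos.2 hρ).ne' x hx, Real.sq_sqrt hρ.le]) hy0]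
  exact hC (√ρ, y) ⟨⟨Real.sqrt_nonneg _, Real.sqrt_le_one.2 hρ1⟩, by simpa using hy⟩

theorem hadamard_param {W : ℝ × Rn n → ℂ} (hW : ContDiffOn ℝ ∞ W (univ ×ˢ {0}ᶜ)) :
    ∃ W₁ : ℝ × Rn n → ℂ, ContDiffOn ℝ ∞ W₁ (univ ×ˢ {0}ᶜ) ∧
      ∀ ρ : ℝ, ∀ y : Rn n, y ≠ 0 → W (ρ, y) = W (0, y) + ρ * W₁ (ρ, y) := by
  have hD : ContDiffOn ℝ ∞ (fun q => fderiv ℝ W q (1, 0)) (univ ×ˢ {0}ᶜ) :=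
    (hW.fderiv_of_isOpen isOpen_univ_prod_off (by simp)).clm_apply contDiffOn_const
  have hJ : ContDiffOn ℝ ∞ (fun r : ℝ × (ℝ × Rn n) => fderiv ℝ W (r.1 * r.2.1, r.2.2) (1, 0))
      (univ ×ˢ (univ ×ˢ {0}ᶜ)) :=
    hD.comp (f := fun r : ℝ × (ℝ × Rn n) => (r.1 * r.2.1, r.2.2)) (by fun_prop)
      fun r hr => ⟨mem_univ _, hr.2.2⟩
  refine ⟨fun q => ∫ τ in Ioc (0 : ℝ) 1, (1 : ℝ) • fderiv ℝ W (τ * q.1, q.2) (1, 0), ?_,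
    fun ρ y hy => ?_⟩
  · refine contDiffOn_integral_Ioc (w := fun _ => 1)
      (Ψ := fun τ q => fderiv ℝ W (τ * q.1, q.2) (1, 0)) isOpen_univ_prod_off
      (integrableOn_const (by simp)) (fun τ _ => ?_) fun k => ?_
    · exact hJ.comp (f := fun q : ℝ × Rn n => (τ, q)) (by fun_prop) fun q hq => ⟨mem_univ _, hq⟩
    · exact (contDiffOn_iteratedFDeriv_param
        (W := fun τ (q : ℝ × Rn n) => fderiv ℝ W (τ * q.1, q.2) (1, 0)) isOpen_univ_prod_off hJ k).continuousOn.mono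
        (prod_mono_left (subset_univ _))
  · have hd : ∀ τ : ℝ, HasDerivAt (fun τ : ℝ => W (τ * ρ, y))
        ((ρ : ℂ) * fderiv ℝ W (τ * ρ, y) (1, 0)) τ := by
      intro τ
      have h1 : HasFDerivAt W (fderiv ℝ W (τ * ρ, y)) (τ * ρ, y) :=
        ((hW.contDiffAt (isOpen_univ_prod_off.mem_nhds
          (show (τ * ρ, y) ∈ univ ×ˢ {0}ᶜ from ⟨mem_univ _, hy⟩))).differentiableAt
          (by simp)).hasFDerivAt
      have h2 : HasDerivAt (fun τ : ℝ => (τ * ρ, y)) (ρ, 0) τ := by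
        simpa using ((hasDerivAt_id τ).mul_const ρ).prodMk (hasDerivAt_const τ y)
      have h3 := h1.comp_hasDerivAt τ h2
      have e : ((ρ, 0) : ℝ × Rn n) = ρ • ((1 : ℝ), (0 : Rn n)) := by simp
      rw [e, map_smul, Complex.real_smul] at h3
      exact h3
    have hcont : Continuous fun τ : ℝ => fderiv ℝ W (τ * ρ, y) (1, 0) := by
      rw [← continuousOn_univ]
      exact hD.continuousOn.comp (f := fun τ : ℝ => (τ * ρ, y)) (by fun_prop)
        fun τ _ => ⟨mem_univ _, hy⟩
    have h := intervalIntegral.integral_eq_sub_of_hasDerivAt (a := 0) (b := 1)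
      (fun τ _ => hd τ) ((continuous_const.mul hcont).intervalIntegrable _ _)
    rw [intervalIntegral.integral_const_mul, intervalIntegral.integral_of_le zero_le_one] at h
    simp only [one_smul]
    rw [h]; simp

theorem tendsto_param_zero {W : ℝ × Rn n → ℂ} (hW : ContDiffOn ℝ ∞ W (univ ×ˢ {0}ᶜ)) {y : Rn n}
    (hy : y ≠ 0) (c : ℝ) : Tendsto (fun ρ : ℝ => W (ρ * c, y)) (𝓝[≠] 0) (𝓝 (W (0, y))) := by
  have h : Continuous fun ρ : ℝ => W (ρ * c, y) := by
    rw [← continuousOn_univ]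
    exact hW.continuousOn.comp (f := fun ρ : ℝ => (ρ * c, y)) (by fun_prop)
      fun τ _ => ⟨mem_univ _, hy⟩
  simpa using (h.tendsto 0).mono_left nhdsWithin_le_nhds

/-- `W` is even in `ρ`, so its linear coefficient vanishes and `W = W(0, y) + ρ² W₂`; the factor
`ρ²` is proportional to `|x|`. `W(0, y)` is a limit along the ray of `y`, hence homogeneous of
degree `0`. -/
theorem Pol.step {u : Rn n → ℂ} (hu : Pol u) : ∃ w u₁ : Rn n → ℂ, HomFun 0 w ∧ Pol u₁ ∧
    ∀ x, x ≠ 0 → u x = w x + ‖x‖ * u₁ x := by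
  obtain ⟨W, hW, hWu⟩ := hu
  obtain ⟨W₁, hW₁, h₁⟩ := hadamard_param hW
  obtain ⟨W₂, hW₂, h₂⟩ := hadamard_param hW₁
  have hz : ∀ y : Rn n, y ≠ 0 → W₁ (0, y) = 0 := by
    intro y hy
    have t1 := tendsto_param_zero hW₁ hy 1
    have t2 := (tendsto_param_zero hW₁ hy (-1)).neg
    have : W₁ (0, y) = - W₁ (0, y) := by
      refine tendsto_nhds_unique_of_eventuallyEq t1 t2 ?_
      filter_upwards [self_mem_nhdsWithin] with ρ hρ
      have hρ : ρ ≠ 0 := hρ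
      have e : W (ρ, y) = W (-ρ, y) := by
        rw [← hWu ρ hρ y hy, ← hWu (-ρ) (neg_ne_zero.2 hρ) y hy, neg_sq]
      rw [h₁ ρ y hy, h₁ (-ρ) y hy, add_left_cancel_iff] at e
      have hρ' : (ρ : ℂ) ≠ 0 := by exact_mod_cast hρ
      rw [mul_one, mul_neg, mul_one]
      refine mul_left_cancel₀ hρ' ?_
      rw [e]; push_cast; ring
    simpa [eq_neg_iff_add_eq_zero, ← two_mul] using this
  have hw : ∀ t : ℝ, 0 < t → ∀ y : Rn n, y ≠ 0 → W (0, t • y) = W (0, y) := by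
    intro t ht y hy
    have hty : t • y ≠ 0 := smul_ne_zero ht.ne' hy
    refine tendsto_nhds_unique_of_eventuallyEq (tendsto_param_zero hW hty 1)
      (tendsto_param_zero hW hy (√t)) ?_
    filter_upwards [self_mem_nhdsWithin] with ρ hρ
    have hρ : ρ ≠ 0 := hρ
    rw [mul_one, ← hWu ρ hρ _ hty, ← hWu (ρ * √t) (mul_ne_zero hρ (Real.sqrt_pos.2 ht).ne') y hy,
      mul_pow, Real.sq_sqrt ht.le, mul_smul]
  refine ⟨fun y => W (0, y), fun x => (u x - W (0, x)) / ‖x‖, ⟨?_, fun t ht y hy => ?_⟩,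
    ⟨fun q => W₂ q / (‖q.2‖ : ℂ), ?_, fun ρ hρ y hy => ?_⟩, fun x hx => ?_⟩
  · exact hW.comp (f := fun y : Rn n => ((0 : ℝ), y)) (by fun_prop) fun y hy => ⟨mem_univ _, hy⟩
  · simp [hw t ht y hy]
  · have hinv : ContDiffOn ℝ ∞ (fun q : ℝ × Rn n => ((‖q.2‖ : ℂ))⁻¹) (univ ×ˢ {0}ᶜ) := by
      refine ContDiffOn.inv ?_ fun q hq => by simpa using hq.2
      refine Complex.ofRealCLM.contDiff.comp_contDiffOn ?_
      exact contDiffOn_norm_off.comp (f := fun q : ℝ × Rn n => q.2) (by fun_prop) fun q hq => hq.2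
    simpa only [div_eq_mul_inv] using hW₂.mul hinv
  · have h2 : 0 < ρ ^ 2 := by positivity
    have hy' : (‖y‖ : ℂ) ≠ 0 := by simpa using hy
    have hρ' : (ρ : ℂ) ≠ 0 := by exact_mod_cast hρ
    simp only
    rw [hWu ρ hρ y hy, hw _ h2 y hy, h₁ ρ y hy, h₂ ρ y hy, hz y hy, norm_smul,
      Real.norm_of_nonneg h2.le]
    push_cast
    field_simp
    ring
  · have hx' : (‖x‖ : ℂ) ≠ 0 := by simpa using hx
    field_simp
    ring

theorem Pol.exists_expansion {u : Rn n → ℂ} (hu : Pol u) : ∃ w : ℕ → Rn n → ℂ,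
    (∀ j, HomFun 0 (w j)) ∧ ∀ N : ℕ, ∃ v : Rn n → ℂ, Pol v ∧ ∀ x, x ≠ 0 →
      u x = ∑ j ∈ Finset.range N, (‖x‖ : ℂ) ^ j * w j x + (‖x‖ : ℂ) ^ N * v x := by
  choose w v hw hv hwv using fun u : {u : Rn n → ℂ // Pol u} => u.2.step
  let V : ℕ → {u : Rn n → ℂ // Pol u} := fun N => (fun u => ⟨v u, hv u⟩)^[N] ⟨u, hu⟩
  refine ⟨fun j => w (V j), fun j => hw _, fun N => ⟨V N, (V N).2, fun x hx => ?_⟩⟩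
  induction N with
  | zero => simp [V]
  | succ N ih =>
    have e : (V (N + 1) : Rn n → ℂ) = v (V N) := by
      simp only [V, Function.iterate_succ_apply']
    rw [ih, hwv (V N) x hx, Finset.sum_range_succ, e]
    ring

end Polar


/-! ### Borel summation -/

section Scales

variable {E : Type*} [NormedAddCommGroup E] [NormedSpace ℝ E]

/-- `k` derivatives cost at most `l^k` while the prefactor gains `l^(-a)`, so `k < a` leaves at
least `1/l`. A general `A` allows dilation of one variable only. -/
theorem exists_scaled_bound {Z : E → ℂ} (hZ : ContDiff ℝ ∞ Z) (hc : HasCompactSupport Z)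
    {A : ℝ → E →L[ℝ] E} (hA : ∀ l : ℝ, 1 ≤ l → ‖A l‖ ≤ l) {a k : ℕ} (hk : k < a) :
    ∃ C : ℝ, ∀ l : ℝ, 1 ≤ l → ∀ x,
      ‖iteratedFDeriv ℝ k (fun x => (l⁻¹ ^ a) • Z (A l x)) x‖ ≤ C / l := by
  obtain ⟨C, hC⟩ := (hZ.continuous_iteratedFDeriv (m := k)
    (by exact_mod_cast le_top)).bounded_above_of_compact_support (hc.iteratedFDeriv k)
  have hC0 : 0 ≤ C := (norm_nonneg _).trans (hC 0)
  refine ⟨C, fun l hl x => ?_⟩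
  have hl0 : 0 < l := by linarith
  have hZk : ContDiff ℝ k Z := hZ.of_le (by exact_mod_cast le_top)
  have e : iteratedFDeriv ℝ k (fun x => (l⁻¹ ^ a) • Z (A l x)) x
      = (l⁻¹ ^ a) • iteratedFDeriv ℝ k (Z ∘ A l) x := by
    have h : ContDiffAt ℝ k (Z ∘ A l) x := (hZk.comp (A l).contDiff).contDiffAt
    have e : (fun x => (l⁻¹ ^ a) • Z (A l x)) = (l⁻¹ ^ a) • (Z ∘ A l) := rfl
    rw [e, iteratedFDeriv_const_smul_apply h]
  rw [e, (A l).iteratedFDeriv_comp_right hZk x le_rfl, norm_smul,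
    Real.norm_of_nonneg (by positivity)]
  have h1 := ContinuousMultilinearMap.norm_compContinuousLinearMap_le
    (iteratedFDeriv ℝ k Z (A l x)) (fun _ : Fin k => A l)
  rw [Finset.prod_const, Finset.card_univ, Fintype.card_fin] at h1
  have h2 : ‖iteratedFDeriv ℝ k Z (A l x)‖ * ‖A l‖ ^ k ≤ C * l ^ k := by
    gcongr
    · exact hC _
    · exact hA l hl
  have h3 : l⁻¹ ^ a * l ^ k ≤ l⁻¹ := by
    rw [inv_pow, ← div_eq_inv_mul, div_le_iff₀ (by positivity)]
    calc l ^ k ≤ l ^ (a - 1) := pow_le_pow_right₀ hl (by omega)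
      _ = l⁻¹ * l ^ (a - 1 + 1) := by rw [pow_succ]; field_simp
      _ = l⁻¹ * l ^ a := by rw [Nat.sub_add_cancel (by omega)]
  calc l⁻¹ ^ a * _ ≤ l⁻¹ ^ a * (C * l ^ k) :=
        mul_le_mul_of_nonneg_left (h1.trans h2) (by positivity)
    _ = C * (l⁻¹ ^ a * l ^ k) := by ring
    _ ≤ C * l⁻¹ := mul_le_mul_of_nonneg_left h3 hC0
    _ = C / l := rfl

/-- For fixed `j` only finitely many pairs `(N, k)` satisfy `N + k < j`, so a single scale `l j`
meets all the demands. -/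
theorem exists_fast_scales {g : ℕ → ℕ → ℝ → E → ℂ} (h : ∀ N j k, N + k < j → ∃ C : ℝ, ∀ l : ℝ,
      1 ≤ l → ∀ x, ‖iteratedFDeriv ℝ k (g N j l) x‖ ≤ C / l) :
    ∃ l : ℕ → ℝ, (∀ j, 1 ≤ l j) ∧ ∀ N j k, N + k < j → ∀ x,
      ‖iteratedFDeriv ℝ k (g N j (l j)) x‖ ≤ (1 / 2) ^ j := by
  choose C hC using fun N j k => Classical.skolem.1 fun h' => h N j k h'
  let S : ℕ → ℝ := fun j => ∑ N ∈ Finset.range j, ∑ k ∈ Finset.range j,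
    if h' : N + k < j then |C N j k h'| else 0
  have hS : ∀ N j k (h' : N + k < j), C N j k h' ≤ S j := by
    intro N j k h'
    have h0 : ∀ N k, 0 ≤ (if h' : N + k < j then |C N j k h'| else 0) := fun N k => by
      split_ifs
      · exact abs_nonneg _
      · exact le_rfl
    calc C N j k h' ≤ (if h' : N + k < j then |C N j k h'| else 0) := by
          rw [dif_pos h']; exact le_abs_self _
      _ ≤ ∑ k ∈ Finset.range j, if h' : N + k < j then |C N j k h'| else 0 :=
          Finset.single_le_sum (f := fun k => if h' : N + k < j then |C N j k h'| else 0)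
            (fun k _ => h0 N k) (Finset.mem_range.2 (by omega))
      _ ≤ S j := Finset.single_le_sum
            (f := fun N => ∑ k ∈ Finset.range j, if h' : N + k < j then |C N j k h'| else 0)
            (fun N _ => Finset.sum_nonneg fun k _ => h0 N k) (Finset.mem_range.2 (by omega))
  refine ⟨fun j => max 1 (2 ^ j * S j), fun j => le_max_left _ _, fun N j k h' x => ?_⟩
  refine (hC N j k h' _ (le_max_left _ _) x).trans ?_
  have hp : (0 : ℝ) < max 1 (2 ^ j * S j) := lt_of_lt_of_le one_pos (le_max_left _ _)
  rw [div_le_iff₀ hp]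
  calc C N j k h' ≤ S j := hS N j k h'
    _ = (1 / 2) ^ j * (2 ^ j * S j) := by rw [← mul_assoc, ← mul_pow]; norm_num
    _ ≤ _ := by gcongr; exact le_max_right _ _

/-- For each order `k` the bound fails for at most the first `k + 1` terms, which do not affect
convergence. -/
theorem contDiff_tsum_of_fast {f : ℕ → E → ℂ} (hf : ∀ i, ContDiff ℝ ∞ (f i))
    (h : ∀ k i, k < i → ∀ x, ‖iteratedFDeriv ℝ k (f i) x‖ ≤ (1 / 2) ^ i) :
    ContDiff ℝ ∞ (fun x => ∑' i, f i x) ∧ ∀ x, Summable fun i => f i x := by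
  have hs : Summable fun i : ℕ => ((1 : ℝ) / 2) ^ i := summable_geometric_two
  have hev : ∀ k : ℕ, ∀ᶠ i in (Filter.cofinite : Filter ℕ), k < i := fun k => by
    rw [Nat.cofinite_eq_atTop]; exact eventually_gt_atTop k
  refine ⟨contDiff_tsum_of_eventually (v := fun _ i => (1 / 2) ^ i) hf (fun _ _ => hs)
    fun k _ => (hev k).mono fun i hi x => h k i hi x, fun x => ?_⟩
  refine Summable.of_norm_bounded_eventually hs ((hev 0).mono fun i hi => ?_)
  simpa using h 0 i hi x

end Scales

/-! ### Borel sums of homogeneous terms -/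

section Borel

variable {n : ℕ} {s : ℝ}

theorem step_of_one_le_abs {r : ℝ} (h : 1 ≤ |r|) : step r = 1 := by
  rw [← step_of_one_le h, step, step, sq_abs]

/-- Dilation of the first variable. -/
def dilFst (l : ℝ) : ℝ × Rn n →L[ℝ] ℝ × Rn n :=
  (l • ContinuousLinearMap.id ℝ ℝ).prodMap (ContinuousLinearMap.id ℝ (Rn n))

theorem dilFst_apply (l : ℝ) (q : ℝ × Rn n) : dilFst l q = (l * q.1, q.2) := rfl

/-- The function vanishes identically near the origin. Hence cutting a term off, at any scale, does
not affect its expansion. -/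
theorem nearBound_bump_smul_sub_one (l : ℝ) (K : ℕ) :
    NearBound K fun x : Rn n => (bump (l • x) : ℂ) - 1 := by
  have hG : ContDiff ℝ ∞ fun x : Rn n => (bump (l • x) : ℂ) - 1 :=
    (contDiff_bump_complex.comp (contDiff_const_smul l)).sub contDiff_const
  refine nearBound_of_flat hG fun j _ => ?_
  have h : (fun x : Rn n => (bump (l • x) : ℂ) - 1) =ᶠ[𝓝 0] fun _ => 0 := by
    have ht : Tendsto (fun x : Rn n => l • x) (𝓝 0) (𝓝 0) := by
      simpa using (continuous_const_smul l).tendsto (0 : Rn n)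
    filter_upwards [ht.eventually eventually_patch_eq_zero] with x hx
    simp [bump, hx]
  rw [(h.iteratedFDeriv ℝ j).eq_of_nhds]
  simp

/-- The continuous derivative tends to zero through points `x ≠ 0`; these accumulate at the origin
because `n ≥ 1`. -/
theorem iteratedFDeriv_eq_zero_of_nearBound (hn : 1 ≤ n) {G : Rn n → ℂ} (hG : ContDiff ℝ ∞ G)
    {σ : ℝ} (h : NearBound σ G) {j : ℕ} (hj : (j : ℝ) < σ) : iteratedFDeriv ℝ j G 0 = 0 := by
  have : Nonempty (Fin n) := ⟨⟨0, hn⟩⟩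
  obtain ⟨C, hC⟩ := h.2 j
  have h1 : Tendsto (iteratedFDeriv ℝ j G) (𝓝[≠] 0) (𝓝 (iteratedFDeriv ℝ j G 0)) :=
    ((hG.continuous_iteratedFDeriv (m := j) (by exact_mod_cast le_top)).tendsto 0).mono_left
      nhdsWithin_le_nhds
  refine tendsto_nhds_unique h1 (squeeze_zero_norm' (a := fun x => C * ‖x‖ ^ (σ - j)) ?_ ?_)
  · filter_upwards [self_mem_nhdsWithin, mem_nhdsWithin_of_mem_nhds
      (Metric.closedBall_mem_nhds (0 : Rn n) one_pos)] with x hx hx1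
    exact hC x (by simpa using hx1) hx
  · have : Continuous fun x : Rn n => C * ‖x‖ ^ (σ - j) :=
      continuous_const.mul (continuous_norm.rpow_const fun _ => Or.inr (by linarith))
    have := (this.tendsto 0).mono_left (nhdsWithin_le_nhds (s := {0}ᶜ))
    rwa [norm_zero, zero_rpow (by linarith), mul_zero] at this

theorem exists_smooth_sum (hn : 1 ≤ n) {R : ℕ → MvPolynomial (Fin n) ℂ}
    (hR : ∀ d, (R d).IsHomogeneous d) : ∃ G : Rn n → ℂ, ContDiff ℝ ∞ G ∧
      (∀ x, 1 ≤ ‖x‖ → G x = 0) ∧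
      ∀ K : ℕ, NearBound K fun x => G x - ∑ d ∈ Finset.range K, polyEval (R d) x := by
  let g : ℕ → ℝ → Rn n → ℂ := fun d l x => (bump (l • x) : ℂ) * polyEval (R d) x
  have hbd : ∀ l : ℝ, ContDiff ℝ ∞ fun x : Rn n => (bump (l • x) : ℂ) := fun l =>
    contDiff_bump_complex.comp (contDiff_const_smul l)
  have hg : ∀ d l, ContDiff ℝ ∞ (g d l) := fun d l => (hbd l).mul (contDiff_polyEval _)
  have hnear : ∀ (d : ℕ) (l : ℝ), NearBound (d : ℝ) (g d l) := fun d l => by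
    have := (nearBound_of_contDiff (hbd l)).mul
      ((show PolyHom (d : ℝ) (R d) from Or.inr ⟨d, rfl, hR d⟩).homFun.pbound {x : Rn n | ‖x‖ ≤ 1})
    rwa [zero_add] at this
  -- By homogeneity `bump(l x) R_j(x)` is `l^(-j)` times the dilate by `l` of `bump * R_j`. The
  -- index `N` plays no role here.
  obtain ⟨l, hl1, hl⟩ := exists_fast_scales (g := fun _ => g) (fun N j k hk => by
    obtain ⟨C, hC⟩ := exists_scaled_bound (Z := fun x => (bump x : ℂ) * polyEval (R j) x)
      (contDiff_bump_complex.mul (contDiff_polyEval _))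
      (hasCompactSupport_of_one_le fun x hx => by simp [bump_of_one_le hx])
      (A := fun l => l • ContinuousLinearMap.id ℝ (Rn n)) (fun l hl => by
        rw [norm_smul, Real.norm_of_nonneg (by linarith)]
        exact mul_le_of_le_one_right (by linarith) ContinuousLinearMap.norm_id_le)
      (show k < j by omega)
    refine ⟨C, fun l hl x => ?_⟩
    convert hC l hl x using 4 with x
    have hl0 : (l : ℂ) ≠ 0 := by exact_mod_cast (by linarith : l ≠ 0)
    simp only [g, _root_.smul_apply, ContinuousLinearMap.id_apply]
    rw [polyEval_smul (hR j), Complex.real_smul]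
    push_cast
    rw [inv_pow, mul_left_comm (bump (l • x) : ℂ), ← mul_assoc, inv_mul_cancel₀ (pow_ne_zero j hl0),
      one_mul])
  have hl' : ∀ j k, k < j → ∀ x, ‖iteratedFDeriv ℝ k (g j (l j)) x‖ ≤ (1 / 2) ^ j := fun j k hk =>
    hl 0 j k (by omega)
  obtain ⟨hG, hGs⟩ := contDiff_tsum_of_fast (f := fun d => g d (l d)) (fun d => hg d _)
    fun k i hk x => hl' i k hk x
  refine ⟨_, hG, fun x hx => ?_, fun K => ?_⟩
  · have : ∀ d, g d (l d) x = 0 := fun d => by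
      have : 1 ≤ ‖l d • x‖ := by
        rw [norm_smul, Real.norm_of_nonneg (by linarith [hl1 d])]
        exact one_le_mul_of_one_le_of_one_le (hl1 d) hx
      simp [g, bump_of_one_le this]
    simp [this]
  -- The sum starts at `K + 1`, since the scales control derivatives up to order `K` only from there
  -- on. The term of index `K` is split off and has order `K` by itself.
  · let T : Rn n → ℂ := fun x => ∑' i, g (i + (K + 1)) (l (i + (K + 1))) x
    have hsh : ∀ k i : ℕ, k < K + 1 + i → ∀ x,
        ‖iteratedFDeriv ℝ k (g (i + (K + 1)) (l (i + (K + 1)))) x‖ ≤ (1 / 2) ^ i := fun k i hk x =>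
      (hl' _ k (by omega) x).trans
        (pow_le_pow_of_le_one (by norm_num) (by norm_num) (Nat.le_add_right _ _))
    have hT : ContDiff ℝ ∞ T := (contDiff_tsum_of_fast
      (f := fun i => g (i + (K + 1)) (l (i + (K + 1)))) (fun d => hg _ _)
      fun k i hk x => hsh k i (by omega) x).1
    have hTn : NearBound K T := by
      refine nearBound_of_flat hT fun j hj => ?_
      have := iteratedFDeriv_tsum_apply (𝕜 := ℝ) (N := K) (v := fun _ i => (1 / 2 : ℝ) ^ i)
        (f := fun i => g (i + (K + 1)) (l (i + (K + 1))))
        (fun i => (hg _ _).of_le (by exact_mod_cast le_top)) (fun _ _ => summable_geometric_two)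
        (fun k i x hk => hsh k i (by have : k ≤ K := by exact_mod_cast hk
                                     omega) x) (k := j) (by exact_mod_cast hj.le) 0
      rw [show T = fun x => ∑' i, g (i + (K + 1)) (l (i + (K + 1))) x from rfl, this]
      have h0 : ∀ i, iteratedFDeriv ℝ j (g (i + (K + 1)) (l (i + (K + 1)))) 0 = 0 := fun i =>
        iteratedFDeriv_eq_zero_of_nearBound hn (hg _ _) (hnear _ _) (by
          exact_mod_cast (by omega : j < i + (K + 1)))
      simp [h0]
    have h1 : ∀ d ∈ Finset.range K, NearBound (K : ℝ) fun x : Rn n =>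
        ((bump (l d • x) : ℂ) - 1) * polyEval (R d) x := fun d _ =>
      NearBound.mono ((nearBound_bump_smul_sub_one (l d) K).mul
        ((show PolyHom (d : ℝ) (R d) from Or.inr ⟨d, rfl, hR d⟩).homFun.pbound _))
        (by linarith [Nat.cast_nonneg (α := ℝ) d])
    refine (((PBound.sum h1).add (hnear K (l K))).add hTn).congr fun x _ => ?_
    rw [← (hGs x).sum_add_tsum_nat_add (K + 1), Finset.sum_range_succ]
    simp only [T, g, sub_mul, one_mul, Finset.sum_sub_distrib]
    ring

/-- Borel summation in the radius: `F` is the sum of `r^j f_j(ζ)`, each cut off at `r ≤ 1 / l_j`.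
Since `r^N` can be taken out of the terms with `j ≥ N` and the quotient series is still smooth, the
remainder is `r^(s+N)` times a function smooth in polar coordinates. -/
theorem exists_polar_sum {f : ℕ → Rn n → ℂ} (hf : ∀ j : ℕ, HomFun (s + j) (f j)) :
    ∃ F : ℝ → Rn n → ℂ, IsSmoothPolar F ∧ (∀ r ζ, 1 ≤ r → ‖ζ‖ = 1 → F r ζ = 0) ∧
      ∀ N : ℕ, NearBound (s + N) fun x => ((‖x‖ ^ s : ℝ) : ℂ) * F ‖x‖ (‖x‖⁻¹ • x)
        - ∑ j ∈ Finset.range N, f j x := by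
  -- A compactly supported smooth function that agrees with `f j` on the unit sphere, so that the
  -- series lives on all of `ℝ × ℝⁿ`.
  let e : ℕ → Rn n → ℂ := fun j y => (bump ((2 : ℝ)⁻¹ • y) : ℂ) * ((patch y : ℂ) * f j y)
  have he : ∀ j, ContDiff ℝ ∞ (e j) := fun j =>
    (contDiff_bump_complex.comp (contDiff_const_smul _)).mul (contDiff_patch_mul (hf j).1)
  have he0 : ∀ j y, 2 ≤ ‖y‖ → e j y = 0 := fun j y hy => by
    have : 1 ≤ ‖(2 : ℝ)⁻¹ • y‖ := by
      rw [norm_smul, Real.norm_of_nonneg (by norm_num)]; linarith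
    simp [e, bump_of_one_le this]
  have he1 : ∀ j y, ‖y‖ = 1 → e j y = f j y := fun j y hy => by
    have : ‖(2 : ℝ)⁻¹ • y‖ ≤ 1 / 2 := by
      rw [norm_smul, Real.norm_of_nonneg (by norm_num)]; linarith
    simp [e, bump_of_le_half this, patch_of_one_le hy.ge]
  -- The `j`-th term divided by `r^N`. The truncated subtraction `j - N` is harmless, as only `j ≥
  -- N` is used.
  let g : ℕ → ℕ → ℝ → ℝ × Rn n → ℂ := fun N j l q =>
    ((1 - step (l * q.1) : ℝ) : ℂ) * (q.1 : ℂ) ^ (j - N) * e j q.2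
  have hX : ContDiff ℝ ∞ fun q : ℝ × Rn n => ((1 - step q.1 : ℝ) : ℂ) :=
    Complex.ofRealCLM.contDiff.comp (contDiff_const.sub (contDiff_step.comp contDiff_fst))
  have hr : ∀ a : ℕ, ContDiff ℝ ∞ fun q : ℝ × Rn n => (q.1 : ℂ) ^ a := fun a =>
    (Complex.ofRealCLM.contDiff.comp contDiff_fst).pow a
  have hZ : ∀ a j, ContDiff ℝ ∞ fun q : ℝ × Rn n =>
      ((1 - step q.1 : ℝ) : ℂ) * (q.1 : ℂ) ^ a * e j q.2 := fun a j =>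
    (hX.mul (hr a)).mul ((he j).comp contDiff_snd)
  have hg : ∀ N j l, ContDiff ℝ ∞ (g N j l) := fun N j l =>
    ((hX.comp (g := fun q : ℝ × Rn n => ((1 - step q.1 : ℝ) : ℂ))
      (f := fun q : ℝ × Rn n => (l * q.1, q.2)) (by fun_prop)).mul (hr _)).mul
      ((he j).comp contDiff_snd)
  have hgA : ∀ N j (l : ℝ), 1 ≤ l → g N j l = fun q => (l⁻¹ ^ (j - N)) •
      (fun q : ℝ × Rn n => ((1 - step q.1 : ℝ) : ℂ) * (q.1 : ℂ) ^ (j - N) * e j q.2)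
        (dilFst l q) := by
    intro N j l hl
    ext q
    have hl0 : (l : ℂ) ≠ 0 := by exact_mod_cast (by linarith : l ≠ 0)
    simp only [g, dilFst_apply]
    rw [Complex.real_smul]
    push_cast
    have : (l : ℂ)⁻¹ ^ (j - N) * (l : ℂ) ^ (j - N) = 1 := by
      rw [← mul_pow, inv_mul_cancel₀ hl0, one_pow]
    rw [mul_pow]
    linear_combination (-(1 - (step (l * q.1) : ℂ)) * (q.1 : ℂ) ^ (j - N) * e j q.2) * this
  obtain ⟨l, hl1, hl⟩ := exists_fast_scales (g := g) (fun N j k hk => by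
    obtain ⟨C, hC⟩ := exists_scaled_bound (hZ (j - N) j)
      (HasCompactSupport.intro ((isCompact_closedBall (0 : ℝ) 1).prod
        (isCompact_closedBall (0 : Rn n) 2)) fun q hq => by
          rw [mem_prod, not_and_or] at hq
          rcases hq with hq | hq
          · rw [mem_closedBall_zero_iff, not_le] at hq
            simp [step_of_one_le_abs (r := q.1) hq.le]
          · rw [mem_closedBall_zero_iff, not_le] at hq
            simp [he0 j q.2 hq.le])
      (A := dilFst)
      (fun l hl => by
        refine ContinuousLinearMap.opNorm_le_bound _ (by linarith) fun q => ?_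
        simp only [dilFst_apply, Prod.norm_def]
        rw [norm_mul, Real.norm_of_nonneg (by linarith : 0 ≤ l)]
        refine max_le ?_ ?_
        · gcongr; exact le_max_left _ _
        · refine (le_max_right ‖q.1‖ ‖q.2‖).trans ?_
          exact le_mul_of_one_le_left (by positivity) hl)
      (show k < j - N by omega)
    exact ⟨C, fun l hl x => by rw [hgA N j l hl]; exact hC l hl x⟩)
  let B : ℕ → ℝ × Rn n → ℂ := fun N q => ∑' i, g N (i + N) (l (i + N)) q
  have hB : ∀ N, ContDiff ℝ ∞ (B N) ∧ ∀ q, Summable fun i => g N (i + N) (l (i + N)) q := fun N =>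
    contDiff_tsum_of_fast (f := fun i => g N (i + N) (l (i + N))) (fun i => hg _ _ _)
      fun k i hk x => (hl N (i + N) k (by omega) x).trans
        (pow_le_pow_of_le_one (by norm_num) (by norm_num) (Nat.le_add_right _ _))
  have hpol : ∀ N, IsSmoothPolar fun r y => B N (r, y) := fun N => by
    refine (hB N).1.comp_contDiffOn (f := fun q : ℝ × Rn n => (q.1, ‖q.2‖⁻¹ • q.2)) ?_
    refine contDiffOn_fst.prodMk ?_
    have h1 : ContDiffOn ℝ ∞ (fun q : ℝ × Rn n => ‖q.2‖) (Ici 0 ×ˢ {0}ᶜ) :=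
      contDiffOn_norm_off.comp (f := fun q : ℝ × Rn n => q.2) (by fun_prop) fun q hq => hq.2
    exact (h1.inv fun q hq => norm_ne_zero_iff.2 hq.2).smul contDiffOn_snd
  have hsplit : ∀ N q, B 0 q = ∑ j ∈ Finset.range N, g 0 j (l j) q + (q.1 : ℂ) ^ N * B N q := by
    intro N q
    have h := ((hB 0).2 q).sum_add_tsum_nat_add N
    simp only [Nat.add_zero] at h
    simp only [B, Nat.add_zero]
    rw [← h, ← tsum_mul_left]
    congr 2
    funext i
    simp only [g, Nat.sub_zero, Nat.add_sub_cancel, pow_add]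
    ring
  refine ⟨fun r y => B 0 (r, y), hpol 0, fun r ζ hr _ => ?_, fun N => ?_⟩
  · have : ∀ j, g 0 (j + 0) (l (j + 0)) (r, ζ) = 0 := fun j => by
      have : step (l j * r) = 1 :=
        step_of_one_le (one_le_mul_of_one_le_of_one_le (hl1 j) hr)
      simp [g, this]
    simp only [B, this, tsum_zero]
  · have h1 : ∀ j ∈ Finset.range N, NearBound (s + N) fun x : Rn n =>
        ((bump (l j • x) : ℂ) - 1) * f j x := fun j _ =>
      NearBound.mono ((nearBound_bump_smul_sub_one (l j) N).mul ((hf j).pbound _))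
        (by linarith [Nat.cast_nonneg (α := ℝ) j])
    have h2 := ((homFun_norm_rpow (n := n) (s + N)).pbound {x | ‖x‖ ≤ 1}).mul (hpol N).pol.nearBound
    rw [add_zero] at h2
    refine ((PBound.sum h1).add h2).congr fun x hx => ?_
    have hx0 : 0 < ‖x‖ := norm_pos_iff.2 hx
    have hx1 : ‖‖x‖⁻¹ • x‖ = 1 := by
      rw [norm_smul, norm_inv, norm_norm, inv_mul_cancel₀ hx0.ne']
    have hfj : ∀ j, f j x = ((‖x‖ ^ s : ℝ) : ℂ) * (‖x‖ : ℂ) ^ j * f j (‖x‖⁻¹ • x) := fun j => by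
      have := (hf j).2 ‖x‖ hx0 (‖x‖⁻¹ • x) (smul_ne_zero (inv_ne_zero hx0.ne') hx)
      rw [smul_inv_smul₀ hx0.ne', rpow_add hx0, rpow_natCast] at this
      rw [this]; push_cast; rfl
    have hbs : ∀ j, (bump (l j • x) : ℂ) = ((1 - step (l j * ‖x‖) : ℝ) : ℂ) := fun j => by
      rw [bump, patch, norm_smul, Real.norm_of_nonneg (by linarith [hl1 j])]
    beta_reduce
    rw [hsplit N, rpow_add hx0, rpow_natCast, mul_add, Finset.mul_sum]
    simp only [sub_mul, one_mul, Finset.sum_sub_distrib]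
    have : ∀ j, (bump (l j • x) : ℂ) * f j x
        = ((‖x‖ ^ s : ℝ) : ℂ) * g 0 j (l j) (‖x‖, ‖x‖⁻¹ • x) := fun j => by
      rw [hfj j, hbs j]
      simp only [g, he1 j _ hx1, Nat.sub_zero]
      ring
    simp only [this]
    push_cast
    ring

end Borel


/-! ### Asymptotic expansions on both sides of the Fourier transform -/

section Expansion

variable {n : ℕ} {m s : ℝ}

theorem exists_distFourier_eq_schwartzDist (H : 𝓢(Rn n, ℂ)) :
    ∃ S : 𝓢(Rn n, ℂ), schwartzDist H = distFourier n (schwartzDist S) := by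
  obtain ⟨S, rfl⟩ := schwartzFourier_surjective H
  exact ⟨S, (distFourier_schwartzDist S).symm⟩

theorem schwartzDist_sum {ι : Type*} (t : Finset ι) (H : ι → 𝓢(Rn n, ℂ)) :
    schwartzDist (∑ i ∈ t, H i) = ∑ i ∈ t, schwartzDist (H i) :=
  map_sum (SchwartzMap.toTemperedDistributionCLM (Rn n) ℂ volume) H t

/-- A singularity that is `O(|x|^σ)` with derivatives is the Fourier transform of a symbol. -/
theorem exists_symbol_of_nearBound (hn : 1 ≤ n) {v : Rn n → ℂ} {σ : ℝ} (hv : NearBound σ v)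
    (h1 : ∀ x, 1 ≤ ‖x‖ → v x = 0) {M : ℕ} (hM : (M : ℝ) < σ) :
    ∃ (S R : 𝓢'(Rn n, ℂ)) (e : Rn n → ℂ), IsGivenBy S v ∧ IsGivenBy R e ∧ IsSymbol (-M) e ∧
      S = distFourier n R := by
  -- The value at the origin is reset to zero, as `isSymbol_invFourier` demands; this changes `v` on
  -- a null set only.
  have hoff : ∀ x, x ≠ 0 → v x = ({0}ᶜ : Set (Rn n)).indicator v x := fun x hx =>
    (indicator_of_mem (by exact hx) _).symm
  obtain ⟨hi, hsym⟩ := isSymbol_invFourier (hv.congr hoff) (fun x hx => by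
    by_cases h : x = 0
    · simp [h]
    · rw [← hoff x h, h1 x hx]) (by simp) hM
  obtain ⟨S, hS⟩ := (moderate_of_integrable hi).exists_isGivenBy
  obtain ⟨R, hR⟩ := hsym.moderate.exists_isGivenBy
  refine ⟨S, R, _, hS.congr_ae (ae_eq_of_off hn fun x hx => (hoff x hx).symm), hR, hsym, ?_⟩
  ext ψ
  rw [distFourier_apply, (hS ψ).2, (hR _).2, integral_mul_eq_invFourier hi]

theorem nearBound_one_sub_bump (K : ℕ) : NearBound K fun x : Rn n => (bump x : ℂ) - 1 := by
  simpa using nearBound_bump_smul_sub_one (n := n) 1 K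

theorem nearBound_sub_sum_bump {V : Rn n → ℂ} {f : ℕ → Rn n → ℂ}
    (hf : ∀ j : ℕ, HomFun (s + j) (f j)) {N : ℕ}
    (hV : NearBound (s + N) fun x => V x - ∑ j ∈ Finset.range N, f j x) :
    NearBound (s + N) fun x => V x - ∑ j ∈ Finset.range N, (bump x : ℂ) * f j x := by
  have h1 : ∀ j ∈ Finset.range N, NearBound (s + N) fun x : Rn n => ((bump x : ℂ) - 1) * f j x :=
    fun j _ => NearBound.mono ((nearBound_one_sub_bump N).mul ((hf j).pbound _))
      (by linarith [Nat.cast_nonneg (α := ℝ) j])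
  refine (hV.sub (PBound.sum h1)).congr fun x _ => ?_
  simp only [sub_mul, one_mul, Finset.sum_sub_distrib]
  ring

variable {f : ℕ → Rn n → ℂ} {Q : ℕ → MvPolynomial (Fin n) ℂ} {h : ℕ → Rn n → ℂ}
  {p : ℕ → MvPolynomial (Fin n) ℂ} {V G : Rn n → ℂ} {T₁ T₂ : 𝓢'(Rn n, ℂ)}

/-- The first `N` terms are transformed by `Corr`. What is left is of order `s + N - 1` at the
origin, one power being given away to the logarithm, and transforms into the symbol `e`. -/
theorem exists_symbol_remainder (hn : 1 ≤ n) (hf : ∀ j : ℕ, HomFun (s + j) (f j))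
    (hQ : ∀ j : ℕ, PolyHom (s + j) (Q j)) (hc : ∀ j, Corr (f j) (Q j) (h j) (p j))
    (hV0 : ∀ x, 1 ≤ ‖x‖ → V x = 0)
    (hV : ∀ N : ℕ, NearBound (s + N) fun x => V x - ∑ j ∈ Finset.range N, f j x)
    (hG0 : ∀ x, 1 ≤ ‖x‖ → G x = 0)
    (hG : ∀ N : ℕ, NearBound (s + N) fun x => G x - ∑ j ∈ Finset.range N, polyEval (Q j) x)
    (hT₁ : IsProlongation T₁ V) (hT₂ : IsGivenBy T₂ fun x => G x * (Real.log ‖x‖ : ℂ))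
    {M N : ℕ} (hMN : (M : ℝ) < s + N - 1) :
    ∃ (U : 𝓢'(Rn n, ℂ)) (e : Rn n → ℂ), T₁ + T₂ = distFourier n U ∧ IsSymbol (-M) e ∧
      IsGivenBy U (fun ξ => ∑ j ∈ Finset.range N, ((patch ξ : ℂ) * h j ξ
        + (patch ξ : ℂ) * (polyEval (p j) ξ * (Real.log ‖ξ‖ : ℂ))) + e ξ) := by
  choose T₁' T₂' U H h1 h2 h3 h4 using hc
  have hVb := nearBound_sub_sum_bump hf (hV N)
  have hGb := nearBound_sub_sum_bump (fun j => (hQ j).homFun) (hG N)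
  have hv := (hVb.mono (by linarith : s + N - 1 ≤ s + N)).add
    (NearBound.mono (hGb.mul (nearBound_log one_pos)) (by linarith : s + N - 1 ≤ s + N + -1))
  have hv0 : ∀ x : Rn n, 1 ≤ ‖x‖ → (V x - ∑ j ∈ Finset.range N, (bump x : ℂ) * f j x)
      + (G x - ∑ j ∈ Finset.range N, (bump x : ℂ) * polyEval (Q j) x) * (Real.log ‖x‖ : ℂ) = 0 :=
    fun x hx => by simp [hV0 x hx, hG0 x hx, bump_of_one_le hx]
  obtain ⟨S, R, e, hS, hR, he, hSR⟩ := exists_symbol_of_nearBound hn hv hv0 hMN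
  obtain ⟨S', hS'⟩ := exists_distFourier_eq_schwartzDist (∑ j ∈ Finset.range N, H j)
  have hlog : ∀ {u : Rn n → ℂ}, ContinuousOn u {0}ᶜ → (∀ x, 1 ≤ ‖x‖ → u x = 0) →
      OffBounded fun x => u x * (Real.log ‖x‖ : ℂ) := fun hu h0 =>
    OffBounded.of_eq_zero (hu.mul contDiffOn_log_norm.continuousOn) fun x hx => by
      rw [h0 x hx, zero_mul]
  have hVc : ContinuousOn V {0}ᶜ := by
    have := (hV 0).1.continuousOn; simpa using this
  have hGc : ContinuousOn G {0}ᶜ := by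
    have := (hG 0).1.continuousOn; simpa using this
  have hL : IsProlongation (T₁ + T₂) fun x => V x + G x * (Real.log ‖x‖ : ℂ) :=
    hT₁.add (hT₂.isProlongation hn) (OffBounded.of_eq_zero hVc hV0) (hlog hGc hG0)
  have hob1 : ∀ j, OffBounded fun x : Rn n => (bump x : ℂ) * f j x := fun j =>
    offBounded_bump_mul (hf j).1
  have hob2 : ∀ j, OffBounded fun x : Rn n =>
      (bump x : ℂ) * (polyEval (Q j) x * (Real.log ‖x‖ : ℂ)) := fun j =>
    offBounded_bump_mul ((contDiff_polyEval _).contDiffOn.mul contDiffOn_log_norm)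
  have hsum := IsProlongation.sum (s := Finset.range N) (T := fun j => T₁' j + T₂' j)
    (fun j _ => (h1 j).add ((h2 j).isProlongation hn) (hob1 j) (hob2 j))
    (fun j _ => (hob1 j).add (hob2 j))
  -- Finite parts are additive, so this sum and `T₁ + T₂` prolong the same function and are equal by
  -- uniqueness.
  have hRt : IsProlongation (∑ j ∈ Finset.range N, (T₁' j + T₂' j) + S)
      fun x => V x + G x * (Real.log ‖x‖ : ℂ) := by
    refine (hsum.1.add (hS.isProlongation hn) hsum.2
      (OffBounded.of_eq_zero hv.1.continuousOn hv0)).congr fun x _ => ?_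
    rw [Finset.sum_add_distrib, sub_mul, Finset.sum_mul]
    simp only [mul_assoc]
    ring
  refine ⟨∑ j ∈ Finset.range N, U j + (schwartzDist S' + R), fun ξ => S' ξ + e ξ, ?_,
    (schwartz_isSymbol S' _).add he,
    (IsGivenBy.sum fun j _ => h3 j).add ((isGivenBy_schwartz S').add hR)⟩
  rw [hL.unique hRt, Finset.sum_congr rfl fun j _ => h4 j, Finset.sum_add_distrib,
    distFourier_add, distFourier_add, distFourier_sum, ← hS', ← hSR, schwartzDist_sum]
  abel

/-- Each truncation yields its own `U` and `a`, with an expansion to order `k` only. Injectivity of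
the transform makes all `U` equal, and then continuity makes all `a` equal, so a single `a` has the
full expansion. -/
theorem exists_symbol_of_expansion (hn : 1 ≤ n) (hf : ∀ j : ℕ, HomFun (s + j) (f j))
    (hQ : ∀ j : ℕ, PolyHom (s + j) (Q j)) (hh : ∀ j : ℕ, HomFun (m - j) (h j))
    (hc : ∀ j, Corr (f j) (Q j) (h j) (p j))
    (hV0 : ∀ x, 1 ≤ ‖x‖ → V x = 0)
    (hV : ∀ N : ℕ, NearBound (s + N) fun x => V x - ∑ j ∈ Finset.range N, f j x)
    (hG0 : ∀ x, 1 ≤ ‖x‖ → G x = 0)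
    (hG : ∀ N : ℕ, NearBound (s + N) fun x => G x - ∑ j ∈ Finset.range N, polyEval (Q j) x)
    (hT₁ : IsProlongation T₁ V) (hT₂ : IsGivenBy T₂ fun x => G x * (Real.log ‖x‖ : ℂ))
    {J : ℕ} (hJ : ∀ j, J ≤ j → p j = 0) :
    ∃ (U : 𝓢'(Rn n, ℂ)) (a : Rn n → ℂ), T₁ + T₂ = distFourier n U ∧
      (∀ k : ℕ, IsSymbol (m - k) fun ξ => a ξ - ∑ j ∈ Finset.range k, (patch ξ : ℂ) * h j ξ) ∧
      IsGivenBy U (fun ξ => a ξ + (patch ξ : ℂ) *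
        (polyEval (∑ j ∈ Finset.range J, p j) ξ * (Real.log ‖ξ‖ : ℂ))) := by
  have key : ∀ k : ℕ, ∃ (U : 𝓢'(Rn n, ℂ)) (a : Rn n → ℂ), T₁ + T₂ = distFourier n U ∧
      (IsSymbol (m - k) fun ξ => a ξ - ∑ j ∈ Finset.range k, (patch ξ : ℂ) * h j ξ) ∧
      ContDiff ℝ ∞ a ∧ IsGivenBy U (fun ξ => a ξ + (patch ξ : ℂ) *
        (polyEval (∑ j ∈ Finset.range J, p j) ξ * (Real.log ‖ξ‖ : ℂ))) := by
    intro k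
    -- `M` puts the error below order `m - k`, `N'` makes the number of terms sufficient for `M`,
    -- and adding `J` includes all logarithmic terms.
    obtain ⟨M, hM⟩ := exists_nat_ge (k - m)
    obtain ⟨N', hN'⟩ := exists_nat_gt (M + 1 - s)
    obtain ⟨U, e, hU, he, hUe⟩ := exists_symbol_remainder hn hf hQ hc hV0 hV hG0 hG hT₁ hT₂ (M := M)
      (N := J + (k + N')) (by push_cast; linarith [Nat.cast_nonneg (α := ℝ) J, Nat.cast_nonneg (α := ℝ) k])
    have hps : ∀ ξ, ∑ j ∈ Finset.range (J + (k + N')), polyEval (p j) ξ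
        = polyEval (∑ j ∈ Finset.range J, p j) ξ := fun ξ => by
      rw [Finset.sum_range_add, Finset.sum_eq_zero (s := Finset.range (k + N')) fun j _ => by
        rw [hJ _ (Nat.le_add_right _ _), polyEval_zero], add_zero]
      simp only [polyEval, map_sum]
    have hph : ∀ j, ContDiff ℝ ∞ fun ξ => (patch ξ : ℂ) * h j ξ := fun j =>
      contDiff_patch_mul (hh j).1
    refine ⟨U, fun ξ => ∑ j ∈ Finset.range (J + (k + N')), (patch ξ : ℂ) * h j ξ + e ξ, hU, ?_,
      (ContDiff.sum fun j _ => hph j).add he.1, hUe.congr_ae (Eventually.of_forall fun ξ => ?_)⟩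
    · have hs1 : IsSymbol (m - k) fun ξ => ∑ i ∈ Finset.range (J + N'),
          (patch ξ : ℂ) * h (k + i) ξ :=
        IsSymbol.sum fun i _ => (isSymbol_patch_mul ((hh (k + i)).pbound _)).mono
          (by push_cast; linarith [Nat.cast_nonneg (α := ℝ) i])
      have := hs1.add (he.mono (by linarith : -(M : ℝ) ≤ m - k))
      convert this using 1
      ext ξ
      beta_reduce
      rw [show J + (k + N') = k + (J + N') by omega, Finset.sum_range_add _ k (J + N')]
      generalize J + N' = L
      ring
    · beta_reduce
      rw [Finset.sum_add_distrib, ← hps ξ, Finset.sum_mul, Finset.mul_sum]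
      ring
  obtain ⟨U, a, hU, -, ha, hUa⟩ := key 0
  refine ⟨U, a, hU, fun k => ?_, hUa⟩
  obtain ⟨U', a', hU', hk, ha', hUa'⟩ := key k
  have hUU : U = U' := distFourier_injective (hU.symm.trans hU')
  have hlc : Continuous fun ξ : Rn n => (patch ξ : ℂ) *
      (polyEval (∑ j ∈ Finset.range J, p j) ξ * (Real.log ‖ξ‖ : ℂ)) :=
    (contDiff_patch_mul ((contDiff_polyEval _).contDiffOn.mul contDiffOn_log_norm)).continuous
  have := (hUU ▸ hUa).eq_of_continuous (ha.continuous.add hlc) (ha'.continuous.add hlc) hUa'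
  have haa : a = a' := funext fun ξ => add_right_cancel (congrFun this ξ)
  exact haa ▸ hk

end Expansion


/-! ### Fourier transforms of polynomials -/

section Polynomials

variable {n : ℕ}

theorem exists_isGivenBy_polyEval (r : MvPolynomial (Fin n) ℂ) :
    ∃ T : 𝓢'(Rn n, ℂ), IsGivenBy T (polyEval r) := by
  have h : ∀ i : ℕ, PolyHom (i : ℝ) (MvPolynomial.homogeneousComponent i r) := fun i =>
    Or.inr ⟨i, rfl, MvPolynomial.homogeneousComponent_isHomogeneous i r⟩
  choose T hT using fun i : ℕ => (moderate_polyEval_of_polyHom (h i)).exists_isGivenBy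
  refine ⟨_, (IsGivenBy.sum (s := Finset.range (r.totalDegree + 1)) fun i _ => hT i).congr_ae
    (Eventually.of_forall fun x => ?_)⟩
  conv_rhs => rw [← MvPolynomial.sum_homogeneousComponent r]
  simp only [polyEval, map_sum]

/-- A polynomial as a tempered distribution. -/
def polyDist (r : MvPolynomial (Fin n) ℂ) : 𝓢'(Rn n, ℂ) := (exists_isGivenBy_polyEval r).choose

theorem isGivenBy_polyDist (r : MvPolynomial (Fin n) ℂ) : IsGivenBy (polyDist r) (polyEval r) :=
  (exists_isGivenBy_polyEval r).choose_spec

theorem polyDist_C_mul (c : ℂ) (r : MvPolynomial (Fin n) ℂ) :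
    polyDist (MvPolynomial.C c * r) = c • polyDist r := by
  refine (isGivenBy_polyDist _).unique (((isGivenBy_polyDist r).const_smul c).congr_ae
    (Eventually.of_forall fun x => ?_))
  rw [polyEval_C_mul]

theorem polyDist_sum {ι : Type*} (t : Finset ι) (r : ι → MvPolynomial (Fin n) ℂ) :
    polyDist (∑ i ∈ t, r i) = ∑ i ∈ t, polyDist (r i) := by
  refine (isGivenBy_polyDist _).unique ((IsGivenBy.sum fun i _ => isGivenBy_polyDist (r i)).congr_ae
    (Eventually.of_forall fun x => ?_))
  simp only [polyEval, map_sum]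

theorem schwartzFourier_lineDeriv (j : Fin n) (ψ : 𝓢(Rn n, ℂ)) (ξ : Rn n) :
    schwartzFourier n (∂_{(EuclideanSpace.single j 1 : Rn n)} ψ) ξ
      = Complex.I * (ξ j : ℂ) * schwartzFourier n ψ ξ := by
  have h : ∀ φ : 𝓢(Rn n, ℂ), schwartzFourier n φ ξ = (𝓕 φ) ((2 * π)⁻¹ • ξ) := fun φ => rfl
  have hg : (inner ℝ · (EuclideanSpace.single j 1 : Rn n)).HasTemperateGrowth :=
    ((innerSL ℝ).flip (EuclideanSpace.single j 1 : Rn n)).hasTemperateGrowth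
  rw [h, h, SchwartzMap.fourier_lineDerivOp_eq, _root_.smul_apply,
    SchwartzMap.smulLeftCLM_apply_apply hg]
  have hi : inner ℝ ((2 * π)⁻¹ • ξ) (EuclideanSpace.single j 1 : Rn n) = (2 * π)⁻¹ * ξ j := by
    rw [real_inner_smul_left, EuclideanSpace.inner_single_right]; simp
  have h2 : (π : ℂ) ≠ 0 := by exact_mod_cast pi_pos.ne'
  rw [hi, Complex.real_smul, smul_eq_mul]
  push_cast
  field_simp

theorem lineDeriv_distFourier_polyDist (j : Fin n) (r : MvPolynomial (Fin n) ℂ) :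
    (-Complex.I) • ∂_{(EuclideanSpace.single j 1 : Rn n)} (distFourier n (polyDist r))
      = distFourier n (polyDist (-MvPolynomial.X j * r)) := by
  ext ψ
  have h1 := (isGivenBy_polyDist r) (schwartzFourier n (∂_{(EuclideanSpace.single j 1 : Rn n)} ψ))
  have h2 := (isGivenBy_polyDist (-MvPolynomial.X j * r)) (schwartzFourier n ψ)
  have e : ((-Complex.I) • ∂_{(EuclideanSpace.single j 1 : Rn n)} (distFourier n (polyDist r))) ψ
      = Complex.I * polyDist r (schwartzFourier n (∂_{(EuclideanSpace.single j 1 : Rn n)} ψ)) := by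
    have : ((-Complex.I) • ∂_{(EuclideanSpace.single j 1 : Rn n)} (distFourier n (polyDist r))) ψ
      = (-Complex.I) * distFourier n (polyDist r) (- ∂_{(EuclideanSpace.single j 1 : Rn n)} ψ) := rfl
    rw [this, map_neg, distFourier_apply]; ring
  rw [e, distFourier_apply, h1.2, h2.2, ← integral_const_mul]
  congr 1
  ext ξ
  rw [schwartzFourier_lineDeriv]
  simp only [polyEval, map_mul, map_neg, MvPolynomial.eval_X]
  linear_combination (MvPolynomial.eval (fun i => (ξ i : ℂ)) r * (ξ j : ℂ)
    * schwartzFourier n ψ ξ) * Complex.I_mul_I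

theorem multiD_distFourier_polyDist (α : Fin n →₀ ℕ) (r : MvPolynomial (Fin n) ℂ) :
    multiD α (distFourier n (polyDist r))
      = distFourier n (polyDist ((∏ j, (-MvPolynomial.X j) ^ α j) * r)) := by
  have hit : ∀ (j : Fin n) (k : ℕ) (r : MvPolynomial (Fin n) ℂ),
      (fun V : 𝓢'(Rn n, ℂ) => (-Complex.I) • ∂_{(EuclideanSpace.single j 1 : Rn n)} V)^[k]
        (distFourier n (polyDist r)) = distFourier n (polyDist ((-MvPolynomial.X j) ^ k * r)) := by
    intro j k r
    induction k with
    | zero => simp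
    | succ k ih =>
      rw [Function.iterate_succ_apply', ih, lineDeriv_distFourier_polyDist, pow_succ', mul_assoc]
  have hl : ∀ l : List (Fin n), l.foldr (fun j S => (fun V : 𝓢'(Rn n, ℂ) =>
      (-Complex.I) • ∂_{(EuclideanSpace.single j 1 : Rn n)} V)^[α j] S) (distFourier n (polyDist r))
      = distFourier n (polyDist ((l.map fun j => (-MvPolynomial.X j) ^ α j).prod * r)) := by
    intro l
    induction l with
    | nil => simp
    | cons j l ih => rw [List.foldr_cons, ih, hit, List.map_cons, List.prod_cons, mul_assoc]
  rw [multiD, hl, Fin.prod_univ_def]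

/-- The polynomial `ξ ↦ P(-ξ)`. -/
def reflect (P : MvPolynomial (Fin n) ℂ) : MvPolynomial (Fin n) ℂ :=
  MvPolynomial.aeval (fun j => -MvPolynomial.X j) P

theorem reflect_eq (P : MvPolynomial (Fin n) ℂ) : reflect P
    = ∑ α ∈ P.support, MvPolynomial.C (P.coeff α) * ∏ j, (-MvPolynomial.X j) ^ α j := by
  rw [reflect, MvPolynomial.aeval_def, MvPolynomial.eval₂_eq']; rfl

theorem reflect_reflect (P : MvPolynomial (Fin n) ℂ) : reflect (reflect P) = P := by
  have : (MvPolynomial.aeval (R := ℂ) (fun j : Fin n => -(MvPolynomial.X j : MvPolynomial (Fin n) ℂ))).comp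
      (MvPolynomial.aeval (fun j : Fin n => -(MvPolynomial.X j : MvPolynomial (Fin n) ℂ)))
      = AlgHom.id ℂ _ := by
    ext j; simp
  exact congrArg (fun F : MvPolynomial (Fin n) ℂ →ₐ[ℂ] MvPolynomial (Fin n) ℂ => F P) this

theorem totalDegree_reflect_le (P : MvPolynomial (Fin n) ℂ) :
    (reflect P).totalDegree ≤ P.totalDegree := by
  rw [reflect_eq]
  refine MvPolynomial.totalDegree_finsetSum_le fun α hα => ?_
  refine (MvPolynomial.totalDegree_mul _ _).trans ?_
  rw [MvPolynomial.totalDegree_C, zero_add]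
  refine (MvPolynomial.totalDegree_finsetProd _ _).trans ?_
  calc ∑ j, ((-MvPolynomial.X j : MvPolynomial (Fin n) ℂ) ^ α j).totalDegree ≤ ∑ j, α j := by
        refine Finset.sum_le_sum fun j _ => (MvPolynomial.totalDegree_pow _ _).trans ?_
        rw [MvPolynomial.totalDegree_neg, MvPolynomial.totalDegree_X, mul_one]
    _ = α.sum fun _ e => e := (Finsupp.sum_fintype α (fun _ e => e) fun _ => rfl).symm
    _ ≤ P.totalDegree := MvPolynomial.le_totalDegree hα

theorem polyD_distFourier_polyDist (P r : MvPolynomial (Fin n) ℂ) :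
    polyD P (distFourier n (polyDist r)) = distFourier n (polyDist (reflect P * r)) := by
  rw [polyD, reflect_eq, Finset.sum_mul, polyDist_sum, distFourier_sum]
  refine Finset.sum_congr rfl fun α _ => ?_
  rw [multiD_distFourier_polyDist, mul_assoc, polyDist_C_mul, distFourier_smul]

theorem integral_schwartzFourier (ψ : 𝓢(Rn n, ℂ)) :
    ∫ ξ, schwartzFourier n ψ ξ = ((((2 * π)⁻¹ ^ (-n : ℝ)) : ℝ) : ℂ) * ψ 0 := by
  set g : 𝓢(Rn n, ℂ) := 𝓕 ψ with hg
  have h : ∀ ξ, schwartzFourier n ψ ξ = g ((2 * π)⁻¹ • ξ) := fun ξ => rfl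
  have h0 : ∫ ξ, g ξ = ψ 0 := by
    have h1 : (𝓕⁻ g : 𝓢(Rn n, ℂ)) = ψ := FourierTransform.fourierInv_fourier_eq ψ
    have h2 : (𝓕⁻ g : 𝓢(Rn n, ℂ)) 0 = ∫ ξ, g ξ := by
      rw [SchwartzMap.fourierInv_coe, Real.fourierInv_eq']
      simp
    rw [← h2, h1]
  simp only [h]
  rw [integral_comp_smul_Rn (fun ξ => g ξ) (inv_pos.2 two_pi_pos), h0, Complex.real_smul]

/-- Fourier inversion at the origin, with `c = (2π)^(-n)`. That `c ≠ 0` permits the passage from a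
polynomial back to `P(D)δ`. -/
theorem exists_delta_eq : ∃ c : ℂ, c ≠ 0 ∧
    TemperedDistribution.delta (0 : Rn n) = distFourier n (polyDist (MvPolynomial.C c)) := by
  have hc : ((((2 * π)⁻¹ ^ (-n : ℝ)) : ℝ) : ℂ) ≠ 0 :=
    Complex.ofReal_ne_zero.2 (rpow_pos_of_pos (inv_pos.2 two_pi_pos) _).ne'
  refine ⟨((((2 * π)⁻¹ ^ (-n : ℝ)) : ℝ) : ℂ)⁻¹, inv_ne_zero hc, ?_⟩
  ext ψ
  rw [distFourier_apply, (isGivenBy_polyDist _ _).2, TemperedDistribution.delta_apply]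
  simp only [polyEval, MvPolynomial.eval_C]
  rw [integral_const_mul, integral_schwartzFourier, inv_mul_cancel_left₀ hc]

theorem mem_polysOfDegree_C_mul_reflect {d : ℝ} {P : MvPolynomial (Fin n) ℂ}
    (hP : P ∈ polysOfDegree n d) (c : ℂ) : MvPolynomial.C c * reflect P ∈ polysOfDegree n d := by
  rcases hP with rfl | ⟨k, hk, hd⟩
  · exact Or.inl (by simp [reflect])
  · refine Or.inr ⟨k, hk, (MvPolynomial.totalDegree_mul _ _).trans ?_⟩
    rw [MvPolynomial.totalDegree_C, zero_add]
    exact (totalDegree_reflect_le P).trans hd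

theorem exists_polyDist_eq_polyD_delta {d : ℝ} {P : MvPolynomial (Fin n) ℂ}
    (hP : P ∈ polysOfDegree n d) : ∃ q ∈ polysOfDegree n d,
      polyD P (TemperedDistribution.delta 0) = distFourier n (polyDist q) := by
  obtain ⟨c, -, hδ⟩ := exists_delta_eq (n := n)
  refine ⟨_, mem_polysOfDegree_C_mul_reflect hP c, ?_⟩
  rw [hδ, polyD_distFourier_polyDist, mul_comm]

theorem exists_polyD_delta_eq_polyDist {d : ℝ} {q : MvPolynomial (Fin n) ℂ}
    (hq : q ∈ polysOfDegree n d) : ∃ P ∈ polysOfDegree n d,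
      polyD P (TemperedDistribution.delta 0) = distFourier n (polyDist q) := by
  obtain ⟨c, hc, hδ⟩ := exists_delta_eq (n := n)
  refine ⟨_, mem_polysOfDegree_C_mul_reflect hq c⁻¹, ?_⟩
  have e : reflect (MvPolynomial.C c⁻¹ * reflect q) * MvPolynomial.C c = q := by
    have h1 : reflect (MvPolynomial.C c⁻¹ * reflect q)
        = MvPolynomial.C c⁻¹ * reflect (reflect q) := by
      rw [reflect, map_mul, ← MvPolynomial.algebraMap_eq, AlgHom.commutes]; rfl
    rw [h1, reflect_reflect, mul_right_comm, ← map_mul, inv_mul_cancel₀ hc, map_one, one_mul]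
  rw [hδ, polyD_distFourier_polyDist, e]

end Polynomials

/-! ### Homogeneous components of polynomials -/

section Components

variable {n : ℕ} {m : ℝ}

/-- `p j` is the component of degree `m - j`, numbered downwards to match the indexing of symbol
expansions. -/
theorem exists_components {q : MvPolynomial (Fin n) ℂ} (hq : q ∈ polysOfDegree n m) :
    ∃ p : ℕ → MvPolynomial (Fin n) ℂ, (∀ j : ℕ, PolyHom (m - j) (p j)) ∧
      ∀ J : ℕ, m < J → ∑ j ∈ Finset.range J, p j = q := by
  rcases hq with rfl | ⟨k, hk, hd⟩
  · exact ⟨fun _ => 0, fun _ => PolyHom.zero, fun J _ => by simp⟩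
  · refine ⟨fun j => if j ≤ k then MvPolynomial.homogeneousComponent (k - j) q else 0,
      fun j => ?_, fun J hJ => ?_⟩
    · beta_reduce
      split_ifs with hj
      · refine Or.inr ⟨k - j, ?_, MvPolynomial.homogeneousComponent_isHomogeneous _ _⟩
        rw [← hk, Nat.cast_sub hj]
      · exact PolyHom.zero
    · have hJ' : k + 1 ≤ J := by
        have : (k : ℝ) < J := by rwa [hk]
        exact_mod_cast this
      rw [← Finset.sum_subset (Finset.range_subset_range.2 hJ') fun j _ hj =>
        if_neg (by simpa [Nat.lt_succ_iff] using hj)]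
      have h1 : ∑ j ∈ Finset.range (k + 1), (if j ≤ k then
          MvPolynomial.homogeneousComponent (k - j) q else 0)
          = ∑ j ∈ Finset.range (k + 1), MvPolynomial.homogeneousComponent (k + 1 - 1 - j) q :=
        Finset.sum_congr rfl fun j hj => by
          rw [if_pos (Nat.lt_succ_iff.1 (Finset.mem_range.1 hj)), Nat.add_sub_cancel]
      rw [h1, Finset.sum_range_reflect (fun i => MvPolynomial.homogeneousComponent i q)]
      conv_rhs => rw [← MvPolynomial.sum_homogeneousComponent q]
      refine (Finset.sum_subset (Finset.range_subset_range.2 (by omega)) fun i _ hi =>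
        MvPolynomial.homogeneousComponent_eq_zero _ _ ?_).symm
      simpa [Nat.lt_succ_iff] using hi

theorem sum_mem_polysOfDegree {p : ℕ → MvPolynomial (Fin n) ℂ}
    (hp : ∀ j : ℕ, PolyHom (m - j) (p j)) (J : ℕ) :
    ∑ j ∈ Finset.range J, p j ∈ polysOfDegree n m := by
  by_cases hm : ∃ k : ℕ, (k : ℝ) = m
  · obtain ⟨k, hk⟩ := hm
    refine Or.inr ⟨k, hk, MvPolynomial.totalDegree_finsetSum_le fun j _ => ?_⟩
    rcases hp j with h | ⟨d, hd, hh⟩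
    · simp [h]
    · refine hh.totalDegree_le.trans ?_
      have : (d : ℝ) ≤ k := by rw [hd, hk]; linarith [Nat.cast_nonneg (α := ℝ) j]
      exact_mod_cast this
  · refine Or.inl (Finset.sum_eq_zero fun j _ => ?_)
    rcases hp j with h | ⟨d, hd, -⟩
    · exact h
    · exact absurd ⟨d + j, by push_cast; rw [hd]; ring⟩ hm

end Components


/-! ### Expansions of classical symbols into homogeneous functions -/

section Classical

variable {n : ℕ} {m σ : ℝ}

theorem isSymbol_of_eq_zero {u : Rn n → ℂ} (hu : ContDiff ℝ ∞ u) (h0 : ∀ x, 1 ≤ ‖x‖ → u x = 0) :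
    IsSymbol σ u :=
  isSymbol_iff.2 ⟨hu, farBound_of_contDiff hu PBound.zero h0⟩

/-- `a ∼ ∑ⱼ h j`, cut off near the origin. -/
def HasExp (m : ℝ) (h : ℕ → Rn n → ℂ) (a : Rn n → ℂ) : Prop :=
  ∀ k : ℕ, IsSymbol (m - k) fun ξ => a ξ - ∑ j ∈ Finset.range k, (patch ξ : ℂ) * h j ξ

variable {h h' : ℕ → Rn n → ℂ} {a a' : Rn n → ℂ}

theorem HasExp.isSymbol (ha : HasExp m h a) : IsSymbol m a := by
  have := ha 0
  simpa using this

theorem HasExp.add (ha : HasExp m h a) (ha' : HasExp m h' a') :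
    HasExp m (fun j ξ => h j ξ + h' j ξ) fun ξ => a ξ + a' ξ := fun k => by
  convert (ha k).add (ha' k) using 1
  ext ξ
  simp only [mul_add, Finset.sum_add_distrib]
  ring

theorem HasExp.sub (ha : HasExp m h a) (ha' : HasExp m h' a') :
    HasExp m (fun j ξ => h j ξ - h' j ξ) fun ξ => a ξ - a' ξ := fun k => by
  convert (ha k).sub (ha' k) using 1
  ext ξ
  simp only [mul_sub, Finset.sum_sub_distrib]
  ring

theorem hasExp_schwartz (S : 𝓢(Rn n, ℂ)) : HasExp m (fun _ _ => 0) (S : Rn n → ℂ) := fun k => by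
  simpa using schwartz_isSymbol S (m - k)

theorem HasExp.exists_schwartz (ha : HasExp m (fun _ _ => 0) a) :
    ∃ S : 𝓢(Rn n, ℂ), ∀ x, S x = a x := by
  refine IsSymbol.exists_schwartz fun N => ?_
  obtain ⟨k, hk⟩ := exists_nat_ge (m + N)
  have := (ha k).mono (by linarith : m - k ≤ -N)
  simpa using this

theorem hasExp_polyEval {p : ℕ → MvPolynomial (Fin n) ℂ} (hp : ∀ j : ℕ, PolyHom (m - j) (p j))
    {J : ℕ} (hJ : ∀ j, J ≤ j → p j = 0) :
    HasExp m (fun j => polyEval (p j)) (polyEval (∑ j ∈ Finset.range J, p j)) := fun k => by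
  have h1 : IsSymbol (m - k) fun ξ => ∑ i ∈ Finset.range J, (patch ξ : ℂ) * polyEval (p (k + i)) ξ :=
    IsSymbol.sum fun i _ => (isSymbol_patch_mul ((hp (k + i)).homFun.pbound _)).mono
      (by push_cast; linarith [Nat.cast_nonneg (α := ℝ) i])
  have h2 : IsSymbol (m - k) fun ξ : Rn n =>
      (bump ξ : ℂ) * polyEval (∑ j ∈ Finset.range J, p j) ξ :=
    isSymbol_of_eq_zero (contDiff_bump_complex.mul (contDiff_polyEval _)) fun x hx => by
      rw [bump_of_one_le hx]; simp
  convert h2.add h1 using 1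
  ext ξ
  have e : ∑ j ∈ Finset.range k, polyEval (p j) ξ + ∑ i ∈ Finset.range J, polyEval (p (k + i)) ξ
      = polyEval (∑ j ∈ Finset.range J, p j) ξ := by
    rw [← Finset.sum_range_add, add_comm k, Finset.sum_range_add,
      Finset.sum_eq_zero (s := Finset.range k) fun i _ => by
        rw [hJ _ (Nat.le_add_right _ _), polyEval_zero], add_zero]
    simp only [polyEval, map_sum]
  rw [← Finset.mul_sum, ← Finset.mul_sum, ← e, bump]
  push_cast
  ring

theorem HasExp.isClassicalSymbol (hh : ∀ j : ℕ, HomFun (m - j) (h j)) (ha : HasExp m h a) :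
    IsClassicalSymbol m a := by
  refine ⟨ha.isSymbol.1, fun j ξ => (patch ξ : ℂ) * h j ξ, fun j => contDiff_patch_mul (hh j).1,
    fun j t ht ξ hξ => ?_, ha⟩
  have h0 : ξ ≠ 0 := by rintro rfl; simp at hξ; linarith
  have ht0 : 0 < t := by linarith
  have : 1 ≤ ‖t • ξ‖ := by
    rw [norm_smul, Real.norm_of_nonneg ht0.le]
    exact one_le_mul_of_one_le_of_one_le ht hξ
  beta_reduce
  rw [patch_of_one_le this, patch_of_one_le hξ, (hh j).2 t ht0 ξ h0]
  ring

/-- The values on the unit sphere are extended by homogeneity to all of `ℝⁿ ∖ {0}`. -/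
theorem exists_homFun_eq {b : Rn n → ℂ} (hb : ContDiff ℝ ∞ b)
    (hom : ∀ t : ℝ, 1 ≤ t → ∀ ξ : Rn n, 1 ≤ ‖ξ‖ → b (t • ξ) = ((t ^ σ : ℝ) : ℂ) * b ξ) :
    ∃ h : Rn n → ℂ, HomFun σ h ∧ ∀ ξ, 1 ≤ ‖ξ‖ → b ξ = h ξ := by
  have hn1 : ∀ ξ : Rn n, ξ ≠ 0 → ‖‖ξ‖⁻¹ • ξ‖ = 1 := fun ξ hξ => by
    rw [norm_smul, norm_inv, norm_norm, inv_mul_cancel₀ (norm_ne_zero_iff.2 hξ)]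
  refine ⟨fun ξ => ((‖ξ‖ ^ σ : ℝ) : ℂ) * b (‖ξ‖⁻¹ • ξ), ⟨?_, fun t ht ξ hξ => ?_⟩, fun ξ hξ => ?_⟩
  · refine (homFun_norm_rpow σ).1.mul (hb.comp_contDiffOn ?_)
    exact (contDiffOn_norm_off.inv fun x hx => norm_ne_zero_iff.2 hx).smul contDiffOn_id
  · have e : ‖t • ξ‖⁻¹ • (t • ξ) = ‖ξ‖⁻¹ • ξ := by
      rw [norm_smul, Real.norm_of_nonneg ht.le, mul_inv, mul_comm, mul_smul, inv_smul_smul₀ ht.ne']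
    beta_reduce
    rw [e, norm_smul, Real.norm_of_nonneg ht.le, mul_rpow ht.le (norm_nonneg _)]
    push_cast; ring
  · have h0 : ξ ≠ 0 := by rintro rfl; simp at hξ; linarith
    have := hom ‖ξ‖ hξ (‖ξ‖⁻¹ • ξ) (hn1 ξ h0).ge
    rwa [smul_inv_smul₀ (norm_ne_zero_iff.2 h0)] at this

theorem IsClassicalSymbol.exists_hasExp (ha : IsClassicalSymbol m a) :
    ∃ h : ℕ → Rn n → ℂ, (∀ j : ℕ, HomFun (m - j) (h j)) ∧ HasExp m h a := by
  obtain ⟨-, b, hb, hom, hs⟩ := ha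
  choose h hh hbh using fun j => exists_homFun_eq (hb j) (hom j)
  refine ⟨h, hh, fun k => ?_⟩
  have h1 : IsSymbol (m - k) fun ξ => ∑ j ∈ Finset.range k, (b j ξ - (patch ξ : ℂ) * h j ξ) :=
    IsSymbol.sum fun j _ => isSymbol_of_eq_zero ((hb j).sub (contDiff_patch_mul (hh j).1))
      fun x hx => by rw [patch_of_one_le hx, hbh j x hx]; simp
  convert (hs k).add h1 using 1
  ext ξ
  rw [Finset.sum_sub_distrib]
  ring

theorem IsPatch.contDiff {θ : Rn n → ℝ} (hθ : IsPatch θ) : ContDiff ℝ ∞ θ := by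
  obtain ⟨χ, hχ, h⟩ := hθ
  rw [(funext h : θ = _)]
  exact contDiff_const.sub hχ.1

theorem IsPatch.exists_schwartz {θ θ' : Rn n → ℝ} (hθ : IsPatch θ) (hθ' : IsPatch θ')
    {u : Rn n → ℂ} (hu : ContDiffOn ℝ ∞ u {0}ᶜ) :
    ∃ S : 𝓢(Rn n, ℂ), ∀ x, S x = ((θ x : ℂ) - θ' x) * u x := by
  have hc : ContDiff ℝ ∞ fun x => ((θ x : ℂ) - θ' x) * u x := by
    rw [contDiff_iff_contDiffAt]
    intro x
    by_cases hx : x = 0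
    · subst hx
      refine (contDiffAt_const (c := (0 : ℂ))).congr_of_eventuallyEq ?_
      obtain ⟨χ, hχ, h⟩ := hθ
      obtain ⟨χ', hχ', h'⟩ := hθ'
      filter_upwards [hχ.2.2.2, hχ'.2.2.2] with x hx hx'
      rw [h, h', hx, hx']; simp
    · exact ((Complex.ofRealCLM.contDiff.comp hθ.contDiff).sub
        (Complex.ofRealCLM.contDiff.comp hθ'.contDiff)).contDiffAt.mul
        (hu.contDiffAt (isOpen_compl_zero.mem_nhds hx))
  have hcs : HasCompactSupport fun x => ((θ x : ℂ) - θ' x) * u x := by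
    obtain ⟨χ, hχ, h⟩ := hθ
    obtain ⟨χ', hχ', h'⟩ := hθ'
    refine HasCompactSupport.mul_right ?_
    have e : (fun x => (θ x : ℂ) - θ' x) = fun x => ((χ' x - χ x : ℝ) : ℂ) := by
      ext x; rw [h, h']; push_cast; ring
    rw [e]
    exact (hχ'.2.1.sub hχ.2.1).comp_left Complex.ofReal_zero
  exact ⟨hcs.toSchwartzMap hc, fun x => rfl⟩

/-- Two patch functions agree near the origin and near infinity, so exchanging them alters the
logarithmic term by a smooth function of compact support. It is therefore enough to treat `patch`.
-/
theorem logSymbolSpace_subset {θ θ' : Rn n → ℝ} (hθ : IsPatch θ) (hθ' : IsPatch θ') :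
    logSymbolSpace n m θ ⊆ logSymbolSpace n m θ' := by
  rintro T ⟨a, p, ha, hp, hT⟩
  obtain ⟨S, hS⟩ := hθ.exists_schwartz hθ'
    ((contDiff_polyEval p).contDiffOn.mul contDiffOn_log_norm)
  obtain ⟨h, hh, hah⟩ := ha.exists_hasExp
  refine ⟨fun ξ => a ξ + S ξ, p, ?_, hp, hT.congr_ae (Eventually.of_forall fun ξ => ?_)⟩
  · refine HasExp.isClassicalSymbol hh ?_
    simpa using hah.add (hasExp_schwartz S)
  · beta_reduce
    rw [hS]; ring

end Classical


/-! ### Expansions of conormal singularities at the origin -/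

section Singular

variable {n : ℕ} {m s : ℝ}

theorem IsSmoothPolar.exists_expansion {F : ℝ → Rn n → ℂ} (hF : IsSmoothPolar F) (s : ℝ) :
    ∃ f : ℕ → Rn n → ℂ, (∀ j : ℕ, HomFun (s + j) (f j)) ∧ ∀ N : ℕ, NearBound (s + N) fun x =>
      ((‖x‖ ^ s : ℝ) : ℂ) * F ‖x‖ (‖x‖⁻¹ • x) - ∑ j ∈ Finset.range N, f j x := by
  obtain ⟨w, hw, hwN⟩ := hF.pol.exists_expansion
  refine ⟨fun j x => ((‖x‖ ^ (s + j) : ℝ) : ℂ) * w j x, fun j => ?_, fun N => ?_⟩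
  · simpa using (homFun_norm_rpow (s + j)).mul (hw j)
  · obtain ⟨v, hv, hwv⟩ := hwN N
    have h := ((homFun_norm_rpow (n := n) (s + N)).pbound {x | ‖x‖ ≤ 1}).mul hv.nearBound
    rw [add_zero] at h
    refine h.congr fun x hx => ?_
    have hx0 : 0 < ‖x‖ := norm_pos_iff.2 hx
    have hp : ∀ j : ℕ, ((‖x‖ ^ (s + j) : ℝ) : ℂ) = ((‖x‖ ^ s : ℝ) : ℂ) * (‖x‖ : ℂ) ^ j := fun j => by
      rw [rpow_add hx0, rpow_natCast]; push_cast; rfl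
    simp only [hp]
    rw [hwv x hx, mul_add, Finset.mul_sum]
    simp only [mul_assoc]
    ring

theorem exists_natCast_or_neg {s : ℝ} (hs : ∃ k : ℤ, (k : ℝ) = s) :
    ∃ b : ℕ, s = b ∨ s = -b := by
  obtain ⟨k, rfl⟩ := hs
  obtain ⟨b, rfl | rfl⟩ := k.eq_nat_or_neg
  · exact ⟨b, Or.inl (by simp)⟩
  · exact ⟨b, Or.inr (by simp)⟩

theorem PolyHom.eq_zero_of_not_int {p : MvPolynomial (Fin n) ℂ} (hs : ¬ ∃ k : ℤ, (k : ℝ) = s)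
    {j : ℕ} (hp : PolyHom (s + j) p) : p = 0 := by
  rcases hp with h | ⟨k, hk, -⟩
  · exact h
  · exact absurd ⟨k - j, by push_cast; linarith⟩ hs

/-- `Q j` is the Taylor term of degree `s + j`. For `s = b ≥ 0` flatness kills the first `b` Taylor
terms; for `s = -b` the first `b` polynomials are zero; for other `s` all vanish with `G`. -/
theorem exists_taylor_polynomials {G : Rn n → ℂ} (hG : ContDiff ℝ ∞ G)
    (hflat : ∀ j : ℕ, (j : ℝ) < s → iteratedFDeriv ℝ j G 0 = 0)
    (hint : (¬ ∃ k : ℤ, (k : ℝ) = s) → ∀ x, G x = 0) :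
    ∃ Q : ℕ → MvPolynomial (Fin n) ℂ, (∀ j : ℕ, PolyHom (s + j) (Q j)) ∧ ∀ N : ℕ,
      NearBound (s + N) fun x => G x - ∑ j ∈ Finset.range N, polyEval (Q j) x := by
  choose q hq hqt using fun k => exists_poly_taylorTerm G k
  by_cases hs : ∃ k : ℤ, (k : ℝ) = s
  · obtain ⟨b, rfl | rfl⟩ := exists_natCast_or_neg hs
    · refine ⟨fun j => q (b + j), fun j => Or.inr ⟨b + j, by push_cast; rfl, hq _⟩, fun N => ?_⟩
      rw [← Nat.cast_add]
      refine (nearBound_sub_taylor hG (b + N)).congr fun x _ => ?_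
      rw [Finset.sum_range_add, Finset.sum_eq_zero (s := Finset.range b) fun k hk => by
        rw [taylorTerm, hflat k (by exact_mod_cast Finset.mem_range.1 hk)]; simp, zero_add]
      simp only [hqt]
    · refine ⟨fun j => if b ≤ j then q (j - b) else 0, fun j => ?_, fun N => ?_⟩
      · beta_reduce
        split_ifs with hj
        · exact Or.inr ⟨j - b, by rw [Nat.cast_sub hj]; ring, hq _⟩
        · exact PolyHom.zero
      · have hz : ∀ j, j < b → ∀ x : Rn n, polyEval (if b ≤ j then q (j - b) else 0) x = 0 :=
          fun j hj x => by rw [if_neg (by omega), polyEval_zero]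
        rcases le_total b N with h | h
        · obtain ⟨K, rfl⟩ := Nat.exists_eq_add_of_le h
          rw [show -(b : ℝ) + ((b + K : ℕ) : ℝ) = K by push_cast; ring]
          refine (nearBound_sub_taylor hG K).congr fun x _ => ?_
          rw [Finset.sum_range_add, Finset.sum_eq_zero (s := Finset.range b) fun k hk =>
            hz k (Finset.mem_range.1 hk) x, zero_add]
          simp [hqt]
        -- The required order `-b + N` is not positive, so smoothness alone suffices.
        · have hN : (N : ℝ) ≤ b := by exact_mod_cast h
          refine ((nearBound_of_contDiff hG).mono (by linarith : -(b : ℝ) + N ≤ 0)).congr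
            fun x _ => ?_
          rw [Finset.sum_eq_zero fun k hk => hz k ((Finset.mem_range.1 hk).trans_le h) x, sub_zero]
  · refine ⟨fun _ => 0, fun _ => PolyHom.zero, fun N => PBound.zero.congr fun x _ => ?_⟩
    simp [hint hs x, polyEval_zero]

theorem exists_smooth_with_taylor (hn : 1 ≤ n) {Q : ℕ → MvPolynomial (Fin n) ℂ}
    (hQ : ∀ j : ℕ, PolyHom (s + j) (Q j)) : ∃ G : Rn n → ℂ, ContDiff ℝ ∞ G ∧
      (∀ x, 1 ≤ ‖x‖ → G x = 0) ∧ (∀ j : ℕ, (j : ℝ) < s → iteratedFDeriv ℝ j G 0 = 0) ∧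
      ((¬ ∃ k : ℤ, (k : ℝ) = s) → ∀ x, G x = 0) ∧
      ∀ N : ℕ, NearBound (s + N) fun x => G x - ∑ j ∈ Finset.range N, polyEval (Q j) x := by
  -- Flatness at the origin is contained in the bound with `N = 0`, which says that `G` itself is of
  -- order `s`.
  suffices h : ∃ G : Rn n → ℂ, ContDiff ℝ ∞ G ∧ (∀ x, 1 ≤ ‖x‖ → G x = 0) ∧
      ((¬ ∃ k : ℤ, (k : ℝ) = s) → ∀ x, G x = 0) ∧
      ∀ N : ℕ, NearBound (s + N) fun x => G x - ∑ j ∈ Finset.range N, polyEval (Q j) x by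
    obtain ⟨G, h1, h2, h3, h4⟩ := h
    refine ⟨G, h1, h2, fun j hj => ?_, h3, h4⟩
    have := h4 0
    simp only [Nat.cast_zero, add_zero, Finset.range_zero, Finset.sum_empty, sub_zero] at this
    exact iteratedFDeriv_eq_zero_of_nearBound hn h1 this hj
  by_cases hs : ∃ k : ℤ, (k : ℝ) = s
  · obtain ⟨b, rfl | rfl⟩ := exists_natCast_or_neg hs
    · obtain ⟨G, h1, h2, h3⟩ := exists_smooth_sum hn (R := fun d => if b ≤ d then Q (d - b) else 0)
        fun d => by
          split_ifs with hd
          · have := hQ (d - b)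
            rw [Nat.cast_sub hd, add_sub_cancel] at this
            exact this.isHomogeneous
          · exact MvPolynomial.isHomogeneous_zero _ _ _
      refine ⟨G, h1, h2, fun h => absurd hs h, fun N => ?_⟩
      rw [← Nat.cast_add]
      refine (h3 (b + N)).congr fun x _ => ?_
      rw [Finset.sum_range_add, Finset.sum_eq_zero (s := Finset.range b) fun k hk => by
        rw [if_neg (by simpa using hk), polyEval_zero], zero_add]
      simp
    · obtain ⟨G, h1, h2, h3⟩ := exists_smooth_sum hn (R := fun d => Q (b + d)) fun d => by
        have := hQ (b + d)
        rw [show -(b : ℝ) + ((b + d : ℕ) : ℝ) = d by push_cast; ring] at this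
        exact this.isHomogeneous
      have hz : ∀ j, j < b → ∀ x : Rn n, polyEval (Q j) x = 0 := fun j hj x => by
        have hjb : (j : ℝ) < b := by exact_mod_cast hj
        have : Q j = 0 := by
          rcases hQ j with h | ⟨k, hk, -⟩
          · exact h
          · linarith [Nat.cast_nonneg (α := ℝ) k]
        rw [this, polyEval_zero]
      refine ⟨G, h1, h2, fun h => absurd hs h, fun N => ?_⟩
      rcases le_total b N with h | h
      · obtain ⟨K, rfl⟩ := Nat.exists_eq_add_of_le h
        rw [show -(b : ℝ) + ((b + K : ℕ) : ℝ) = K by push_cast; ring]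
        refine (h3 K).congr fun x _ => ?_
        rw [Finset.sum_range_add, Finset.sum_eq_zero (s := Finset.range b) fun k hk =>
          hz k (Finset.mem_range.1 hk) x, zero_add]
      · have hN : (N : ℝ) ≤ b := by exact_mod_cast h
        refine ((nearBound_of_contDiff h1).mono (by linarith : -(b : ℝ) + N ≤ 0)).congr
          fun x _ => ?_
        rw [Finset.sum_eq_zero fun k hk => hz k ((Finset.mem_range.1 hk).trans_le h) x, sub_zero]
  · refine ⟨fun _ => 0, contDiff_const, fun _ _ => rfl, fun _ _ => rfl, fun N =>
      PBound.zero.congr fun x _ => ?_⟩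
    simp [fun j => (hQ j).eq_zero_of_not_int hs, polyEval_zero]

/-- Functions with an expansion into homogeneous terms have prolongations if the terms do. -/
theorem exists_prolongation_of_expansion (hn : 1 ≤ n) {V : Rn n → ℂ} {f : ℕ → Rn n → ℂ}
    (hf : ∀ j : ℕ, HomFun (s + j) (f j))
    (hT : ∀ j, ∃ T : 𝓢'(Rn n, ℂ), IsProlongation T fun x => (bump x : ℂ) * f j x)
    (hV0 : ∀ x, 1 ≤ ‖x‖ → V x = 0)
    (hV : ∀ N : ℕ, NearBound (s + N) fun x => V x - ∑ j ∈ Finset.range N, f j x) :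
    ∃ T : 𝓢'(Rn n, ℂ), IsProlongation T V := by
  choose T hT using hT
  -- After `N` terms the remainder has order above `-n`, so it is integrable and needs no finite
  -- part.
  obtain ⟨N, hN⟩ := exists_nat_gt (-n - s)
  have hb := nearBound_sub_sum_bump hf (hV N)
  have h0 : ∀ x : Rn n, 1 ≤ ‖x‖ → V x - ∑ j ∈ Finset.range N, (bump x : ℂ) * f j x = 0 :=
    fun x hx => by simp [hV0 x hx, bump_of_one_le hx]
  obtain ⟨S, hS⟩ := (moderate_of_integrable
    (PBound.integrable hn hb (by linarith) h0)).exists_isGivenBy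
  have h1 := IsProlongation.sum (s := Finset.range N) (fun j _ => hT j)
    (fun j _ => offBounded_bump_mul (hf j).1)
  exact ⟨_, (h1.1.add (hS.isProlongation hn) h1.2
    (OffBounded.of_eq_zero hb.1.continuousOn h0)).congr fun x _ => by ring⟩

theorem exists_isGivenBy_mul_log (hn : 1 ≤ n) {G : Rn n → ℂ} (hG : ContDiff ℝ ∞ G)
    (h0 : ∀ x, 1 ≤ ‖x‖ → G x = 0) :
    ∃ T : 𝓢'(Rn n, ℂ), IsGivenBy T fun x => G x * (Real.log ‖x‖ : ℂ) := by
  have h : NearBound (0 + -(1 / 2)) fun x => G x * (Real.log ‖x‖ : ℂ) :=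
    (nearBound_of_contDiff hG).mul (nearBound_log (by norm_num))
  have hn' : (1 : ℝ) ≤ n := by exact_mod_cast hn
  exact (moderate_of_integrable (PBound.integrable hn h (by linarith)
    fun x hx => by rw [h0 x hx]; simp)).exists_isGivenBy

end Singular

/-! ### The Fourier transform of classical symbols -/

section Main

variable {n : ℕ} {m : ℝ}

theorem PolyHom.eq_zero_of_neg {p : ℕ → MvPolynomial (Fin n) ℂ}
    (hp : ∀ j : ℕ, PolyHom (m - j) (p j)) {J : ℕ} (hJ : m < J) {j : ℕ} (hj : J ≤ j) : p j = 0 := by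
  have hjJ : (J : ℝ) ≤ j := by exact_mod_cast hj
  rcases hp j with h | ⟨k, hk, -⟩
  · exact h
  · linarith [Nat.cast_nonneg (α := ℝ) k]

theorem mem_polysOfDegree_neg {p : MvPolynomial (Fin n) ℂ} (hp : p ∈ polysOfDegree n m) :
    -p ∈ polysOfDegree n m := by
  rcases hp with rfl | ⟨k, hk, hd⟩
  · exact Or.inl neg_zero
  · exact Or.inr ⟨k, hk, by rwa [MvPolynomial.totalDegree_neg]⟩

theorem polar_eq_zero {F : ℝ → Rn n → ℂ} {s : ℝ}
    (hF : ∀ r ζ, 1 ≤ r → ‖ζ‖ = 1 → F r ζ = 0) (x : Rn n) (hx : 1 ≤ ‖x‖) :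
    ((‖x‖ ^ s : ℝ) : ℂ) * F ‖x‖ (‖x‖⁻¹ • x) = 0 := by
  have h0 : ‖x‖ ≠ 0 := by linarith
  rw [hF _ _ hx (by rw [norm_smul, norm_inv, norm_norm, inv_mul_cancel₀ h0]), mul_zero]

/-- The terms of `F` and `G` are matched one by one with symbol terms; `P(D)δ₀` and `H` come from a
polynomial in `𝒫_m` and a Schwartz function. The polynomials `p j` have degree `m - j` and vanish
for `j > m`, so they add up to one element of `𝒫_m`. -/
theorem surjOn_distFourier (hn : 1 ≤ n) :
    SurjOn (distFourier n) (logSymbolSpace n m patch) (spaceC n (-(n : ℝ) - m)) := by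
  rintro T ⟨F, G, P, H, T₁, T₂, hF, hF0, hG, hG0, hflat, hint, hP, hT₁, hT₂, rfl⟩
  obtain ⟨f, hf, hfV⟩ := hF.exists_expansion (-(n : ℝ) - m)
  obtain ⟨Q, hQ, hQG⟩ := exists_taylor_polynomials hG hflat hint
  choose h p hh hp hc using fun j : ℕ => exists_corr_of_singular hn
    (by ring : -(n : ℝ) - m + j = -n - (m - j)) (hf j) (hQ j)
  obtain ⟨J, hJ⟩ := exists_nat_gt m
  obtain ⟨U, a, hU, ha, hUa⟩ := exists_symbol_of_expansion hn hf hQ hh hc (polar_eq_zero hF0) hfV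
    hG0 hQG hT₁ hT₂ (J := J) fun j hj => PolyHom.eq_zero_of_neg hp hJ hj
  rw [show -(-(n : ℝ) - m) - n = m by ring] at hP
  obtain ⟨q, hq, hqP⟩ := exists_polyDist_eq_polyD_delta hP
  obtain ⟨S, hS⟩ := exists_distFourier_eq_schwartzDist H
  obtain ⟨q', hq', hqq'⟩ := exists_components hq
  have hqe := hasExp_polyEval hq' (J := J) fun j hj => PolyHom.eq_zero_of_neg hq' hJ hj
  rw [hqq' J hJ] at hqe
  refine ⟨U + polyDist q + schwartzDist S, ⟨_, ∑ j ∈ Finset.range J, p j,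
    HasExp.isClassicalSymbol (fun j => ((hh j).add (hq' j).homFun).add HomFun.zero)
      ((HasExp.add ha hqe).add (hasExp_schwartz S)), sum_mem_polysOfDegree hp J, ?_⟩, ?_⟩
  · refine ((hUa.add (isGivenBy_polyDist q)).add (isGivenBy_schwartz S)).congr_ae
      (Eventually.of_forall fun ξ => ?_)
    beta_reduce
    ring
  · rw [distFourier_add, distFourier_add, ← hU, ← hqP, ← hS]

theorem mapsTo_distFourier (hn : 1 ≤ n) :
    MapsTo (distFourier n) (logSymbolSpace n m patch) (spaceC n (-(n : ℝ) - m)) := by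
  rintro T ⟨a, p, ha, hp, hT⟩
  obtain ⟨h, hh, hah⟩ := ha.exists_hasExp
  obtain ⟨p', hp', hpp'⟩ := exists_components hp
  choose f Q q hf hQ hq hc using fun j : ℕ => exists_corr_of_symbol hn
    (by ring : -(n : ℝ) - m + j = -n - (m - j)) (hh j) (hp' j)
  obtain ⟨F, hF, hF0, hFf⟩ := exists_polar_sum hf
  obtain ⟨G, hG, hG0, hflat, hint, hGQ⟩ := exists_smooth_with_taylor hn hQ
  obtain ⟨T₁, hT₁⟩ := exists_prolongation_of_expansion hn hf
    (fun j => by obtain ⟨T₁, -, -, -, h1, -⟩ := hc j; exact ⟨T₁, h1⟩) (polar_eq_zero hF0) hFf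
  obtain ⟨T₂, hT₂⟩ := exists_isGivenBy_mul_log hn hG hG0
  obtain ⟨J, hJ⟩ := exists_nat_gt m
  obtain ⟨U, b, hU, hb, hUb⟩ := exists_symbol_of_expansion hn hf hQ
    (fun j => (hh j).add (hq j).homFun) hc (polar_eq_zero hF0) hFf
    hG0 hGQ hT₁ hT₂ (J := J) fun j hj => PolyHom.eq_zero_of_neg hp' hJ hj
  have hqe := hasExp_polyEval hq (J := J) fun j hj => PolyHom.eq_zero_of_neg hq hJ hj
  -- The Borel sum has the symbol `b` with terms `h j + q j`. Removing the terms of `a` and adding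
  -- back those of the polynomial `∑ q j` leaves the zero expansion, so `a - b + ∑ q j` is a
  -- Schwartz function.
  have hdiff := (hah.sub hb).add hqe
  simp only [sub_add_cancel_left, neg_add_cancel] at hdiff
  obtain ⟨S, hS⟩ := hdiff.exists_schwartz
  obtain ⟨P, hP, hqP⟩ := exists_polyD_delta_eq_polyDist
    (mem_polysOfDegree_neg (sum_mem_polysOfDegree hq J))
  have hTe : T = U + polyDist (-∑ j ∈ Finset.range J, q j) + schwartzDist S := by
    refine hT.unique (((hUb.add (isGivenBy_polyDist _)).add (isGivenBy_schwartz S)).congr_ae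
      (Eventually.of_forall fun ξ => ?_))
    beta_reduce
    rw [hS, hpp' J hJ]
    simp only [polyEval, map_neg]
    ring
  refine ⟨F, G, P, schwartzFourier n S, T₁, T₂, hF, hF0, hG, hG0, hflat, hint, ?_, hT₁, hT₂, ?_⟩
  · rwa [show -(-(n : ℝ) - m) - n = m by ring]
  · rw [hTe, distFourier_add, distFourier_add, ← hU, ← hqP, distFourier_schwartzDist]

end Main

end

theorem proposition6 (n : ℕ) (hn : 1 ≤ n) (m : ℝ) :
    Set.MapsTo (distFourier n) (symbolSpace n m) (spaceC n (-(n : ℝ) - m)) ∧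
    ∀ θ : Rn n → ℝ, IsPatch θ →
      Set.BijOn (distFourier n) (logSymbolSpace n m θ) (spaceC n (-(n : ℝ) - m)) := by
  refine ⟨fun T hT => mapsTo_distFourier hn ?_, fun θ hθ => ⟨fun T hT => ?_,
    distFourier_injective.injOn, fun T hT => ?_⟩⟩
  · obtain ⟨a, ha, hTa⟩ := hT
    refine ⟨a, 0, ha, Or.inl rfl, ?_⟩
    simpa only [polyEval_zero, mul_zero, zero_mul, add_zero] using hTa
  · exact mapsTo_distFourier hn (logSymbolSpace_subset hθ isPatch_patch hT)
  · exact (surjOn_distFourier hn).mono (logSymbolSpace_subset isPatch_patch hθ) subset_rfl hT
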